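/- Two number fields $K,L\subseteq\overline{\mathbb Q}$ are called Sylow-conjugate if for every prime $p$ the $p$-Sylow subgroups of the absolute Galois groups $\mathrm{Gal}(\overline{\mathbb Q}/K)$ and $\mathrm{Gal}(\overline{\mathbb Q}/L)$ (closed pro-$p$ subgroups of index prime to $p$) are conjugate in $\mathrm{Gal}(\overline{\mathbb Q}/\mathbb Q)$. (a) Let $p_7(x)=x^7-7x+3$ and $q_7(x)=x^7+14x^4-42x^2-21x+9$. Both are irreducible over $\mathbb Q$, and for any roots $\alpha,\beta\in\overline{\mathbb Q}$ of $p_7$ and $q_7$, respectively, the fields $K=\mathbb Q(\alpha)$ and $L=\mathbb Q(\beta)$ are Sylow-conjugate but not isomorphic; they have the same Galois closure $M$ over $\mathbb Q$, and $\mathrm{Gal}(M/\mathbb Q)\cong \mathrm{PSL}_3(2)$. (b) Let $p_8(x)=x^8-4x^7-4x^6+26x^5+2x^4-52x^3+31x+1$ and $q_8(x)=x^8+12x^7+30x^6-108x^5-402x^4+342x^3+1256x^2-687x-337$. Both are irreducible over $\mathbb Q$, and for any roots $\alpha,\beta\in\overline{\mathbb Q}$ of $p_8$ and $q_8$, respectively,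 the fields $K=\mathbb Q(\alpha)$ and $L=\mathbb Q(\beta)$ are Sylow-conjugate but not isomorphic; they have the same Galois closure $M$ over $\mathbb Q$, and $\mathrm{Gal}(M/\mathbb Q)\cong \mathrm{GL}_2(3)$. In particular, a number field is not determined by the Sylow subgroups of its absolute Galois group: there are non-isomorphic number fields $K,L\subseteq\overline{\mathbb Q}$ such that for every prime $p$ the $p$-Sylow subgroups of $\mathrm{Gal}(\overline{\mathbb Q}/K)$ and $\mathrm{Gal}(\overline{\mathbb Q}/L)$ are isomorphic as profinite groups. -/

import Mathlib

open Polynomial IntermediateField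

section SylowConj

/-- For a profinite group `P` this says that `P` is pro-`p`: every quotient of `P` by an open normal
subgroup is a `p`-group. -/
def IsProP (p : ℕ) (P : Type*) [Group P] [TopologicalSpace P] : Prop :=
  ∀ (N : Subgroup P) [N.Normal], IsOpen (N : Set P) → IsPGroup p (P ⧸ N)

/-- `P` is a `p`-Sylow subgroup of the profinite group `U`: a closed pro-`p` subgroup whose
(supernatural) index is prime to `p`. The index of `P` is the least common multiple of the
(finite) indices of the open subgroups of `U` containing `P`. -/
structure IsProSylow (p : ℕ) {U : Type*} [Group U] [TopologicalSpace U] (P : Subgroup U) :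
    Prop where
  isClosed : IsClosed (P : Set U)
  isProP : IsProP p P
  not_dvd_index : ∀ H : Subgroup U, IsOpen (H : Set U) → P ≤ H → ¬ p ∣ H.index

/-- Closed subgroups `U`, `V` of a profinite group `G` are Sylow-conjugate: for every prime `p` both
have `p`-Sylow subgroups, and any `p`-Sylow subgroup of `U` is conjugate within `G` to any
`p`-Sylow subgroup of `V`. -/
def SylowConjugateSubgroups {G : Type*} [Group G] [TopologicalSpace G] (U V : Subgroup G) :
    Prop :=
  ∀ p : ℕ, p.Prime →
    (∃ P : Subgroup U, IsProSylow p P) ∧ (∃ Q : Subgroup V, IsProSylow p Q) ∧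
    ∀ (P : Subgroup U) (Q : Subgroup V), IsProSylow p P → IsProSylow p Q →
      ∃ g : G, Q.map V.subtype = (P.map U.subtype).map (MulAut.conj g).toMonoidHom

/-- For every prime `p` the profinite groups `U` and `V` have `p`-Sylow subgroups, and any
`p`-Sylow subgroup of `U` is isomorphic, as a topological group, to any `p`-Sylow subgroup
of `V`. -/
def HaveIsomorphicSylows (U V : Type*) [Group U] [TopologicalSpace U] [Group V]
    [TopologicalSpace V] : Prop :=
  ∀ p : ℕ, p.Prime →
    (∃ P : Subgroup U, IsProSylow p P) ∧ (∃ Q : Subgroup V, IsProSylow p Q) ∧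
    ∀ (P : Subgroup U) (Q : Subgroup V), IsProSylow p P → IsProSylow p Q →
      Nonempty (P ≃ₜ* Q)

/-- Subfields `K`, `L` of an algebraic closure `Ω` of `ℚ` are Sylow-conjugate: their absolute Galois
groups `Gal(Ω/K)` and `Gal(Ω/L)`, regarded as subgroups of `Gal(Ω/ℚ)` (with the Krull topology),
are Sylow-conjugate in `Gal(Ω/ℚ)`. -/
def SylowConjugateFields {Ω : Type*} [Field Ω] [Algebra ℚ Ω] (K L : IntermediateField ℚ Ω) :
    Prop :=
  SylowConjugateSubgroups K.fixingSubgroup L.fixingSubgroup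

end SylowConj

section GaloisClosure

/-- The Galois (normal) closure inside `Ω` of an intermediate field `K` of `Ω/k`. -/
noncomputable def galoisClosure {k Ω : Type*} [Field k] [Field Ω] [Algebra k Ω]
    (K : IntermediateField k Ω) : IntermediateField k Ω :=
  IntermediateField.normalClosure k K Ω

/-- The group of automorphisms over `k` of an intermediate field `M` of `Ω/k`. -/
abbrev galoisGroup {k Ω : Type*} [Field k] [Field Ω] [Algebra k Ω]
    (M : IntermediateField k Ω) : Type _ :=
  M ≃ₐ[k] M

end GaloisClosure

section Polys

/-- The polynomial `p₇`. -/
noncomputable def polyP7 : ℚ[X] := X ^ 7 - 7 * X + 3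

/-- The polynomial `q₇`. -/
noncomputable def polyQ7 : ℚ[X] := X ^ 7 + 14 * X ^ 4 - 42 * X ^ 2 - 21 * X + 9

/-- The polynomial `p₈`. -/
noncomputable def polyP8 : ℚ[X] :=
  X ^ 8 - 4 * X ^ 7 - 4 * X ^ 6 + 26 * X ^ 5 + 2 * X ^ 4 - 52 * X ^ 3 + 31 * X + 1

/-- The polynomial `q₈`. -/
noncomputable def polyQ8 : ℚ[X] :=
  X ^ 8 + 12 * X ^ 7 + 30 * X ^ 6 - 108 * X ^ 5 - 402 * X ^ 4 + 342 * X ^ 3 + 1256 * X ^ 2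
    - 687 * X - 337

end Polys

/-! ### Relative index under homomorphisms. -/

section Index

/-! Each pair of polynomials realises a duality between vectors and covectors. Let H be `GL₃(2)` in
(a) and `GL₂(3)` in (b). The roots of p are labelled by the nonzero vectors, the roots of q by the
nonzero covectors, and the absolute Galois group acts on both through one surjection ρ onto H. The
fixing subgroups of K and L are then the preimages of the stabilizer A of a vector and the
stabilizer B of a covector, and everything is read off from (H, A, B) in
`conclusions_of_linear_representation`. The orbits span, so A and B have trivial core; hence both
Galois closures have fixing group `ker ρ` and Galois group H. No conjugate of A lies in B, because
some transvection or reflection fixes a given vector and moves a given covector; so the fields are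
not isomorphic.

For Sylow-conjugacy, if p does not divide the index 7 or 8, then A and B both contain Sylow
subgroups of H, which are conjugate. For p = 7 the orders of A and B are prime to p. For p = 2 in
`GL₂(3)` the Sylow subgroups of A and B have order two and are generated by conjugate reflections.
The profinite Sylow theorems carry this to the absolute Galois groups (`isProSylow_conj_of_conj`).

To construct ρ, a constant multiple of p(x) is factored modulo q(y) as C(y, x) D(y, x) with C cubic
in x. The vanishing of C is a Galois invariant incidence relation: each root of q is a line with
three points. Frobenius at 2, respectively 3, permutes the roots of p in one cycle and those of q in
one cycle, so the labels can be taken in `ZMod n` and incidence depends on the difference of labels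
only. Which differences occur is decided in characteristic 2 or 3, where D is nonzero at the
required pairs (`exists_cyclic_configuration`). The labels on a line sum to zero, so
incidence-preserving permutations are linear.

Surjectivity of ρ comes from Frobenius elements at several primes: their orbit lengths force the
order of the image to be divisible by 84, respectively 24. Index two is impossible in `GL₃(2)`,
where transvections are squares; in `GL₂(3)` it leaves only the subgroup of determinant one, which
misses the Frobenius element of order eight. -/

theorem Subgroup.relIndex_map_dvd {G G' : Type*} [Group G] [Group G'] (f : G →* G')
    (H K : Subgroup G) : (H.map f).relIndex (K.map f) ∣ H.relIndex K := by
  have h1 := Subgroup.index_map_dvd (H.subgroupOf K) (f.subgroupMap_surjective K)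
  refine dvd_trans (Subgroup.index_dvd_of_le ?_) h1
  rintro _ ⟨x, hx, rfl⟩
  exact ⟨x, hx, rfl⟩

end Index

/-! ### Sylow theory for profinite groups. -/

section ProPGroups

open Subgroup

variable {U W : Type*} [Group U] [TopologicalSpace U] [Group W] [TopologicalSpace W]

theorem isProP_iff {p : ℕ} : IsProP p U ↔
    ∀ N : Subgroup U, N.Normal → IsOpen (N : Set U) → ∀ x : U, ∃ k : ℕ, x ^ p ^ k ∈ N := by
  refine ⟨fun h N hN ho x => ?_, fun h N hN ho => ?_⟩
  · obtain ⟨k, hk⟩ := h N ho (x : U ⧸ N)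
    exact ⟨k, (QuotientGroup.eq_one_iff _).1 hk⟩
  · intro x
    obtain ⟨x, rfl⟩ := QuotientGroup.mk_surjective x
    obtain ⟨k, hk⟩ := h N hN ho x
    exact ⟨k, (QuotientGroup.eq_one_iff _).2 hk⟩

theorem IsProP.of_surjective {p : ℕ} (h : IsProP p W) (f : W →* U) (hf : Continuous f)
    (hs : Function.Surjective f) : IsProP p U := by
  rw [isProP_iff] at h ⊢
  intro N hN ho x
  obtain ⟨x, rfl⟩ := hs x
  obtain ⟨k, hk⟩ := h (N.comap f) inferInstance (ho.preimage hf) x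
  exact ⟨k, by simpa using hk⟩

/-- The index of an open overgroup divides the product of its index inside the range of `f` and the
index of that range, and p divides neither factor. -/
theorem IsProSylow.map {p : ℕ} {P : Subgroup W} (hP : IsProSylow p P) (f : W →* U)
    (hf : Topology.IsClosedEmbedding f) (hp : p.Prime) (hi : ¬ p ∣ f.range.index) :
    IsProSylow p (P.map f) where
  isClosed := by
    rw [Subgroup.coe_map]
    exact hf.isClosedMap _ hP.isClosed
  isProP := hP.isProP.of_surjective (f.subgroupMap P)
    ((hf.continuous.comp continuous_subtype_val).subtype_mk _) (f.subgroupMap_surjective P)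
  not_dvd_index H hH hle := by
    have h1 := hP.not_dvd_index (H.comap f) (hH.preimage hf.continuous)
      (Subgroup.map_le_iff_le_comap.1 hle)
    rw [Subgroup.index_comap] at h1
    intro h2
    have h3 : H.index ∣ (H ⊓ f.range).index := Subgroup.index_dvd_of_le inf_le_left
    rw [← Subgroup.relIndex_mul_index (inf_le_right : H ⊓ f.range ≤ f.range),
      Subgroup.inf_relIndex_right] at h3
    rcases hp.dvd_mul.1 (h2.trans h3) with h | h
    · exact h1 h
    · exact hi h

variable [IsTopologicalGroup U]

theorem IsProSylow.exists_sylow {p : ℕ} [hp : Fact p.Prime] {P : Subgroup U} (hP : IsProSylow p P)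
    (M : OpenNormalSubgroup U) :
    ∃ S : Sylow p (U ⧸ M.toSubgroup), (S : Subgroup _) = P.map (QuotientGroup.mk' M.toSubgroup) := by
  have h1 : IsPGroup p (P.map (QuotientGroup.mk' M.toSubgroup)) := by
    rintro ⟨_, x, hx, rfl⟩
    obtain ⟨k, hk⟩ := isProP_iff.1 hP.isProP (M.toSubgroup.subgroupOf P) inferInstance
      (M.isOpen'.preimage continuous_subtype_val) ⟨x, hx⟩
    refine ⟨k, Subtype.ext ?_⟩
    have : x ^ p ^ k ∈ M.toSubgroup := by simpa [Subgroup.mem_subgroupOf] using hk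
    simpa using (QuotientGroup.eq_one_iff _).2 this
  have h2 : ¬ p ∣ (P.map (QuotientGroup.mk' M.toSubgroup)).index := by
    rw [← Subgroup.index_comap_of_surjective _ (QuotientGroup.mk'_surjective M.toSubgroup)]
    refine hP.not_dvd_index _ ?_ (Subgroup.le_comap_map _ _)
    refine Subgroup.isOpen_mono ?_ M.isOpen'
    intro x hx
    have : QuotientGroup.mk' M.toSubgroup x = 1 := (QuotientGroup.eq_one_iff _).2 hx
    simp only [Subgroup.mem_comap, this, one_mem]
  exact ⟨h1.toSylow h2, rfl⟩

variable [CompactSpace U] [TotallyDisconnectedSpace U]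

/-- A point outside a closed subgroup has a whole coset of some open normal subgroup outside it, so
closed subgroups are detected in the finite quotients. -/
theorem Subgroup.mem_of_forall_openNormal {Q : Subgroup U} (hQ : IsClosed (Q : Set U)) {x : U}
    (h : ∀ M : OpenNormalSubgroup U, ∃ y ∈ Q, y⁻¹ * x ∈ M.toSubgroup) : x ∈ Q := by
  by_contra hx
  have ho : IsOpen ((fun y => x * y⁻¹) ⁻¹' (Q : Set U)ᶜ) :=
    hQ.isOpen_compl.preimage (by fun_prop)
  obtain ⟨M, hM⟩ := ProfiniteGrp.exist_openNormalSubgroup_sub_open_nhds_of_one ho (by simpa using hx)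
  obtain ⟨y, hy, hxy⟩ := h M
  have := hM hxy
  simp only [Set.mem_preimage, mul_inv_rev, inv_inv, mul_inv_cancel_left] at this
  exact this hy

theorem Subgroup.le_of_forall_openNormal {P Q : Subgroup U} (hQ : IsClosed (Q : Set U))
    (h : ∀ M : OpenNormalSubgroup U, P.map (QuotientGroup.mk' M.toSubgroup) ≤
      Q.map (QuotientGroup.mk' M.toSubgroup)) : P ≤ Q := by
  intro x hx
  refine Subgroup.mem_of_forall_openNormal hQ fun M => ?_
  obtain ⟨y, hy, hyx⟩ := h M (Subgroup.mem_map_of_mem _ hx)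
  exact ⟨y, hy, (QuotientGroup.eq).1 hyx⟩

/-- For each open normal M, the elements that conjugate P to Q modulo M form a closed set, nonempty
by the Sylow theorem in the finite quotient. These sets are directed, so by compactness they have a
common element. -/
theorem IsProSylow.exists_conj {p : ℕ} (hp : p.Prime) {P Q : Subgroup U} (hP : IsProSylow p P)
    (hQ : IsProSylow p Q) : ∃ g : U, Q = P.map (MulAut.conj g).toMonoidHom := by
  have := Fact.mk hp
  let C (M : OpenNormalSubgroup U) : Set U :=
    {g | (P.map (MulAut.conj g).toMonoidHom).map (QuotientGroup.mk' M.toSubgroup) =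
      Q.map (QuotientGroup.mk' M.toSubgroup)}
  have hcomm (M : OpenNormalSubgroup U) (g : U) :
      (P.map (MulAut.conj g).toMonoidHom).map (QuotientGroup.mk' M.toSubgroup) =
      (P.map (QuotientGroup.mk' M.toSubgroup)).map
        (MulAut.conj (QuotientGroup.mk' M.toSubgroup g)).toMonoidHom := by
    rw [Subgroup.map_map, Subgroup.map_map]
    congr 1
  have hmono {M M' : OpenNormalSubgroup U} (h : M ≤ M') : C M ⊆ C M' := by
    intro g hg
    have key (R : Subgroup U) : (R.map (QuotientGroup.mk' M.toSubgroup)).map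
        (QuotientGroup.map M.toSubgroup M'.toSubgroup (MonoidHom.id U) h) =
        R.map (QuotientGroup.mk' M'.toSubgroup) := by
      rw [Subgroup.map_map]; congr 1
    change _ = _
    rw [← key, ← key, show _ = _ from hg]
  have hclosed (M : OpenNormalSubgroup U) : IsClosed (C M) := by
    have := QuotientGroup.discreteTopology (N := M.toSubgroup) M.isOpen'
    have : C M = (QuotientGroup.mk' M.toSubgroup) ⁻¹' {x | (P.map (QuotientGroup.mk' M.toSubgroup)).map
        (MulAut.conj x).toMonoidHom = Q.map (QuotientGroup.mk' M.toSubgroup)} := by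
      ext g
      simp only [C, Set.mem_ofPred_eq, Set.mem_preimage, hcomm]
    rw [this]
    exact IsClosed.preimage (f := QuotientGroup.mk' M.toSubgroup) QuotientGroup.continuous_mk
      (isClosed_discrete _)
  have hne (M : OpenNormalSubgroup U) : (C M).Nonempty := by
    have : Finite (U ⧸ M.toSubgroup) := Subgroup.quotient_finite_of_isOpen _ M.isOpen'
    obtain ⟨S, hS⟩ := hP.exists_sylow M
    obtain ⟨T, hT⟩ := hQ.exists_sylow M
    obtain ⟨x, hx⟩ := MulAction.exists_smul_eq (U ⧸ M.toSubgroup) S T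
    obtain ⟨g, rfl⟩ := QuotientGroup.mk'_surjective _ x
    refine ⟨g, ?_⟩
    change _ = _
    rw [hcomm, ← hS, ← hT, ← hx]
    rfl
  have hdir : Directed (fun x1 x2 => x1 ⊇ x2) C := fun M M' =>
    ⟨M ⊓ M', hmono inf_le_left, hmono inf_le_right⟩
  have : Nonempty (OpenNormalSubgroup U) :=
    ⟨(ProfiniteGrp.exist_openNormalSubgroup_sub_open_nhds_of_one isOpen_univ
      (Set.mem_univ (1 : U))).choose⟩
  obtain ⟨g, hg⟩ := IsCompact.nonempty_iInter_of_directed_nonempty_isCompact_isClosed C hdir hne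
    (fun M => (hclosed M).isCompact) hclosed
  rw [Set.mem_iInter] at hg
  refine ⟨g, le_antisymm (Subgroup.le_of_forall_openNormal ?_ fun M => (hg M).ge)
    (Subgroup.le_of_forall_openNormal hQ.isClosed fun M => (hg M).le)⟩
  rw [Subgroup.coe_map]
  exact (hP.isClosed.isCompact.image
    (show Continuous fun x => g * x * g⁻¹ by fun_prop)).isClosed

/-- By Zorn there is a minimal closed subgroup of index prime to p. It is pro-p: in a finite
quotient of it, the preimage of a Sylow subgroup would again be closed of index prime to p, so by
minimality it is everything. -/
theorem exists_isProSylow {p : ℕ} (hp : p.Prime) : ∃ P : Subgroup U, IsProSylow p P := by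
  have := Fact.mk hp
  let F : Set (Subgroup U) := {P | IsClosed (P : Set U) ∧
    ∀ H : Subgroup U, IsOpen (H : Set U) → P ≤ H → ¬ p ∣ H.index}
  have htop : (⊤ : Subgroup U) ∈ F := by
    refine ⟨isClosed_univ, fun H _ hle => ?_⟩
    rw [top_le_iff.1 hle, Subgroup.index_top]
    exact hp.one_lt.ne' ∘ Nat.dvd_one.1
  have hchain (c : Set (Subgroup U)) (hc : c ⊆ F) (hdir : DirectedOn (· ≥ ·) c) (hne : c.Nonempty) :
      sInf c ∈ F := by
    have : Nonempty c := hne.to_subtype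
    refine ⟨?_, fun H hH hle hdvd => ?_⟩
    · rw [Subgroup.coe_sInf]
      exact isClosed_biInter fun P hP => (hc hP).1
    -- If no member of the chain were contained in the open subgroup `H`, compactness would give a
    -- point of the intersection outside `H`.
    · obtain ⟨x, hx⟩ := IsCompact.nonempty_iInter_of_directed_nonempty_isCompact_isClosed
        (fun P : c => ((P : Subgroup U) : Set U) ∩ (H : Set U)ᶜ)
        (fun P Q => by
          obtain ⟨R, hR, hRP, hRQ⟩ := hdir P P.2 Q Q.2
          exact ⟨⟨R, hR⟩, Set.inter_subset_inter_left _ hRP, Set.inter_subset_inter_left _ hRQ⟩)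
        (fun P => by
          by_contra hne
          refine (hc P.2).2 H hH (fun z hz => ?_) hdvd
          by_contra hzH
          exact hne ⟨z, hz, hzH⟩)
        (fun P => ((hc P.2).1.inter hH.isClosed_compl).isCompact)
        (fun P => (hc P.2).1.inter hH.isClosed_compl)
      rw [Set.mem_iInter] at hx
      obtain ⟨y, hy⟩ := hne
      refine (hx ⟨y, hy⟩).2 (hle ?_)
      rw [Subgroup.mem_sInf]
      exact fun P hP => (hx ⟨P, hP⟩).1
  obtain ⟨P, hP⟩ : ∃ P : Subgroup U, Minimal (· ∈ F) P := by
    obtain ⟨P, -, hP⟩ := zorn_le_nonempty₀ (α := (Subgroup U)ᵒᵈ) (OrderDual.ofDual ⁻¹' F)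
      (fun c hc hch y hy => ⟨OrderDual.toDual (sInf (OrderDual.toDual ⁻¹' c)),
        hchain (OrderDual.toDual ⁻¹' c) (fun P hP => hc hP) (fun P hP Q hQ => by
          rcases hch.total hP hQ with h | h
          · exact ⟨Q, hQ, h, le_rfl⟩
          · exact ⟨P, hP, le_rfl, h⟩) ⟨_, hy⟩,
        fun P hP => sInf_le (α := Subgroup U) hP⟩) (OrderDual.toDual ⊤) htop
    exact ⟨P.ofDual, hP⟩
  refine ⟨P, hP.prop.1, fun N hN ho => ?_, hP.prop.2⟩
  have hPc : CompactSpace P := isCompact_iff_compactSpace.1 hP.prop.1.isCompact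
  have hfin : Finite (P ⧸ N) := Subgroup.quotient_finite_of_isOpen N ho
  obtain ⟨S⟩ : Nonempty (Sylow p (P ⧸ N)) := inferInstance
  let P₀ : Subgroup P := (S : Subgroup (P ⧸ N)).comap (QuotientGroup.mk' N)
  have hNP₀ : N ≤ P₀ := fun x hx => by
    have : QuotientGroup.mk' N x = 1 := (QuotientGroup.eq_one_iff _).2 hx
    simp only [P₀, Subgroup.mem_comap, this, one_mem]
  have hidx : ¬ p ∣ P₀.index := by
    rw [Subgroup.index_comap_of_surjective _ (QuotientGroup.mk'_surjective N)]
    exact S.not_dvd_index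
  have hmem : P₀.map P.subtype ∈ F := by
    refine ⟨?_, fun H hH hle hdvd => ?_⟩
    · rw [Subgroup.coe_map]
      have hcl : IsClosed (P₀ : Set P) := Subgroup.isClosed_of_isOpen _ (Subgroup.isOpen_mono hNP₀ ho)
      exact hP.prop.1.isClosedEmbedding_subtypeVal.isClosedMap _ hcl
    -- Indices are compared in a finite quotient by some `M` inside `H`, where they are
    -- multiplicative natural numbers.
    · obtain ⟨M, hM⟩ := ProfiniteGrp.exist_openNormalSubgroup_sub_open_nhds_of_one hH (one_mem H)
      let π := QuotientGroup.mk' M.toSubgroup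
      have hker : M.toSubgroup ≤ H := hM
      have e : (H.map π).index = H.index := by
        rw [← Subgroup.index_comap_of_surjective _ (QuotientGroup.mk'_surjective M.toSubgroup),
          Subgroup.comap_map_eq, QuotientGroup.ker_mk', sup_eq_left.2 hker]
      have h1 : ((P₀.map P.subtype).map π).relIndex (P.map π) ∣ P₀.index := by
        have := Subgroup.relIndex_map_dvd π (P₀.map P.subtype) P
        rwa [Subgroup.relIndex, Subgroup.relIndex, ← Subgroup.relIndex, ← Subgroup.comap_subtype (P₀.map P.subtype),
          Subgroup.comap_map_eq_self_of_injective P.subtype_injective] at this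
      have h2 : ¬ p ∣ (P.map π).index := by
        rw [← Subgroup.index_comap_of_surjective _ (QuotientGroup.mk'_surjective M.toSubgroup)]
        refine hP.prop.2 _ (Subgroup.isOpen_mono (fun x hx => ?_) M.isOpen') (Subgroup.le_comap_map _ _)
        have : QuotientGroup.mk' M.toSubgroup x = 1 := (QuotientGroup.eq_one_iff _).2 hx
        simp only [Subgroup.mem_comap, π, this, one_mem]
      have h3 : H.index ∣ ((P₀.map P.subtype).map π).index :=
        e ▸ Subgroup.index_dvd_of_le (Subgroup.map_mono hle)
      rw [← Subgroup.relIndex_mul_index (Subgroup.map_mono (f := π) (Subgroup.map_subtype_le P₀))] at h3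
      rcases hp.dvd_mul.1 (hdvd.trans h3) with h | h
      · exact hidx (h.trans h1)
      · exact h2 h
  have hle : P ≤ P₀.map P.subtype := hP.2 hmem (Subgroup.map_subtype_le P₀)
  intro x
  obtain ⟨x, rfl⟩ := QuotientGroup.mk'_surjective N x
  obtain ⟨y, hy, hyx⟩ := hle x.2
  obtain rfl : y = x := Subtype.ext hyx
  obtain ⟨k, hk⟩ := S.isPGroup' ⟨_, hy⟩
  exact ⟨k, congrArg Subtype.val hk⟩

end ProPGroups

/-! ### Transfer of Sylow subgroups between conjugate subgroups. -/

section Conjugacy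

variable {G : Type*} [Group G] [TopologicalSpace G] [IsTopologicalGroup G] [CompactSpace G]
  [TotallyDisconnectedSpace G]

/-- If `U'` has index prime to `p` in `U` and a conjugate of `U'` has index prime to `p` in `V`, then
the `p`-Sylow subgroups of `U` and `V` are conjugate. -/
theorem isProSylow_conj_of_conj {p : ℕ} (hp : p.Prime) {U V U' : Subgroup G} (g : G)
    (hU : IsClosed (U : Set G)) (hV : IsClosed (V : Set G)) (hU' : IsClosed (U' : Set G))
    (hle : U' ≤ U) (hle' : U'.map (MulAut.conj g).toMonoidHom ≤ V)
    (hi : ¬ p ∣ U'.relIndex U) (hi' : ¬ p ∣ (U'.map (MulAut.conj g).toMonoidHom).relIndex V) :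
    (∃ P : Subgroup U, IsProSylow p P) ∧ (∃ Q : Subgroup V, IsProSylow p Q) ∧
    ∀ (P : Subgroup U) (Q : Subgroup V), IsProSylow p P → IsProSylow p Q →
      ∃ g : G, Q.map V.subtype = (P.map U.subtype).map (MulAut.conj g).toMonoidHom := by
  have := isCompact_iff_compactSpace.1 hU.isCompact
  have := isCompact_iff_compactSpace.1 hV.isCompact
  have := isCompact_iff_compactSpace.1 hU'.isCompact
  obtain ⟨R, hR⟩ := exists_isProSylow (U := U') hp
  let f₁ : U' →* U := Subgroup.inclusion hle
  let f₂ : U' →* V := ((MulAut.conj g).toMonoidHom.comp U'.subtype).codRestrict V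
    fun x => hle' ⟨x, x.2, rfl⟩
  have hf₁ : Topology.IsClosedEmbedding f₁ := by
    refine Continuous.isClosedEmbedding (continuous_subtype_val.subtype_mk _) ?_
    exact Subgroup.inclusion_injective hle
  have hf₂ : Topology.IsClosedEmbedding f₂ := by
    refine Continuous.isClosedEmbedding (Continuous.subtype_mk
      (show Continuous fun x : U' => g * x * g⁻¹ by fun_prop) _) ?_
    intro x y hxy
    exact Subtype.ext ((MulAut.conj g).injective (congrArg Subtype.val hxy))
  have h₁ : IsProSylow p (R.map f₁) := hR.map f₁ hf₁ hp (by rwa [Subgroup.inclusion_range])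
  have hr₂ : f₂.range = (U'.map (MulAut.conj g).toMonoidHom).subgroupOf V := by
    ext x
    constructor
    · rintro ⟨y, rfl⟩
      exact ⟨y, y.2, rfl⟩
    · rintro ⟨y, hy, hyx⟩
      exact ⟨⟨y, hy⟩, Subtype.ext hyx⟩
  have h₂ : IsProSylow p (R.map f₂) := hR.map f₂ hf₂ hp (by rwa [hr₂])
  refine ⟨⟨_, h₁⟩, ⟨_, h₂⟩, fun P Q hP hQ => ?_⟩
  obtain ⟨a, ha⟩ := hP.exists_conj hp h₁
  obtain ⟨b, hb⟩ := h₂.exists_conj hp hQ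
  refine ⟨b * g * a, ?_⟩
  have key : (R.map f₂).map V.subtype =
      ((R.map f₁).map U.subtype).map (MulAut.conj g).toMonoidHom := by
    simp only [Subgroup.map_map]
    congr 1
  have hconj (W : Subgroup G) (w : W) (T : Subgroup W) :
      (T.map (MulAut.conj w).toMonoidHom).map W.subtype =
      (T.map W.subtype).map (MulAut.conj (w : G)).toMonoidHom := by
    simp only [Subgroup.map_map]
    congr 1
  rw [hb, hconj, key, ha, hconj]
  simp only [Subgroup.map_map]
  congr 1
  ext x
  simp [mul_assoc]

/-- The restriction of a topological embedding of groups to a subgroup. -/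
noncomputable def Subgroup.continuousEquivMap {A B : Type*} [Group A] [TopologicalSpace A] [Group B]
    [TopologicalSpace B] (f : A →* B) (hf : Topology.IsEmbedding f) (P : Subgroup A) :
    P ≃ₜ* P.map f where
  __ := P.equivMapOfInjective f hf.injective
  continuous_toFun := (hf.continuous.comp continuous_subtype_val).subtype_mk _
  continuous_invFun := by
    rw [(hf.comp Topology.IsEmbedding.subtypeVal).isInducing.continuous_iff]
    convert continuous_subtype_val using 1
    ext x
    exact congrArg Subtype.val ((P.equivMapOfInjective f hf.injective).apply_symm_apply x)

theorem SylowConjugateSubgroups.haveIsomorphicSylows {U V : Subgroup G}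
    (h : SylowConjugateSubgroups U V) : HaveIsomorphicSylows U V := by
  intro p hp
  obtain ⟨hP, hQ, hconj⟩ := h p hp
  refine ⟨hP, hQ, fun P Q hP hQ => ?_⟩
  obtain ⟨g, hg⟩ := hconj P Q hP hQ
  let e₁ := Subgroup.continuousEquivMap U.subtype Topology.IsEmbedding.subtypeVal P
  let e₂ := Subgroup.continuousEquivMap V.subtype Topology.IsEmbedding.subtypeVal Q
  have hc : Topology.IsEmbedding (MulAut.conj g).toMonoidHom := by
    refine Topology.IsClosedEmbedding.isEmbedding (Continuous.isClosedEmbedding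
      (show Continuous fun x => g * x * g⁻¹ by fun_prop) (MulAut.conj g).injective)
  let e₃ := Subgroup.continuousEquivMap (MulAut.conj g).toMonoidHom hc (P.map U.subtype)
  rw [hg] at e₂
  exact ⟨(e₁.trans e₃).trans e₂.symm⟩

end Conjugacy

/-! ### Galois closures and fixing subgroups as preimages under ρ. -/

section GaloisDescent

open Pointwise

variable {k Ω : Type*} [Field k] [Field Ω] [Algebra k Ω]

/-- The Galois closure is the compositum of all conjugates of K, so its fixing subgroup is the
intersection of the conjugates of that of K. -/
theorem mem_fixingSubgroup_galoisClosure_iff [Normal k Ω] (K : IntermediateField k Ω) (τ : Gal(Ω/k)) :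
    τ ∈ (galoisClosure K).fixingSubgroup ↔ ∀ σ : Gal(Ω/k), σ⁻¹ * τ * σ ∈ K.fixingSubgroup := by
  rw [galoisClosure, normalClosure_def'']
  have h : τ ∈ (⨆ f : Gal(Ω/k), K.map (f : Ω →ₐ[k] Ω)).fixingSubgroup ↔
      (⨆ f : Gal(Ω/k), K.map (f : Ω →ₐ[k] Ω)) ≤ fixedField (Subgroup.zpowers τ) := by
    rw [le_iff_le, Subgroup.zpowers_le]
  rw [h, iSup_le_iff]
  refine forall_congr' fun σ => ?_
  rw [le_iff_le, Subgroup.zpowers_le, IntermediateField.mem_fixingSubgroup_iff,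
    IntermediateField.mem_fixingSubgroup_iff]
  constructor
  · intro h x hx
    have := h (σ x) ⟨x, hx, rfl⟩
    rw [AlgEquiv.mul_apply, AlgEquiv.mul_apply, this]
    exact σ.symm_apply_apply x
  · rintro h _ ⟨x, hx, rfl⟩
    have := congrArg σ (h x hx)
    rw [AlgEquiv.mul_apply, AlgEquiv.mul_apply] at this
    exact (σ.apply_symm_apply _).symm.trans this

variable [IsGalois k Ω] {H : Type*} [Group H] {ρ : Gal(Ω/k) →* H} {K L : IntermediateField k Ω}
  {A B : Subgroup H}

theorem fixingSubgroup_galoisClosure_eq_ker (hρ : Function.Surjective ρ)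
    (hK : K.fixingSubgroup = A.comap ρ) (hA : ∀ x : H, (∀ g : H, g⁻¹ * x * g ∈ A) → x = 1) :
    (galoisClosure K).fixingSubgroup = ρ.ker := by
  ext τ
  rw [mem_fixingSubgroup_galoisClosure_iff, hK, MonoidHom.mem_ker]
  simp only [Subgroup.mem_comap, map_mul, map_inv]
  constructor
  · intro h
    refine hA _ fun g => ?_
    obtain ⟨σ, rfl⟩ := hρ g
    exact h σ
  · intro h σ
    simp [h]

theorem galoisClosure_eq_of_fixingSubgroup_eq (hρ : Function.Surjective ρ)
    (hK : K.fixingSubgroup = A.comap ρ) (hA : ∀ x : H, (∀ g : H, g⁻¹ * x * g ∈ A) → x = 1)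
    (hL : L.fixingSubgroup = B.comap ρ) (hB : ∀ x : H, (∀ g : H, g⁻¹ * x * g ∈ B) → x = 1) :
    galoisClosure K = galoisClosure L := by
  rw [← InfiniteGalois.fixedField_fixingSubgroup (galoisClosure K),
    ← InfiniteGalois.fixedField_fixingSubgroup (galoisClosure L),
    fixingSubgroup_galoisClosure_eq_ker hρ hK hA, fixingSubgroup_galoisClosure_eq_ker hρ hL hB]

theorem nonempty_galoisGroup_mulEquiv (hρ : Function.Surjective ρ)
    (hK : K.fixingSubgroup = A.comap ρ) (hA : ∀ x : H, (∀ g : H, g⁻¹ * x * g ∈ A) → x = 1) :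
    Nonempty (galoisGroup (galoisClosure K) ≃* H) := by
  have hn : Normal k (galoisClosure K) := normalClosure.normal k K Ω
  have hs := AlgEquiv.restrictNormalHom_surjective (F := k) (K₁ := galoisClosure K) Ω
  have hker : (AlgEquiv.restrictNormalHom (F := k) (K₁ := Ω) (galoisClosure K)).ker = ρ.ker := by
    rw [restrictNormalHom_ker, fixingSubgroup_galoisClosure_eq_ker hρ hK hA]
  exact ⟨((QuotientGroup.quotientKerEquivOfSurjective _ hs).symm.trans
    (QuotientGroup.quotientMulEquivOfEq hker)).trans
    (QuotientGroup.quotientKerEquivOfSurjective ρ hρ)⟩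

theorem isOpen_ker_of_fixingSubgroup_eq [FiniteDimensional k K] (hρ : Function.Surjective ρ)
    (hK : K.fixingSubgroup = A.comap ρ) (hA : ∀ x : H, (∀ g : H, g⁻¹ * x * g ∈ A) → x = 1) :
    IsOpen (ρ.ker : Set Gal(Ω/k)) := by
  have : FiniteDimensional k (galoisClosure K) := by unfold galoisClosure; infer_instance
  rw [← fixingSubgroup_galoisClosure_eq_ker hρ hK hA]
  exact IntermediateField.fixingSubgroup_isOpen _

end GaloisDescent

/-! ### Field isomorphism and Sylow-conjugacy in terms of the finite quotient. -/

section RationalGaloisDescent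

variable {Ω : Type*} [Field Ω] [Algebra ℚ Ω] [IsGalois ℚ Ω] {H : Type*} [Group H]
  {ρ : Gal(Ω/ℚ) →* H} {K L : IntermediateField ℚ Ω} {A B : Subgroup H}

/-- An isomorphism from K to L extends to an automorphism of Ω, which conjugates the fixing subgroup
of K into that of L; `hAB` says that no conjugate of A lies in B. -/
theorem isEmpty_ringEquiv_of_fixingSubgroup_eq
    (hK : K.fixingSubgroup = A.comap ρ) (hL : L.fixingSubgroup = B.comap ρ)
    (hρ : Function.Surjective ρ)
    (hAB : ∀ g : H, ∃ x : H, g⁻¹ * x * g ∈ A ∧ x ∉ B) : IsEmpty (K ≃+* L) := by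
  refine ⟨fun e => ?_⟩
  let σ : Gal(Ω/ℚ) := (RingEquiv.toRatAlgEquiv e).liftNormal Ω
  have hσ (x : K) : σ x = e x := (RingEquiv.toRatAlgEquiv e).liftNormal_commutes Ω x
  obtain ⟨x, hxA, hxB⟩ := hAB (ρ σ)
  obtain ⟨τ, rfl⟩ := hρ x
  refine hxB ?_
  rw [← Subgroup.mem_comap, ← hL, IntermediateField.mem_fixingSubgroup_iff]
  intro y hy
  have h1 : σ⁻¹ * τ * σ ∈ K.fixingSubgroup := by
    rw [hK, Subgroup.mem_comap]
    simpa using hxA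
  have h2 := hσ (e.symm ⟨y, hy⟩)
  rw [e.apply_symm_apply] at h2
  have h3 := congrArg σ ((IntermediateField.mem_fixingSubgroup_iff K _).1 h1 _ (e.symm ⟨y, hy⟩).2)
  rw [AlgEquiv.mul_apply, AlgEquiv.mul_apply, h2] at h3
  exact (σ.apply_symm_apply _).symm.trans h3

theorem sylowConjugateFields_of_fixingSubgroup_eq
    (hρ : Function.Surjective ρ)
    (hK : K.fixingSubgroup = A.comap ρ) (hker : IsOpen (ρ.ker : Set Gal(Ω/ℚ)))
    (hL : L.fixingSubgroup = B.comap ρ)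
    (hAB : ∀ p : ℕ, p.Prime → ∃ (C : Subgroup H) (g : H), C ≤ A ∧
      C.map (MulAut.conj g).toMonoidHom ≤ B ∧ ¬ p ∣ C.relIndex A ∧
      ¬ p ∣ (C.map (MulAut.conj g).toMonoidHom).relIndex B) : SylowConjugateFields K L := by
  intro p hp
  obtain ⟨C, g, hCA, hCB, hiA, hiB⟩ := hAB p hp
  obtain ⟨σ, rfl⟩ := hρ g
  have hclosed (D : Subgroup H) : IsClosed (D.comap ρ : Set Gal(Ω/ℚ)) :=
    Subgroup.isClosed_of_isOpen _ (Subgroup.isOpen_mono (MonoidHom.ker_le_comap _ _) hker)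
  have hconj : (C.comap ρ).map (MulAut.conj σ).toMonoidHom =
      (C.map (MulAut.conj (ρ σ)).toMonoidHom).comap ρ := by
    ext τ
    refine Subgroup.mem_map_equiv.trans (Iff.trans ?_ Subgroup.mem_map_equiv.symm)
    simp only [Subgroup.mem_comap, MulAut.conj_symm_apply, map_mul, map_inv]
  have hrel (D E : Subgroup H) : (D.comap ρ).relIndex (E.comap ρ) = D.relIndex E := by
    rw [Subgroup.relIndex_comap, Subgroup.map_comap_eq_self_of_surjective hρ]
  refine isProSylow_conj_of_conj hp (U' := C.comap ρ) σ (hK ▸ hclosed A) (hL ▸ hclosed B)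
    (hclosed C) ?_ ?_ ?_ ?_
  · rw [hK]; exact Subgroup.comap_mono hCA
  · rw [hL, hconj]; exact Subgroup.comap_mono hCB
  · rwa [hK, hrel]
  · rwa [hL, hconj, hrel]

end RationalGaloisDescent

/-! ### Frobenius automorphisms in the absolute Galois group. -/

section Frobenius

/-- For every prime `ℓ` there are a reduction map from the ring of algebraic integers of `Ω` to a
domain of characteristic `ℓ` and an automorphism of `Ω` that induces the Frobenius on it. -/
theorem exists_reduction_frobenius {Ω : Type*} [Field Ω] [Algebra ℚ Ω] [IsGalois ℚ Ω] {ℓ : ℕ}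
    (hℓ : ℓ.Prime) :
    ∃ (Q : Ideal (integralClosure ℤ Ω)) (σ : Gal(Ω/ℚ)), Q.IsPrime ∧
      (ℓ : integralClosure ℤ Ω) ∈ Q ∧
      ∀ x y : integralClosure ℤ Ω, (y : Ω) = σ x → y - x ^ ℓ ∈ Q := by
  have := Fact.mk hℓ
  have : CharZero Ω := algebraRat.charZero Ω
  let R := integralClosure ℤ Ω
  let P : Ideal ℤ := Ideal.span {(ℓ : ℤ)}
  have hPm : P.IsMaximal := PrincipalIdealRing.isMaximal_of_irreducible
    (Nat.prime_iff_prime_int.1 hℓ).irreducible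
  obtain ⟨Q, hQm, hQP⟩ := Ideal.exists_maximal_ideal_liesOver_of_isIntegral (S := R) P
  have hℓQ : (ℓ : R) ∈ Q := by
    have h : (ℓ : ℤ) ∈ P := Ideal.mem_span_singleton_self _
    rw [hQP.over, Ideal.mem_comap] at h
    simpa using h
  have hchar : CharP (R ⧸ Q) ℓ := by
    have : Nontrivial (R ⧸ Q) := Ideal.Quotient.nontrivial_iff.2 hQm.ne_top
    refine (CharP.charP_iff_prime_eq_zero hℓ).2 ?_
    rw [← map_natCast (Ideal.Quotient.mk Q)]
    exact Ideal.Quotient.eq_zero_iff_mem.2 hℓQ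
  let : Field (R ⧸ Q) := Ideal.Quotient.field Q
  let : Field (ℤ ⧸ P) := Ideal.Quotient.field P
  -- A Galois invariant algebraic integer is rational, hence an integer.
  have hinv : Algebra.IsInvariant ℤ R Gal(Ω/ℚ) := by
    refine ⟨fun b hb => ?_⟩
    have h1 : (b : Ω) ∈ Set.range (algebraMap ℚ Ω) := by
      rw [InfiniteGalois.mem_range_algebraMap_iff_fixed]
      intro σ
      exact congrArg Subtype.val (hb σ)
    obtain ⟨q, hq⟩ := h1
    have h2 : IsIntegral ℤ q := by
      rw [← isIntegral_algebraMap_iff (B := Ω) (algebraMap ℚ Ω).injective, hq]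
      exact b.2
    obtain ⟨z, hz⟩ := IsIntegrallyClosed.isIntegral_iff.1 h2
    refine ⟨z, Subtype.ext ?_⟩
    rw [← hq, ← hz]
    simp
  -- With the discrete topology the action is continuous because stabilizers of algebraic elements
  -- are open.
  let : TopologicalSpace R := ⊥
  have : DiscreteTopology R := ⟨rfl⟩
  have : ContinuousSMul Gal(Ω/ℚ) R := by
    rw [continuousSMul_iff_stabilizer_isOpen]
    intro x
    convert stabilizer_isOpen_of_isIntegral (K := ℚ) (x : Ω) using 2
    ext σ
    exact Subtype.ext_iff
  have halg : Algebra.IsAlgebraic (ℤ ⧸ P) (R ⧸ Q) := by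
    have : Algebra.IsIntegral (ℤ ⧸ P) (R ⧸ Q) := inferInstance
    exact this.isAlgebraic
  let f : (R ⧸ Q) →ₐ[ℤ ⧸ P] (R ⧸ Q) :=
    { frobenius (R ⧸ Q) ℓ with
      commutes' := fun r => by
        obtain ⟨r, rfl⟩ := Ideal.Quotient.mk_surjective r
        have h : algebraMap (ℤ ⧸ P) (R ⧸ Q) (Ideal.Quotient.mk P r) = (r : R ⧸ Q) :=
          eq_intCast ((algebraMap (ℤ ⧸ P) (R ⧸ Q)).comp (Ideal.Quotient.mk P)) r
        rw [h]
        exact map_intCast (frobenius (R ⧸ Q) ℓ) r }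
  -- The residue field is algebraic over the prime field, so its Frobenius is bijective; it then
  -- lifts to the decomposition group.
  let e := AlgEquiv.ofBijective f (Algebra.IsAlgebraic.algHom_bijective f)
  obtain ⟨σ, hσ⟩ := Ideal.Quotient.stabilizerHom_surjective_of_profinite (G := Gal(Ω/ℚ)) P Q e
  refine ⟨Q, σ, hQm.isPrime, hℓQ, fun x y hxy => ?_⟩
  have h := DFunLike.congr_fun hσ (Ideal.Quotient.mk Q x)
  rw [Ideal.Quotient.stabilizerHom_apply] at h
  rw [← Ideal.Quotient.eq, map_pow]
  obtain rfl : y = (σ : Gal(Ω/ℚ)) • x := Subtype.ext hxy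
  exact h

end Frobenius

/-! ### Roots and their reductions. -/

section Reduction

variable {Ω k : Type*} [Field Ω] [CommRing k] (φ : integralClosure ℤ Ω →+* k)

/-- Over the algebraic integers f(x) is the product of x − y over the roots y, and its image
vanishes in a domain, so one factor reduces to zero. -/
theorem exists_root_of_aeval_reduction_eq_zero [IsDomain k] [IsAlgClosed Ω] {f : ℤ[X]} (hf : f.Monic)
    (x : integralClosure ℤ Ω) (hx : aeval (φ x) f = 0) :
    ∃ y : integralClosure ℤ Ω, aeval (y : Ω) f = 0 ∧ φ y = φ x := by
  set g : Polynomial Ω := f.map (algebraMap ℤ Ω) with hg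
  have hgm : g.Monic := hf.map _
  have hroot (z : Ω) (hz : z ∈ g.roots) : aeval z f = 0 := by
    rw [mem_roots hgm.ne_zero, IsRoot, hg, eval_map_algebraMap] at hz
    exact hz
  have hint (z : Ω) (hz : z ∈ g.roots) : z ∈ integralClosure ℤ Ω := ⟨f, hf, hroot z hz⟩
  obtain ⟨s, hs⟩ : ∃ s : Multiset (integralClosure ℤ Ω), s.map Subtype.val = g.roots :=
    CanLift.prf g.roots hint
  have hprod : aeval x f = (s.map fun y => x - y).prod := by
    apply Subtype.val_injective
    have h1 : ((aeval x f : integralClosure ℤ Ω) : Ω) = aeval (x : Ω) f :=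
      (aeval_algHom_apply (integralClosure ℤ Ω).val x f).symm
    have h2 : (((s.map fun y => x - y).prod : integralClosure ℤ Ω) : Ω) =
        (g.roots.map fun z => (x : Ω) - z).prod := by
      rw [← hs, Multiset.map_map]
      exact (map_multiset_prod (integralClosure ℤ Ω).val _).trans (by rw [Multiset.map_map]; rfl)
    rw [h1, h2, ← eval_map_algebraMap, ← hg]
    conv_lhs => rw [(IsAlgClosed.splits g).eq_prod_roots_of_monic hgm]
    rw [eval_multiset_prod, Multiset.map_map]
    simp
  have h0 : φ (aeval x f) = 0 := by
    rw [← hx]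
    exact (aeval_algHom_apply φ.toIntAlgHom x f).symm
  rw [hprod, map_multiset_prod, Multiset.prod_eq_zero_iff, Multiset.map_map, Multiset.mem_map] at h0
  obtain ⟨y, hy, hxy⟩ := h0
  refine ⟨y, hroot _ (hs ▸ Multiset.mem_map_of_mem _ hy), ?_⟩
  rw [Function.comp_apply, map_sub, sub_eq_zero] at hxy
  exact hxy.symm

variable [Algebra ℚ Ω] {ℓ : ℕ} {σ : Gal(Ω/ℚ)}

theorem aeval_galois_apply_eq_zero (τ : Gal(Ω/ℚ)) {f : ℤ[X]} {x : Ω} (hx : aeval x f = 0) :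
    aeval (τ x) f = 0 := by
  have h := aeval_algHom_apply (τ : Ω →ₐ[ℚ] Ω).toRingHom.toIntAlgHom x f
  rw [hx, map_zero] at h
  exact h

variable {φ} (hσ : ∀ x y : integralClosure ℤ Ω, (y : Ω) = σ x → φ y = φ x ^ ℓ)
include hσ

theorem reduction_pow_apply (i : ℕ) (x y : integralClosure ℤ Ω) (hxy : (y : Ω) = (σ ^ i) x) :
    φ y = φ x ^ ℓ ^ i := by
  induction i generalizing y with
  | zero => 
    obtain rfl : y = x := Subtype.ext hxy
    simp
  | succ i ih =>
    rw [hσ ((σ ^ i) • x) y (by rw [hxy, pow_succ']; rfl), ih _ rfl, ← pow_mul, pow_succ]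

/-- If the Frobenius orbit of the reduction of a root `x` of `f` has length `deg f`, then the roots
of `f` form one orbit under the Frobenius automorphism, with the same cyclic structure. -/
theorem exists_cyclic_labelling {n : ℕ} [NeZero n] {f : ℤ[X]} (hf : f.Monic) (hn : f.natDegree = n)
    (x : integralClosure ℤ Ω) (hx : aeval (x : Ω) f = 0) (hper : Function.minimalPeriod (· ^ ℓ) (φ x) = n) :
    ∃ r : ZMod n → integralClosure ℤ Ω, r 0 = x ∧ Function.Injective r ∧
      (∀ z : Ω, aeval z f = 0 ↔ ∃ i, z = r i) ∧ (∀ i, (r (i + 1) : Ω) = σ (r i)) ∧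
      ∀ i : ℕ, φ (r i) = φ x ^ ℓ ^ i := by
  classical
  have hinj : ∀ i < n, ∀ j < n, φ x ^ ℓ ^ i = φ x ^ ℓ ^ j → i = j := by
    intro i hi j hj h
    have := Function.iterate_injOn_Iio_minimalPeriod (f := (· ^ ℓ)) (x := φ x)
    rw [hper] at this
    exact this hi hj (by simpa only [pow_iterate] using h)
  have hperiod : φ x ^ ℓ ^ n = φ x := by
    have := Function.iterate_minimalPeriod (f := (· ^ ℓ)) (x := φ x)
    rwa [hper, pow_iterate] at this
  let s : ℕ → integralClosure ℤ Ω := fun i => σ ^ i • x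
  have hs (i : ℕ) : φ (s i) = φ x ^ ℓ ^ i := reduction_pow_apply hσ i x _ rfl
  have hsroot (i : ℕ) : aeval (s i : Ω) f = 0 := aeval_galois_apply_eq_zero (σ ^ i) hx
  have hsinj : ∀ i < n, ∀ j < n, s i = s j → i = j := fun i hi j hj h =>
    hinj i hi j hj (by rw [← hs, ← hs, h])
  have hne : (f.map (algebraMap ℤ Ω)) ≠ 0 := (hf.map _).ne_zero
  have hmem (z : Ω) : z ∈ (f.map (algebraMap ℤ Ω)).roots.toFinset ↔ aeval z f = 0 := by
    rw [Multiset.mem_toFinset, mem_roots hne, IsRoot, eval_map_algebraMap]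
  -- The n Frobenius translates of x have distinct reductions, and f has at most n roots.
  have himg : (Finset.range n).image (fun i => (s i : Ω)) = (f.map (algebraMap ℤ Ω)).roots.toFinset := by
    refine Finset.eq_of_subset_of_card_le (fun z hz => ?_) ?_
    · obtain ⟨i, -, rfl⟩ := Finset.mem_image.1 hz
      exact (hmem _).2 (hsroot i)
    · rw [Finset.card_image_of_injOn (fun i hi j hj h => hsinj i (by simpa using hi) j (by simpa using hj)
        (Subtype.ext h)), Finset.card_range]
      refine (Multiset.toFinset_card_le _).trans ((card_roots' _).trans ?_)
      rw [hf.natDegree_map, hn]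
  have hall (z : Ω) (hz : aeval z f = 0) : ∃ i < n, z = s i := by
    rw [← hmem, ← himg] at hz
    obtain ⟨i, hi, rfl⟩ := Finset.mem_image.1 hz
    exact ⟨i, Finset.mem_range.1 hi, rfl⟩
  -- The n-th translate is one of the first n, and its reduction equals that of x; distinctness of
  -- the reductions identifies it with x.
  have hsn : s n = s 0 := by
    obtain ⟨i, hi, h⟩ := hall _ (hsroot n)
    have h' : s n = s i := Subtype.ext h
    have := hinj i hi 0 (Nat.pos_of_ne_zero (NeZero.ne n)) (by
      rw [← hs, ← h', hs, hperiod, pow_zero, pow_one])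
    rw [h', this]
  have hmod (i : ℕ) : s i = s (i % n) := by
    induction i using Nat.strong_induction_on with
    | _ i ih =>
      rcases lt_or_ge i n with h | h
      · rw [Nat.mod_eq_of_lt h]
      · have h1 : s i = s (i - n) := by
          have : i = (i - n) + n := by omega
          conv_lhs => rw [this]
          change σ ^ (i - n + n) • x = σ ^ (i - n) • x
          rw [pow_add, mul_smul, show σ ^ n • x = x by simpa [s] using hsn]
        rw [h1, ih (i - n) (by have := NeZero.pos n; omega), Nat.mod_eq_sub_mod h]
  have hcast (i : ℕ) : s (i : ZMod n).val = s i := by rw [ZMod.val_natCast, ← hmod]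
  refine ⟨fun i => s i.val, ?_, ?_, ?_, ?_, ?_⟩
  · simp [s]
  · exact fun i j h => ZMod.val_injective n (hsinj _ (ZMod.val_lt i) _ (ZMod.val_lt j) h)
  · refine fun z => ⟨fun hz => ?_, ?_⟩
    · obtain ⟨i, hi, rfl⟩ := hall z hz
      exact ⟨i, congrArg Subtype.val (hcast i).symm⟩
    · rintro ⟨i, rfl⟩
      exact hsroot _
  · intro i
    have h := hcast (i.val + 1)
    rw [Nat.cast_add, ZMod.natCast_zmod_val, Nat.cast_one] at h
    dsimp only
    rw [h]
    change (σ ^ (i.val + 1)) (x : Ω) = σ ((σ ^ i.val) x)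
    rw [pow_succ']
    rfl
  · intro i
    dsimp only
    rw [hcast, hs]

/-- This turns a factorization of f modulo ℓ into a lower bound for the Galois image: a power of σ
that fixes x has exponent divisible by the residual orbit length. -/
theorem minimalPeriod_reduction_dvd (m : ℕ) (x : integralClosure ℤ Ω) (hm : (σ ^ m) (x : Ω) = x) :
    Function.minimalPeriod (· ^ ℓ) (φ x) ∣ m := by
  refine Function.IsPeriodicPt.minimalPeriod_dvd ?_
  rw [Function.IsPeriodicPt, Function.IsFixedPt, pow_iterate]
  exact (reduction_pow_apply hσ m x x hm.symm).symm

end Reduction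

/-! ### Orbit lengths, irreducibility and simple extensions. -/

section Orbits

/-- For an orbit length that is a prime power, it suffices to exclude the largest proper divisor. -/
theorem minimalPeriod_pow_eq {k : Type*} [CommRing k] {ℓ q i n : ℕ} [Fact q.Prime] {a : k}
    (h : a ^ ℓ ^ q ^ i ≠ a) (h' : a ^ ℓ ^ n = a) (hn : n = q ^ (i + 1)) :
    Function.minimalPeriod (· ^ ℓ) a = n := by
  subst hn
  refine Function.minimalPeriod_eq_prime_pow ?_ ?_ <;>
  rwa [Function.IsPeriodicPt, Function.IsFixedPt, pow_iterate]

/-- The minimal polynomial of x vanishes at all of its `deg f` conjugates, so it equals f. -/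
theorem irreducible_of_injective_galois_orbit {k Ω : Type*} [Field k] [Field Ω] [Algebra k Ω]
    {f : k[X]} (hf : f.Monic) {ι : Type*} [Fintype ι] (hn : f.natDegree = Fintype.card ι) {x : Ω}
    (hx : aeval x f = 0) {r : ι → Ω} (hr : Function.Injective r) (hconj : ∀ i, ∃ τ : Gal(Ω/k), τ x = r i) :
    Irreducible f := by
  classical
  have hint : IsIntegral k x := ⟨f, hf, hx⟩
  have hdvd : minpoly k x ∣ f := minpoly.dvd k x hx
  have hne : (minpoly k x).map (algebraMap k Ω) ≠ 0 := ((minpoly.monic hint).map _).ne_zero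
  have hcard : Fintype.card ι ≤ (minpoly k x).natDegree := by
    have h1 : (Finset.univ.image r) ⊆ ((minpoly k x).map (algebraMap k Ω)).roots.toFinset := by
      intro z hz
      obtain ⟨i, -, rfl⟩ := Finset.mem_image.1 hz
      obtain ⟨τ, hτ⟩ := hconj i
      rw [Multiset.mem_toFinset, mem_roots hne, IsRoot, eval_map_algebraMap, ← hτ]
      have := aeval_algHom_apply (τ : Ω →ₐ[k] Ω) x (minpoly k x)
      rw [minpoly.aeval, map_zero] at this
      exact this
    have h2 := Finset.card_le_card h1
    rw [Finset.card_image_of_injective _ hr, Finset.card_univ] at h2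
    refine h2.trans ((Multiset.toFinset_card_le _).trans ((card_roots' _).trans ?_))
    rw [(minpoly.monic hint).natDegree_map]
  rw [eq_of_monic_of_dvd_of_natDegree_le (minpoly.monic hint) hf hdvd (hn.trans_le hcard)]
  exact minpoly.irreducible hint

theorem mem_fixingSubgroup_adjoin_simple {k Ω : Type*} [Field k] [Field Ω] [Algebra k Ω]
    (x : Ω) (τ : Gal(Ω/k)) : τ ∈ k⟮x⟯.fixingSubgroup ↔ τ x = x := by
  rw [← Subgroup.zpowers_le, ← le_iff_le, adjoin_simple_le_iff, mem_fixedField_iff]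
  refine ⟨fun h => h τ (Subgroup.mem_zpowers τ), fun h g hg => ?_⟩
  have : Subgroup.zpowers τ ≤ MulAction.stabilizer Gal(Ω/k) x := by
    rw [Subgroup.zpowers_le]
    exact h
  exact this hg

end Orbits

/-! ### Incidence defined by a cubic relation. -/

section Incidence

theorem card_le_three_of_cubic_roots {A : Type*} [Field A] {c₃ c₂ c₁ c₀ : A} (hc : c₃ ≠ 0) {s : Finset A}
    (hs : ∀ x ∈ s, c₃ * x ^ 3 + c₂ * x ^ 2 + c₁ * x + c₀ = 0) : s.card ≤ 3 := by
  let f : A[X] := C c₃ * X ^ 3 + C c₂ * X ^ 2 + C c₁ * X + C c₀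
  have hdeg : f.natDegree = 3 := natDegree_cubic hc
  have hne : f ≠ 0 := by
    rintro h
    rw [h, natDegree_zero] at hdeg
    omega
  rw [← hdeg]
  refine card_le_degree_of_subset_roots (fun x hx => ?_)
  rw [mem_roots hne, IsRoot]
  simpa [f] using hs x hx

/-- Two cyclically labelled families whose members are related by a Galois invariant cubic
equation: the relation is determined by the three solutions for one member. -/
theorem cyclic_incidence_iff {Ω : Type*} [Field Ω] [Algebra ℚ Ω] {n : ℕ} [NeZero n]
    {α β : ZMod n → Ω} (hα : Function.Injective α) {σ : Gal(Ω/ℚ)}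
    (hσα : ∀ i, α (i + 1) = σ (α i)) (hσβ : ∀ i, β (i + 1) = σ (β i))
    {F : Ω → Ω → Ω} (hF : ∀ (τ : Gal(Ω/ℚ)) y x, τ (F y x) = F (τ y) (τ x))
    (hcubic : ∀ y, ∃ c₃ c₂ c₁ c₀ : Ω, c₃ ≠ 0 ∧
      ∀ x, F y x = c₃ * x ^ 3 + c₂ * x ^ 2 + c₁ * x + c₀)
    {S : Finset (ZMod n)} (hS : S.card = 3) (h0 : ∀ i ∈ S, F (β 0) (α i) = 0) (i j : ZMod n) :
    F (β j) (α i) = 0 ↔ i - j ∈ S := by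
  classical
  have hbase (i : ZMod n) : F (β 0) (α i) = 0 ↔ i ∈ S := by
    refine ⟨fun h => ?_, h0 i⟩
    by_contra hi
    obtain ⟨c₃, c₂, c₁, c₀, hc, hx⟩ := hcubic (β 0)
    -- Another index would give the nonzero cubic in x a fourth root.
    have := card_le_three_of_cubic_roots (s := (insert i S).image α) hc (c₂ := c₂) (c₁ := c₁)
      (c₀ := c₀) (by
        intro x hxs
        obtain ⟨m, hm, rfl⟩ := Finset.mem_image.1 hxs
        rw [← hx]
        rcases Finset.mem_insert.1 hm with rfl | hm
        · exact h
        · exact h0 m hm)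
    rw [Finset.card_image_of_injective _ hα, Finset.card_insert_of_notMem hi, hS] at this
    omega
  -- Applying σ shifts both labels by one, so incidence depends on their difference only.
  have hshift (m : ℕ) : ∀ i : ZMod n, F (β m) (α (i + m)) = 0 ↔ F (β 0) (α i) = 0 := by
    induction m with
    | zero => simp
    | succ m ih =>
      intro i
      rw [Nat.cast_succ, ← add_assoc, hσα, hσβ, ← hF, map_eq_zero_iff _ σ.injective, ih]
  have h := hshift j.val (i - j)
  rw [ZMod.natCast_zmod_val, sub_add_cancel] at h
  rw [h, hbase]

end Incidence

/-! ### Permutations of labels as linear actions on vectors and covectors. -/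

section Representation

open Matrix

/-- The stabilizer of a column vector. -/
def vecStabilizer {m F : Type*} [Fintype m] [DecidableEq m] [CommRing F] (v : m → F) :
    Subgroup (GL m F) where
  carrier := {g | (g : Matrix m m F) *ᵥ v = v}
  one_mem' := by simp
  mul_mem' {a b} ha hb := by
    simp only [Set.mem_ofPred_eq] at ha hb ⊢
    rw [Units.val_mul, ← mulVec_mulVec, hb, ha]
  inv_mem' {a} ha := by
    simp only [Set.mem_ofPred_eq] at ha ⊢
    conv_lhs => rw [← ha]
    rw [mulVec_mulVec, ← Units.val_mul, inv_mul_cancel, Units.val_one, one_mulVec]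

/-- The stabilizer of a row vector. -/
def covecStabilizer {m F : Type*} [Fintype m] [DecidableEq m] [CommRing F] (u : m → F) :
    Subgroup (GL m F) where
  carrier := {g | u ᵥ* (g : Matrix m m F) = u}
  one_mem' := by simp
  mul_mem' {a b} ha hb := by
    simp only [Set.mem_ofPred_eq] at ha hb ⊢
    rw [Units.val_mul, ← vecMul_vecMul, ha, hb]
  inv_mem' {a} ha := by
    simp only [Set.mem_ofPred_eq] at ha ⊢
    conv_lhs => rw [← ha]
    rw [vecMul_vecMul, ← Units.val_mul, mul_inv_cancel, Units.val_one, vecMul_one]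

theorem mem_vecStabilizer {m F : Type*} [Fintype m] [DecidableEq m] [CommRing F] {v : m → F}
    {g : GL m F} : g ∈ vecStabilizer v ↔ (g : Matrix m m F) *ᵥ v = v := Iff.rfl

theorem mem_covecStabilizer {m F : Type*} [Fintype m] [DecidableEq m] [CommRing F] {u : m → F}
    {g : GL m F} : g ∈ covecStabilizer u ↔ u ᵥ* (g : Matrix m m F) = u := Iff.rfl

/-- A group acting on labelled points by linear maps of the labels is represented linearly. -/
theorem exists_linear_representation {Γ ι X m F : Type*} [Group Γ] [MulAction Γ X] [Fintype m]
    [DecidableEq m] [CommRing F] {α : ι → X} (hperm : ∀ (τ : Γ) i, ∃ i', τ • α i = α i')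
    {v : ι → m → F} (hv : ∀ A B : Matrix m m F, (∀ i, A *ᵥ v i = B *ᵥ v i) → A = B)
    (hlin : ∀ τ : Γ, ∃ A : Matrix m m F, ∀ i i', τ • α i = α i' → A *ᵥ v i = v i') :
    ∃ ρ : Γ →* GL m F, ∀ τ i i', τ • α i = α i' → (ρ τ : Matrix m m F) *ᵥ v i = v i' := by
  choose A hA using hlin
  -- A matrix is determined by its action on the labels, so the chosen matrices multiply as the
  -- group elements do.
  let f : Γ →* Matrix m m F :=
    { toFun := A
      map_one' := hv _ _ fun i => by rw [hA 1 i i (one_smul _ _), one_mulVec]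
      map_mul' := fun τ τ' => hv _ _ fun i => by
        obtain ⟨i', hi'⟩ := hperm τ' i
        obtain ⟨i'', hi''⟩ := hperm τ i'
        rw [hA (τ * τ') i i'' (by rw [mul_smul, hi', hi'']), ← mulVec_mulVec, hA _ _ _ hi',
          hA _ _ _ hi''] }
  exact ⟨f.toHomUnits, hA⟩

/-- Points and lines labelled by vectors and covectors with compatible incidence: the contragredient
representation describes the action on the lines. -/
theorem vecMul_eq_of_smul_eq {Γ ι X m F : Type*} [Group Γ] [MulAction Γ X] [Fintype m]
    [DecidableEq m] [CommRing F] {α β : ι → X} (hperm : ∀ (τ : Γ) i, ∃ i', τ • α i = α i')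
    {I : X → X → Prop} (hI : ∀ (τ : Γ) x y, I (τ • x) (τ • y) ↔ I x y)
    {v u : ι → m → F} {c : F} (hinc : ∀ i j, I (β j) (α i) ↔ u j ⬝ᵥ v i = c)
    (hdual : ∀ j w, (∀ i, w ⬝ᵥ v i = c ↔ u j ⬝ᵥ v i = c) → w = u j) {ρ : Γ →* GL m F}
    (hρ : ∀ τ i i', τ • α i = α i' → (ρ τ : Matrix m m F) *ᵥ v i = v i') {τ : Γ} {j j' : ι}
    (hj : τ • β j = β j') : u j' ᵥ* (ρ τ : Matrix m m F) = u j := by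
  refine hdual j _ fun i => ?_
  obtain ⟨i', hi'⟩ := hperm τ i
  rw [← dotProduct_mulVec, hρ _ _ _ hi', ← hinc, ← hinc, ← hj, ← hi', hI]

theorem smul_eq_iff_mem_vecStabilizer {Γ ι X m F : Type*} [Group Γ] [MulAction Γ X] [Fintype m]
    [DecidableEq m] [CommRing F] {α : ι → X} (hperm : ∀ (τ : Γ) i, ∃ i', τ • α i = α i')
    {v : ι → m → F} (hv : Function.Injective v) {ρ : Γ →* GL m F}
    (hρ : ∀ τ i i', τ • α i = α i' → (ρ τ : Matrix m m F) *ᵥ v i = v i') (τ : Γ) (i : ι) :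
    τ • α i = α i ↔ ρ τ ∈ vecStabilizer (v i) := by
  rw [mem_vecStabilizer]
  refine ⟨hρ τ i i, fun h => ?_⟩
  obtain ⟨i', hi'⟩ := hperm τ i
  rw [hρ _ _ _ hi'] at h
  rw [hi', hv h]

theorem smul_eq_iff_mem_covecStabilizer {Γ ι X m F : Type*} [Group Γ] [MulAction Γ X] [Fintype m]
    [DecidableEq m] [CommRing F] {β : ι → X} (hperm : ∀ (τ : Γ) i, ∃ i', τ • β i = β i')
    {u : ι → m → F} (hu : Function.Injective u) {ρ : Γ →* GL m F}
    (hρ : ∀ τ i i', τ • β i = β i' → u i' ᵥ* (ρ τ : Matrix m m F) = u i) (τ : Γ) (i : ι) :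
    τ • β i = β i ↔ ρ τ ∈ covecStabilizer (u i) := by
  rw [mem_covecStabilizer]
  refine ⟨hρ τ i i, fun h => ?_⟩
  obtain ⟨j, hj⟩ := hperm τ i
  have h2 : u j ᵥ* (ρ τ : Matrix m m F) = u i ᵥ* (ρ τ : Matrix m m F) := (hρ _ _ _ hj).trans h.symm
  have h3 : u j = u i := by
    have := congrArg (· ᵥ* ((ρ τ)⁻¹ : GL m F).1) h2
    simpa only [vecMul_vecMul, ← Units.val_mul, mul_inv_cancel, Units.val_one, vecMul_one]
      using this
  rw [hj, hu h3]

/-- The core of the stabilizer of a vector with spanning orbit is trivial. -/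
theorem eq_one_of_forall_conj_mem_vecStabilizer {m F ι : Type*} [Fintype m] [DecidableEq m]
    [CommRing F] {v : ι → m → F} (hv : ∀ A B : Matrix m m F, (∀ i, A *ᵥ v i = B *ᵥ v i) → A = B)
    {i₀ : ι} (htrans : ∀ i, ∃ g : GL m F, (g : Matrix m m F) *ᵥ v i₀ = v i) (x : GL m F)
    (hx : ∀ g : GL m F, g⁻¹ * x * g ∈ vecStabilizer (v i₀)) : x = 1 := by
  refine Units.ext (hv _ _ fun i => ?_)
  obtain ⟨g, hg⟩ := htrans i
  have h := congrArg ((g : Matrix m m F) *ᵥ ·) (mem_vecStabilizer.1 (hx g))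
  simp only [mulVec_mulVec, ← Units.val_mul, mul_assoc, mul_inv_cancel_left] at h
  rw [Units.val_mul, ← mulVec_mulVec, hg] at h
  rw [h, Units.val_one, one_mulVec]

/-- The core of the stabilizer of a covector with spanning orbit is trivial. -/
theorem eq_one_of_forall_conj_mem_covecStabilizer {m F ι : Type*} [Fintype m] [DecidableEq m]
    [CommRing F] {u : ι → m → F} (hu : ∀ A B : Matrix m m F, (∀ i, u i ᵥ* A = u i ᵥ* B) → A = B)
    {i₀ : ι} (htrans : ∀ i, ∃ g : GL m F, u i ᵥ* (g : Matrix m m F) = u i₀) (x : GL m F)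
    (hx : ∀ g : GL m F, g⁻¹ * x * g ∈ covecStabilizer (u i₀)) : x = 1 := by
  refine Units.ext (hu _ _ fun i => ?_)
  obtain ⟨g, hg⟩ := htrans i
  have h := congrArg (· ᵥ* ((g⁻¹ : GL m F) : Matrix m m F)) (mem_covecStabilizer.1 (hx g))
  rw [← hg] at h
  simpa only [vecMul_vecMul, ← Units.val_mul, mul_assoc, mul_inv_cancel_left, mul_inv_cancel,
    mul_one, Units.val_one, vecMul_one] using h

/-- A reflection or transvection fixing the vector `v` and moving the covector `u`. -/
theorem exists_mem_vecStabilizer_notMem_covecStabilizer {m F : Type*} [Fintype m] [DecidableEq m]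
    [Field F] {v u a b : m → F} (hba : 2 + b ⬝ᵥ a = 0) (hbv : b ⬝ᵥ v = 0) (hb : b ≠ 0)
    (hua : u ⬝ᵥ a ≠ 0) : ∃ x : GL m F, x ∈ vecStabilizer v ∧ x ∉ covecStabilizer u := by
  -- The square of M is 1 + (2 + b·a) a bᵀ = 1. In characteristic two b·a = 0 and M is a
  -- transvection; over the field of three elements b·a = 1 and M is a reflection.
  let M : Matrix m m F := 1 + vecMulVec a b
  have hM : M * M = 1 := by
    have h1 : vecMulVec a b * vecMulVec a b = (b ⬝ᵥ a) • vecMulVec a b := by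
      rw [vecMulVec_mul_vecMulVec, vecMulVec_smul]
    have h2 : M * M = 1 + (2 + b ⬝ᵥ a) • vecMulVec a b := by
      simp only [M, mul_add, add_mul, h1, mul_one, one_mul, add_smul, two_smul]
      abel
    rw [h2, hba, zero_smul, add_zero]
  refine ⟨⟨M, M, hM, hM⟩, ?_, ?_⟩
  · rw [mem_vecStabilizer]
    simp [M, add_mulVec, vecMulVec_mulVec, hbv]
  · rw [mem_covecStabilizer]
    intro h
    have h' : (u ⬝ᵥ a) • b = 0 := by
      simpa [M, vecMul_add, vecMul_vecMulVec] using h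
    rcases smul_eq_zero.1 h' with h' | h'
    · exact hua h'
    · exact hb h'

/-- An additive relation between labels that is preserved by a permutation of the labels. -/
theorem mulVec_eq_of_relation {m F : Type*} [Fintype m] [CommRing F] {A : Matrix m m F}
    {a b c a' b' c' : m → F} (h : a + b + c = 0) (h' : a' + b' + c' = 0) (ha : A *ᵥ a = a')
    (hb : A *ᵥ b = b') : A *ᵥ c = c' := by
  rw [eq_neg_of_add_eq_zero_right h, eq_neg_of_add_eq_zero_right h', mulVec_neg, mulVec_add, ha, hb]

end Representation

/-! ### Conjugate Sylow subgroups of two subgroups of a finite group. -/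

section FiniteGroups

/-- A Sylow p-subgroup of a subgroup of index prime to p is one of the whole group, and those are
all conjugate. -/
theorem exists_conj_subgroups_of_not_dvd_index {H : Type*} [Group H] [Finite H] {A B : Subgroup H}
    {p : ℕ} (hp : p.Prime) (hA : ¬ p ∣ A.index) (hB : ¬ p ∣ B.index) :
    ∃ (C : Subgroup H) (g : H), C ≤ A ∧ C.map (MulAut.conj g).toMonoidHom ≤ B ∧
      ¬ p ∣ C.relIndex A ∧ ¬ p ∣ (C.map (MulAut.conj g).toMonoidHom).relIndex B := by
  have := Fact.mk hp
  have key (D : Subgroup H) (hD : ¬ p ∣ D.index) :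
      ∃ S : Sylow p H, (S : Subgroup H) ≤ D := by
    obtain ⟨S⟩ : Nonempty (Sylow p D) := inferInstance
    have h1 : IsPGroup p ((S : Subgroup D).map D.subtype) := S.isPGroup'.map _
    have h2 : ¬ p ∣ ((S : Subgroup D).map D.subtype).index := by
      rw [← Subgroup.relIndex_mul_index (Subgroup.map_subtype_le _), hp.dvd_mul, not_or]
      refine ⟨?_, hD⟩
      rw [Subgroup.relIndex, Subgroup.subgroupOf,
        Subgroup.comap_map_eq_self_of_injective D.subtype_injective]
      exact S.not_dvd_index
    exact ⟨h1.toSylow h2, Subgroup.map_subtype_le _⟩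
  obtain ⟨S, hS⟩ := key A hA
  obtain ⟨T, hT⟩ := key B hB
  obtain ⟨g, hg⟩ := MulAction.exists_smul_eq H S T
  have hmap : (S : Subgroup H).map (MulAut.conj g).toMonoidHom = T := by
    rw [← hg]; rfl
  refine ⟨S, g, hS, hmap ▸ hT, fun h => S.not_dvd_index (h.trans ?_), fun h => T.not_dvd_index ?_⟩
  · exact Subgroup.relIndex_dvd_index_of_le hS
  · rw [hmap] at h
    exact h.trans (Subgroup.relIndex_dvd_index_of_le hT)

theorem exists_conj_subgroups_of_not_dvd_card {H : Type*} [Group H] [Finite H] {A B : Subgroup H}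
    {p : ℕ} (hA : ¬ p ∣ Nat.card A) (hB : ¬ p ∣ Nat.card B) :
    ∃ (C : Subgroup H) (g : H), C ≤ A ∧ C.map (MulAut.conj g).toMonoidHom ≤ B ∧
      ¬ p ∣ C.relIndex A ∧ ¬ p ∣ (C.map (MulAut.conj g).toMonoidHom).relIndex B := by
  refine ⟨⊥, 1, bot_le, ?_, ?_, ?_⟩
  · rw [Subgroup.map_bot]; exact bot_le
  · rwa [Subgroup.relIndex_bot_left]
  · rwa [Subgroup.map_bot, Subgroup.relIndex_bot_left]

end FiniteGroups

/-! ### The groups `GL₃(2)` and `GL₂(3)`. -/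

section MatrixGroups

open Matrix

/-- Gaussian elimination. It is stated for submonoids so that it also applies to the auxiliary set
comparing an index-two subgroup with the determinant. -/
theorem eq_top_of_transvection_mem_of_diagonal_mem {m F : Type*} [Fintype m] [DecidableEq m]
    [Field F] (H : Submonoid (GL m F))
    (hT : ∀ (i j : m) (c : F), i ≠ j → ∀ g : GL m F, (g : Matrix m m F) = transvection i j c → g ∈ H)
    (hD : ∀ (d : m → F) (g : GL m F), (g : Matrix m m F) = diagonal d → g ∈ H) : H = ⊤ := by
  refine eq_top_iff.2 fun g _ => ?_
  have key : ∃ g' ∈ H, (g' : Matrix m m F) = g := by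
    refine diagonal_transvection_induction_of_det_ne_zero
      (fun M => ∃ g' ∈ H, (g' : Matrix m m F) = M) _ ((isUnit_iff_isUnit_det _).1 g.isUnit).ne_zero
      (fun d hd => ?_) (fun t => ?_) ?_
    · have hu : IsUnit (diagonal d) := (isUnit_iff_isUnit_det _).2 (isUnit_iff_ne_zero.2 hd)
      exact ⟨hu.unit, hD d _ rfl, rfl⟩
    · have hu : IsUnit t.toMatrix := (isUnit_iff_isUnit_det _).2 (by rw [t.det]; exact isUnit_one)
      exact ⟨hu.unit, hT t.i t.j t.c t.hij _ rfl, rfl⟩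
    · rintro _ _ - - ⟨x, hx, rfl⟩ ⟨y, hy, rfl⟩
      exact ⟨x * y, mul_mem hx hy, rfl⟩
  obtain ⟨g', hg', h⟩ := key
  rwa [← Units.ext h]

theorem card_GL_fin_three_zmod_two : Nat.card (GL (Fin 3) (ZMod 2)) = 168 := by
  rw [Matrix.card_GL_field, ZMod.card]
  decide

theorem card_GL_fin_two_zmod_three : Nat.card (GL (Fin 2) (ZMod 3)) = 48 := by
  rw [Matrix.card_GL_field, ZMod.card]
  decide

theorem Subgroup.eq_top_or_index_eq_two {G : Type*} [Group G] {H : Subgroup G} {d : ℕ}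
    (hG : Nat.card G = 2 * d) (hd : 0 < d) (h : d ∣ Nat.card H) : H = ⊤ ∨ H.index = 2 := by
  have h1 := H.card_mul_index
  rw [hG] at h1
  obtain ⟨c, hc⟩ := h
  rw [hc] at h1
  have h2 : c * H.index = 2 := by
    refine Nat.eq_of_mul_eq_mul_left hd ?_
    rw [← mul_assoc, h1, mul_comm]
  have h3 : H.index ∣ 2 := ⟨c, by rw [← h2, mul_comm]⟩
  rcases (Nat.dvd_prime Nat.prime_two).1 h3 with h3 | h3
  · exact Or.inl (Subgroup.index_eq_one.1 h3)
  · exact Or.inr h3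

/-- Otherwise H has index two and contains all squares. In characteristic two, a transvection in
position (i, j) is the square of a product of transvections in positions (i, k) and (k, j), with k
the third index, and the only invertible diagonal matrix is 1. -/
theorem eq_top_of_dvd_card_GL_fin_three_zmod_two {H : Subgroup (GL (Fin 3) (ZMod 2))}
    (h : 84 ∣ Nat.card H) : H = ⊤ := by
  rcases Subgroup.eq_top_or_index_eq_two (d := 84) card_GL_fin_three_zmod_two (by norm_num) h with
    h | h
  · exact h
  rw [← Subgroup.toSubmonoid_inj]
  refine eq_top_of_transvection_mem_of_diagonal_mem H.toSubmonoid (fun i j c hij g hg => ?_)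
    fun d g hg => ?_
  · have key : ∃ k, k ≠ i ∧ k ≠ j := by clear hij hg; revert i j; decide
    obtain ⟨k, hki, hkj⟩ := key
    let a : Matrix (Fin 3) (Fin 3) (ZMod 2) := transvection i k c * transvection k j 1
    have ha : IsUnit a := (isUnit_iff_isUnit_det _).2 (by
      rw [det_mul, det_transvection_of_ne _ _ hki.symm, det_transvection_of_ne _ _ hkj, one_mul]
      exact isUnit_one)
    have : g = ha.unit * ha.unit := by
      refine Units.ext ?_
      rw [hg, Units.val_mul, IsUnit.unit_spec]
      have h2 (x : Matrix (Fin 3) (Fin 3) (ZMod 2)) : x + x = 0 := by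
        ext
        exact CharTwo.add_self_eq_zero _
      have e (x y z : Matrix (Fin 3) (Fin 3) (ZMod 2)) (hxy : x * y = z) (hxx : x * x = 0)
          (hyy : y * y = 0) (hyx : y * x = 0) :
          1 + z = ((1 + x) * (1 + y)) * ((1 + x) * (1 + y)) := by
        have h3 : ((1 + x) * (1 + y)) * ((1 + x) * (1 + y)) = 1 + x * y + ((x + x) + (y + y) +
            (x * y + x * y) + x * x * (1 + y) + y * y + y * x * (1 + y) + x * (y * y) +
            x * (y * x) * (1 + y)) := by noncomm_ring
        rw [h3, hxx, hyx, hyy, h2, h2, h2, hxy]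
        simp [h2]
      refine e _ _ _ ?_ ?_ ?_ ?_
      · rw [single_mul_single_same, mul_one]
      · exact single_mul_single_of_ne _ _ _ _ hki _
      · exact single_mul_single_of_ne _ _ _ _ hkj.symm _
      · exact single_mul_single_of_ne _ _ _ _ hij.symm _
    rw [this]
    exact Subgroup.mul_self_mem_of_index_two h _
  · have : g = 1 := by
      refine Units.ext ?_
      have hd : ∀ i, d i = 1 := by
        intro i
        have h0 : d i ≠ 0 := by
          have hu := ((isUnit_iff_isUnit_det _).1 g.isUnit).ne_zero
          rw [hg, det_diagonal, Finset.prod_ne_zero_iff] at hu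
          exact hu i (Finset.mem_univ i)
        generalize d i = x at h0
        revert x
        decide
      rw [hg, Units.val_one, ← diagonal_one]
      exact congrArg diagonal (funext hd)
    rw [this]
    exact one_mem _

/-- A subgroup of index two contains all squares, hence all transvections and −1. If it also
contains diag(1, 2) it is everything; otherwise it consists exactly of the matrices of determinant
one, which `h₀` contradicts. -/
theorem eq_top_of_dvd_card_GL_fin_two_zmod_three {H : Subgroup (GL (Fin 2) (ZMod 3))}
    (h : 24 ∣ Nat.card H) {h₀ : GL (Fin 2) (ZMod 3)} (hmem : h₀ ∈ H)
    (hdet : (h₀ : Matrix (Fin 2) (Fin 2) (ZMod 3)).det ≠ 1) : H = ⊤ := by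
  rcases Subgroup.eq_top_or_index_eq_two (d := 24) card_GL_fin_two_zmod_three (by norm_num) h with
    h | h
  · exact h
  have hsq (g x : GL (Fin 2) (ZMod 3)) (hg : (g : Matrix (Fin 2) (Fin 2) (ZMod 3)) = x * x) :
      g ∈ H := by
    rw [show g = x * x from Units.ext hg]
    exact Subgroup.mul_self_mem_of_index_two h x
  have htrans (i j : Fin 2) (c : ZMod 3) (hij : i ≠ j) (g : GL (Fin 2) (ZMod 3))
      (hg : (g : Matrix (Fin 2) (Fin 2) (ZMod 3)) = transvection i j c) : g ∈ H := by
    -- Transvections have order dividing three, so g = g⁴ = (g²)².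
    refine hsq g (g * g) ?_
    rw [Units.val_mul, hg]
    clear hg
    revert i j c
    decide +kernel
  have hdet_mul (a b : GL (Fin 2) (ZMod 3)) :
      (a * b).1.det = 1 ↔ (a.1.det = 1 ↔ b.1.det = 1) := by
    have ha := ((isUnit_iff_isUnit_det _).1 a.isUnit).ne_zero
    have hb := ((isUnit_iff_isUnit_det _).1 b.isUnit).ne_zero
    rw [Units.val_mul, det_mul]
    generalize a.1.det = x at ha
    generalize b.1.det = y at hb
    revert x y
    decide
  have hneg (g : GL (Fin 2) (ZMod 3)) (hg : (g : Matrix (Fin 2) (Fin 2) (ZMod 3)) = diagonal ![2, 2]) :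
      g ∈ H := by
    -- An element of order four whose square is −1.
    refine hsq g ⟨!![0, 1; 2, 0], !![0, 2; 1, 0], ?_, ?_⟩ ?_
    · decide +kernel
    · decide +kernel
    · rw [hg]; decide +kernel
  have hdiag (d : Fin 2 → ZMod 3) (g : GL (Fin 2) (ZMod 3))
      (hg : (g : Matrix (Fin 2) (Fin 2) (ZMod 3)) = diagonal d) :
      d = ![1, 1] ∨ d = ![2, 2] ∨ d = ![1, 2] ∨ d = ![2, 1] := by
    have hu := ((isUnit_iff_isUnit_det _).1 g.isUnit).ne_zero
    rw [hg, det_diagonal, Fin.prod_univ_two] at hu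
    clear hg
    revert d
    decide +kernel
  have hone (g : GL (Fin 2) (ZMod 3)) (hg : (g : Matrix (Fin 2) (Fin 2) (ZMod 3)) = diagonal ![1, 1]) :
      g ∈ H := by
    refine hsq g 1 ?_
    rw [hg]; decide +kernel
  let t : GL (Fin 2) (ZMod 3) :=
    ⟨diagonal ![1, 2], diagonal ![1, 2], by decide +kernel, by decide +kernel⟩
  let z : GL (Fin 2) (ZMod 3) :=
    ⟨diagonal ![2, 2], diagonal ![2, 2], by decide +kernel, by decide +kernel⟩
  have hz : z ∈ H := hneg z rfl
  have h12 (g : GL (Fin 2) (ZMod 3)) (hg : (g : Matrix (Fin 2) (Fin 2) (ZMod 3)) = diagonal ![1, 2]) :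
      g = t := Units.ext hg
  have h21 (g : GL (Fin 2) (ZMod 3)) (hg : (g : Matrix (Fin 2) (Fin 2) (ZMod 3)) = diagonal ![2, 1]) :
      g = z * t := Units.ext (hg.trans (by decide +kernel))
  by_cases ht : t ∈ H
  · rw [← Subgroup.toSubmonoid_inj]
    refine eq_top_of_transvection_mem_of_diagonal_mem H.toSubmonoid
      (fun i j c hij g hg => htrans i j c hij g hg) fun d g hg => ?_
    rcases hdiag d g hg with rfl | rfl | rfl | rfl
    · exact hone g hg
    · exact hneg g hg
    · rw [h12 g hg]; exact ht
    · rw [h21 g hg]; exact mul_mem hz ht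
  -- Membership in H and determinant one both behave like signs under multiplication, so the set
  -- where they agree is closed under products; it contains the generators.
  · let N : Submonoid (GL (Fin 2) (ZMod 3)) :=
      { carrier := {g | g ∈ H ↔ (g : Matrix (Fin 2) (Fin 2) (ZMod 3)).det = 1}
        one_mem' := by simp
        mul_mem' := fun {a b} ha hb => by
          simp only [Set.mem_ofPred_eq] at ha hb ⊢
          rw [hdet_mul, Subgroup.mul_mem_iff_of_index_two h, ha, hb] }
    have htdet : ¬ (t : Matrix (Fin 2) (Fin 2) (ZMod 3)).det = 1 := by decide +kernel
    have hN : N = ⊤ := by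
      refine eq_top_of_transvection_mem_of_diagonal_mem N (fun i j c hij g hg => ?_) fun d g hg => ?_
      · exact iff_of_true (htrans i j c hij g hg) (by rw [hg, det_transvection_of_ne _ _ hij])
      · rcases hdiag d g hg with rfl | rfl | rfl | rfl
        · exact iff_of_true (hone g hg) (by rw [hg]; decide +kernel)
        · exact iff_of_true (hneg g hg) (by rw [hg]; decide +kernel)
        · rw [h12 g hg]; exact iff_of_false ht htdet
        · rw [h21 g hg]
          exact mul_mem (show z ∈ N from iff_of_true hz (by decide +kernel))
            (show t ∈ N from iff_of_false ht htdet)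
    have : h₀ ∈ N := hN ▸ Submonoid.mem_top h₀
    exact absurd (this.1 hmem) hdet

set_option synthInstance.maxSize 2000 in
set_option synthInstance.maxHeartbeats 200000 in
theorem exists_notMem_covecStabilizer_of_fin_three {v u : Fin 3 → ZMod 2} (hu : u ≠ 0) :
    ∃ x : GL (Fin 3) (ZMod 2), x ∈ vecStabilizer v ∧ x ∉ covecStabilizer u := by
  have key : ∀ u : Fin 3 → ZMod 2, u ≠ 0 → ∀ v : Fin 3 → ZMod 2, ∃ a b : Fin 3 → ZMod 2,
      2 + b ⬝ᵥ a = 0 ∧ b ⬝ᵥ v = 0 ∧ b ≠ 0 ∧ u ⬝ᵥ a ≠ 0 := by decide +kernel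
  obtain ⟨a, b, h1, h2, h3, h4⟩ := key u hu v
  exact exists_mem_vecStabilizer_notMem_covecStabilizer h1 h2 h3 h4

set_option synthInstance.maxSize 2000 in
set_option synthInstance.maxHeartbeats 200000 in
theorem exists_notMem_covecStabilizer_of_fin_two {v u : Fin 2 → ZMod 3} (hv : v ≠ 0) (hu : u ≠ 0) :
    ∃ x : GL (Fin 2) (ZMod 3), x ∈ vecStabilizer v ∧ x ∉ covecStabilizer u := by
  have key : ∀ u : Fin 2 → ZMod 3, u ≠ 0 → ∀ v : Fin 2 → ZMod 3, v ≠ 0 → (∃ a b : Fin 2 → ZMod 3,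
      2 + b ⬝ᵥ a = 0 ∧ b ⬝ᵥ v = 0 ∧ b ≠ 0 ∧ u ⬝ᵥ a ≠ 0) := by decide +kernel
  obtain ⟨a, b, h1, h2, h3, h4⟩ := key u hu v hv
  exact exists_mem_vecStabilizer_notMem_covecStabilizer h1 h2 h3 h4

set_option synthInstance.maxSize 2000 in
set_option synthInstance.maxHeartbeats 200000 in
/-- All reflections in `GL₂(3)` are conjugate. -/
theorem exists_conj_eq_of_mul_self_eq_one {s t : GL (Fin 2) (ZMod 3)} (hs : s * s = 1) (hs1 : s ≠ 1)
    (hs2 : s ≠ -1) (ht : t * t = 1) (ht1 : t ≠ 1) (ht2 : t ≠ -1) : ∃ g, g * s * g⁻¹ = t := by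
  -- An involution other than ±1 has an eigenbasis with eigenvalues 1 and −1; the columns (p, r) and
  -- (q, w) are these eigenvectors.
  have key : ∀ a b c d : ZMod 3, a * a + b * c = 1 → a * b + b * d = 0 → c * a + d * c = 0 →
      c * b + d * d = 1 → ¬ (a = 1 ∧ b = 0 ∧ c = 0 ∧ d = 1) → ¬ (a = -1 ∧ b = 0 ∧ c = 0 ∧ d = -1) →
      ∃ p q r w : ZMod 3, p * w - q * r ≠ 0 ∧ a * p + b * r = p ∧ a * q + b * w = - q ∧
        c * p + d * r = r ∧ c * q + d * w = - w := by decide +kernel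
  have main (s : GL (Fin 2) (ZMod 3)) (hs : s * s = 1) (hs1 : s ≠ 1) (hs2 : s ≠ -1) :
      ∃ g : GL (Fin 2) (ZMod 3),
        s.1 * g.1 = g.1 * diagonal ![1, -1] := by
    have hsm := congrArg (Units.val) hs
    rw [Units.val_mul, Units.val_one, ← Matrix.ext_iff] at hsm
    simp only [mul_apply, Fin.sum_univ_two, Fin.forall_fin_two] at hsm
    obtain ⟨p, q, r, w, hdet, h1, h2, h3, h4⟩ := key _ _ _ _ hsm.1.1 hsm.1.2 hsm.2.1 hsm.2.2
      (fun h => hs1 (Units.ext (by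
        ext i j; fin_cases i <;> fin_cases j <;> simp [h.1, h.2.1, h.2.2.1, h.2.2.2])))
      (fun h => hs2 (Units.ext (by
        ext i j; fin_cases i <;> fin_cases j <;> simp [h.1, h.2.1, h.2.2.1, h.2.2.2])))
    have hu : IsUnit !![p, q; r, w] := (isUnit_iff_isUnit_det _).2 (by
      rw [det_fin_two_of]; exact isUnit_iff_ne_zero.2 hdet)
    refine ⟨hu.unit, ?_⟩
    rw [IsUnit.unit_spec]
    ext i j
    fin_cases i <;> fin_cases j <;> simp [mul_apply, Fin.sum_univ_two, h1, h2, h3, h4]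
  obtain ⟨g, hg⟩ := main s hs hs1 hs2
  obtain ⟨g', hg'⟩ := main t ht ht1 ht2
  refine ⟨g' * g⁻¹, ?_⟩
  have e1 : (g⁻¹ * s * g : GL (Fin 2) (ZMod 3)).1 = diagonal ![1, -1] := by
    rw [Units.val_mul, Units.val_mul, mul_assoc, hg, ← mul_assoc, ← Units.val_mul, inv_mul_cancel,
      Units.val_one, one_mul]
  have e2 : (g'⁻¹ * t * g' : GL (Fin 2) (ZMod 3)).1 = diagonal ![1, -1] := by
    rw [Units.val_mul, Units.val_mul, mul_assoc, hg', ← mul_assoc, ← Units.val_mul, inv_mul_cancel,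
      Units.val_one, one_mul]
  have e3 : g⁻¹ * s * g = g'⁻¹ * t * g' := Units.ext (e1.trans e2.symm)
  calc g' * g⁻¹ * s * (g' * g⁻¹)⁻¹ = g' * (g⁻¹ * s * g) * g'⁻¹ := by group
    _ = t := by rw [e3]; group

/-- Only p = 2 divides the index 8. The stabilizers have order 6, so there the Sylow subgroups are
generated by involutions. These differ from −1, which fixes no nonzero vector or covector, hence
they are conjugate. -/
theorem exists_conj_subgroups_of_fin_two_zmod_three {v u : Fin 2 → ZMod 3} (hv : v ≠ 0) (hu : u ≠ 0)
    (hA : (vecStabilizer v).index = 8) (hB : (covecStabilizer u).index = 8) {p : ℕ} (hp : p.Prime) :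
    ∃ (C : Subgroup (GL (Fin 2) (ZMod 3))) (g : GL (Fin 2) (ZMod 3)), C ≤ vecStabilizer v ∧
      C.map (MulAut.conj g).toMonoidHom ≤ covecStabilizer u ∧ ¬ p ∣ C.relIndex (vecStabilizer v) ∧
      ¬ p ∣ (C.map (MulAut.conj g).toMonoidHom).relIndex (covecStabilizer u) := by
  by_cases hp2 : p = 2
  · subst hp2
    have hcard (D : Subgroup (GL (Fin 2) (ZMod 3))) (hD : D.index = 8) : Nat.card D = 6 := by
      have := D.card_mul_index
      rw [hD, card_GL_fin_two_zmod_three] at this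
      omega
    have hrel {D C : Subgroup (GL (Fin 2) (ZMod 3))} (hD : D.index = 8) (hC : C ≤ D)
        (hC2 : Nat.card C = 2) : ¬ 2 ∣ C.relIndex D := by
      have := Subgroup.relIndex_mul_relIndex ⊥ C D bot_le hC
      rw [Subgroup.relIndex_bot_left, Subgroup.relIndex_bot_left, hcard D hD, hC2] at this
      omega
    have hinv (D : Subgroup (GL (Fin 2) (ZMod 3))) (hD : D.index = 8) :
        ∃ s ∈ D, orderOf s = 2 := by
      obtain ⟨s, hs⟩ := exists_prime_orderOf_dvd_card' (G := D) 2 (by rw [hcard D hD]; norm_num)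
      exact ⟨s, s.2, (Subgroup.orderOf_coe s).trans hs⟩
    obtain ⟨s, hsD, hs⟩ := hinv _ hA
    obtain ⟨t, htD, ht⟩ := hinv _ hB
    have hsq {s : GL (Fin 2) (ZMod 3)} (hs : orderOf s = 2) : s * s = 1 ∧ s ≠ 1 := by
      refine ⟨(pow_two s).symm.trans (orderOf_dvd_iff_pow_eq_one.1 hs.dvd), ?_⟩
      rintro rfl
      rw [orderOf_one] at hs
      omega
    have hneg {w : Fin 2 → ZMod 3} (hw : w ≠ 0) : -w ≠ w := by
      revert w
      decide +kernel
    obtain ⟨g, hg⟩ := exists_conj_eq_of_mul_self_eq_one (hsq hs).1 (hsq hs).2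
      (by
        rintro rfl
        rw [mem_vecStabilizer, Units.val_neg, Units.val_one, neg_mulVec, one_mulVec] at hsD
        exact hneg hv hsD) (hsq ht).1 (hsq ht).2
      (by
        rintro rfl
        rw [mem_covecStabilizer, Units.val_neg, Units.val_one, vecMul_neg, vecMul_one] at htD
        exact hneg hu htD)
    have hmap : (Subgroup.zpowers s).map (MulAut.conj g).toMonoidHom = Subgroup.zpowers t := by
      rw [MonoidHom.map_zpowers, ← hg]
      rfl
    have hle : Subgroup.zpowers s ≤ vecStabilizer v := Subgroup.zpowers_le.2 hsD
    have hle' : Subgroup.zpowers t ≤ covecStabilizer u := Subgroup.zpowers_le.2 htD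
    refine ⟨Subgroup.zpowers s, g, hle, hmap ▸ hle', hrel hA hle ?_, ?_⟩
    · rw [Nat.card_zpowers, hs]
    · rw [hmap]
      exact hrel hB hle' (by rw [Nat.card_zpowers, ht])
  · have h8 : ¬ p ∣ 8 := fun h => hp2 ((Nat.prime_dvd_prime_iff_eq hp Nat.prime_two).1
      (hp.dvd_of_dvd_pow (show p ∣ 2 ^ 3 from h)))
    exact exists_conj_subgroups_of_not_dvd_index hp (by rwa [hA]) (by rwa [hB])

/-- Only p = 7 divides the index 7, and then p does not divide the order 24 of the stabilizers, so
the trivial subgroup serves. -/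
theorem exists_conj_subgroups_of_fin_three_zmod_two {v u : Fin 3 → ZMod 2}
    (hA : (vecStabilizer v).index = 7) (hB : (covecStabilizer u).index = 7) {p : ℕ} (hp : p.Prime) :
    ∃ (C : Subgroup (GL (Fin 3) (ZMod 2))) (g : GL (Fin 3) (ZMod 2)), C ≤ vecStabilizer v ∧
      C.map (MulAut.conj g).toMonoidHom ≤ covecStabilizer u ∧ ¬ p ∣ C.relIndex (vecStabilizer v) ∧
      ¬ p ∣ (C.map (MulAut.conj g).toMonoidHom).relIndex (covecStabilizer u) := by
  by_cases hp7 : p = 7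
  · subst hp7
    have hcard (D : Subgroup (GL (Fin 3) (ZMod 2))) (hD : D.index = 7) : ¬ 7 ∣ Nat.card D := by
      have := D.card_mul_index
      rw [hD, card_GL_fin_three_zmod_two] at this
      omega
    exact exists_conj_subgroups_of_not_dvd_card (hcard _ hA) (hcard _ hB)
  · have h7 : ¬ p ∣ 7 := fun h => hp7 ((Nat.prime_dvd_prime_iff_eq hp (by norm_num)).1 h)
    exact exists_conj_subgroups_of_not_dvd_index hp (by rwa [hA]) (by rwa [hB])

/-- Over the field with two elements all the classical groups of degree three coincide. -/
theorem nonempty_GL_mulEquiv_PSL_fin_three_zmod_two :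
    Nonempty (GL (Fin 3) (ZMod 2) ≃* Matrix.ProjectiveSpecialLinearGroup (Fin 3) (ZMod 2)) := by
  have hsurj : Function.Surjective
      (SpecialLinearGroup.toGL : SpecialLinearGroup (Fin 3) (ZMod 2) →* GL (Fin 3) (ZMod 2)) := by
    intro g
    have hdet : (g : Matrix (Fin 3) (Fin 3) (ZMod 2)).det = 1 := by
      have hu := ((isUnit_iff_isUnit_det _).1 g.isUnit).ne_zero
      generalize (g : Matrix (Fin 3) (Fin 3) (ZMod 2)).det = x at hu
      revert x
      decide
    exact ⟨⟨g, hdet⟩, Units.ext rfl⟩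
  have hinj : Function.Injective
      (SpecialLinearGroup.toGL : SpecialLinearGroup (Fin 3) (ZMod 2) →* GL (Fin 3) (ZMod 2)) :=
    fun a b h => Subtype.ext (congrArg Units.val h)
  have hcenter : Subgroup.center (SpecialLinearGroup (Fin 3) (ZMod 2)) = ⊥ := by
    rw [eq_bot_iff]
    intro x hx
    obtain ⟨r, hr, hx⟩ := Matrix.SpecialLinearGroup.mem_center_iff.1 hx
    have : r = 1 := by
      revert hr
      clear hx
      revert r
      decide
    rw [this, map_one] at hx
    exact Subgroup.mem_bot.2 (Subtype.ext hx.symm)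
  exact ⟨(MulEquiv.ofBijective _ ⟨hinj, hsurj⟩).symm.trans
    ((QuotientGroup.quotientBot (G := SpecialLinearGroup (Fin 3) (ZMod 2))).symm.trans
      (QuotientGroup.quotientMulEquivOfEq hcenter.symm))⟩

end MatrixGroups

/-! ### From a surjective linear representation to the statements on fields. -/

section Conclusions

open Matrix

theorem index_eq_natDegree_of_fixingSubgroup_eq {k Ω H : Type*} [Field k] [Field Ω] [Algebra k Ω]
    [IsGalois k Ω] [Group H] {ρ : Gal(Ω/k) →* H} (hρ : Function.Surjective ρ) {A : Subgroup H} {x : Ω}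
    (hA : k⟮x⟯.fixingSubgroup = A.comap ρ) {f : k[X]} (hf : Irreducible f) (hfx : aeval x f = 0) :
    A.index = f.natDegree := by
  rw [← Subgroup.index_comap_of_surjective A hρ, ← hA, ← finrank_eq_fixingSubgroup_index,
    adjoin.finrank (Algebra.IsIntegral.isIntegral x), ← minpoly.eq_of_irreducible hf hfx,
    natDegree_mul_C (inv_ne_zero (leadingCoeff_ne_zero.2 hf.ne_zero))]

theorem finiteDimensional_adjoin_simple {k Ω : Type*} [Field k] [Field Ω] [Algebra k Ω]
    [Algebra.IsAlgebraic k Ω] (x : Ω) : FiniteDimensional k k⟮x⟯ :=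
  adjoin.finiteDimensional (Algebra.IsIntegral.isIntegral x)

/-- Two families of conjugate algebraic numbers on which the Galois group acts through the full
linear group, once by vectors and once by covectors. -/
theorem conclusions_of_linear_representation {Ω ι m F : Type*} [Field Ω] [Algebra ℚ Ω]
    [IsGalois ℚ Ω] [Fintype m] [DecidableEq m] [Field F] {α β : ι → Ω}
    (hpermα : ∀ (τ : Gal(Ω/ℚ)) i, ∃ i', τ • α i = α i')
    (hpermβ : ∀ (τ : Gal(Ω/ℚ)) i, ∃ i', τ • β i = β i')
    (htransα : ∀ i j, ∃ τ : Gal(Ω/ℚ), τ • α i = α j)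
    (htransβ : ∀ i j, ∃ τ : Gal(Ω/ℚ), τ • β i = β j)
    {v u : ι → m → F} (hv : Function.Injective v) (hu : Function.Injective u)
    (hvspan : ∀ A B : Matrix m m F, (∀ i, A *ᵥ v i = B *ᵥ v i) → A = B)
    (huspan : ∀ A B : Matrix m m F, (∀ i, u i ᵥ* A = u i ᵥ* B) → A = B)
    {ρ : Gal(Ω/ℚ) →* GL m F} (hρ : Function.Surjective ρ)
    (hρv : ∀ τ i i', τ • α i = α i' → (ρ τ : Matrix m m F) *ᵥ v i = v i')
    (hρu : ∀ τ i i', τ • β i = β i' → u i' ᵥ* (ρ τ : Matrix m m F) = u i)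
    (hmove : ∀ (g : GL m F) i j, ∃ x, x ∈ vecStabilizer ((g : Matrix m m F) *ᵥ v i) ∧
      x ∉ covecStabilizer (u j))
    {f g : ℚ[X]} (hf : Irreducible f) (hg : Irreducible g) (hfα : ∀ i, aeval (α i) f = 0)
    (hgβ : ∀ i, aeval (β i) g = 0)
    (hsylow : ∀ i j, (vecStabilizer (v i)).index = f.natDegree →
      (covecStabilizer (u j)).index = g.natDegree → ∀ p : ℕ, p.Prime →
      ∃ (C : Subgroup (GL m F)) (x : GL m F), C ≤ vecStabilizer (v i) ∧
      C.map (MulAut.conj x).toMonoidHom ≤ covecStabilizer (u j) ∧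
      ¬ p ∣ C.relIndex (vecStabilizer (v i)) ∧
      ¬ p ∣ (C.map (MulAut.conj x).toMonoidHom).relIndex (covecStabilizer (u j))) (i j : ι) :
    SylowConjugateFields ℚ⟮α i⟯ ℚ⟮β j⟯ ∧ IsEmpty (ℚ⟮α i⟯ ≃+* ℚ⟮β j⟯) ∧
      galoisClosure ℚ⟮α i⟯ = galoisClosure ℚ⟮β j⟯ ∧
      Nonempty (galoisGroup (galoisClosure ℚ⟮α i⟯) ≃* GL m F) := by
  have hK : ℚ⟮α i⟯.fixingSubgroup = (vecStabilizer (v i)).comap ρ := by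
    ext τ
    rw [mem_fixingSubgroup_adjoin_simple, Subgroup.mem_comap]
    exact smul_eq_iff_mem_vecStabilizer hpermα hv hρv τ i
  have hL : ℚ⟮β j⟯.fixingSubgroup = (covecStabilizer (u j)).comap ρ := by
    ext τ
    rw [mem_fixingSubgroup_adjoin_simple, Subgroup.mem_comap]
    exact smul_eq_iff_mem_covecStabilizer hpermβ hu hρu τ j
  have hA := eq_one_of_forall_conj_mem_vecStabilizer hvspan (i₀ := i) fun i' => by
    obtain ⟨τ, hτ⟩ := htransα i i'
    exact ⟨ρ τ, hρv τ i i' hτ⟩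
  have hB := eq_one_of_forall_conj_mem_covecStabilizer huspan (i₀ := j) fun j' => by
    obtain ⟨τ, hτ⟩ := htransβ j j'
    exact ⟨ρ τ, hρu τ j j' hτ⟩
  have hfin := finiteDimensional_adjoin_simple (k := ℚ) (α i)
  refine ⟨?_, ?_, galoisClosure_eq_of_fixingSubgroup_eq hρ hK hA hL hB,
    nonempty_galoisGroup_mulEquiv hρ hK hA⟩
  · exact sylowConjugateFields_of_fixingSubgroup_eq hρ hK
      (isOpen_ker_of_fixingSubgroup_eq hρ hK hA) hL
      (hsylow i j (index_eq_natDegree_of_fixingSubgroup_eq hρ hK hf (hfα i))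
        (index_eq_natDegree_of_fixingSubgroup_eq hρ hL hg (hgβ j)))
  · refine isEmpty_ringEquiv_of_fixingSubgroup_eq hK hL hρ fun x => ?_
    obtain ⟨y, hy, hy'⟩ := hmove x i j
    refine ⟨y, ?_, hy'⟩
    rw [mem_vecStabilizer] at hy ⊢
    rw [Units.val_mul, Units.val_mul, ← mulVec_mulVec, ← mulVec_mulVec, hy, mulVec_mulVec,
      ← Units.val_mul, inv_mul_cancel, Units.val_one, one_mulVec]

end Conclusions

/-! ### Labelling roots by Frobenius and bounding the Galois image. -/

section CyclicConfiguration

universe w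

variable {Ω : Type w} [Field Ω] [Algebra ℚ Ω] [IsAlgClosure ℚ Ω]

theorem aeval_reduction_eq_zero {Ω k : Type*} [Field Ω] [CommRing k]
    (φ : integralClosure ℤ Ω →+* k) {f : ℤ[X]} {x : integralClosure ℤ Ω}
    (hx : aeval (x : Ω) f = 0) : aeval (φ x) f = 0 := by
  have h1 : aeval x f = 0 := Subtype.val_injective
    ((aeval_algHom_apply (integralClosure ℤ Ω).val x f).symm.trans hx)
  exact (aeval_algHom_apply φ.toIntAlgHom x f).trans (by rw [h1, map_zero])

theorem exists_domain_reduction_frobenius {Ω : Type w} [Field Ω] [Algebra ℚ Ω] [IsGalois ℚ Ω] {ℓ : ℕ}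
    (hℓ : ℓ.Prime) :
    ∃ (k : Type w) (_ : CommRing k) (_ : IsDomain k) (φ : integralClosure ℤ Ω →+* k)
      (σ : Gal(Ω/ℚ)), (ℓ : k) = 0 ∧
      ∀ x y : integralClosure ℤ Ω, (y : Ω) = σ x → φ y = φ x ^ ℓ := by
  obtain ⟨Q, σ, hQ, hℓQ, hfrob⟩ := exists_reduction_frobenius (Ω := Ω) hℓ
  refine ⟨integralClosure ℤ Ω ⧸ Q, inferInstance, inferInstance, Ideal.Quotient.mk Q, σ, ?_, ?_⟩
  · rw [← map_natCast (Ideal.Quotient.mk Q)]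
    exact Ideal.Quotient.eq_zero_iff_mem.2 hℓQ
  · intro x y hxy
    rw [← map_pow]
    exact Ideal.Quotient.eq.2 (hfrob x y hxy)

/-- A polynomial relation `C` between the roots of `g` and `f`, cubic in the second variable, whose
cofactor `D` does not vanish at certain pairs in characteristic `ℓ`, gives the roots of `f` and `g`
the structure of a cyclic configuration. -/
theorem exists_cyclic_configuration {n : ℕ} [NeZero n] {f g : ℤ[X]} (hf : f.Monic)
    (hfn : f.natDegree = n) (hg : g.Monic) (hgn : g.natDegree = n) {ℓ : ℕ} (hℓ : ℓ.Prime)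
    {S : Finset (ZMod n)} (hS : S.card = 3)
    {C D : ∀ {A : Type w} [CommRing A], A → A → A}
    (hC : ∀ {A B : Type w} [CommRing A] [CommRing B] (φ : A →+* B) y x, φ (C y x) = C (φ y) (φ x))
    (hD : ∀ {A B : Type w} [CommRing A] [CommRing B] (φ : A →+* B) y x, φ (D y x) = D (φ y) (φ x))
    (hCD : ∀ {A : Type w} [CommRing A] (y x : A), aeval y g = 0 → aeval x f = 0 → C y x * D y x = 0)
    (hcubic : ∀ y : Ω, ∃ c₃ c₂ c₁ c₀ : Ω, c₃ ≠ 0 ∧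
      ∀ x, C y x = c₃ * x ^ 3 + c₂ * x ^ 2 + c₁ * x + c₀)
    (hred : ∀ {k : Type w} [CommRing k] [IsDomain k], (ℓ : k) = 0 → ∀ a : k, aeval a f = 0 →
      Function.minimalPeriod (· ^ ℓ) a = n ∧ ∃ p : ℤ[X], aeval (aeval a p) g = 0 ∧
        Function.minimalPeriod (· ^ ℓ) (aeval a p) = n ∧
        ∀ i ∈ S, D (aeval a p) (a ^ ℓ ^ i.val) ≠ 0) :
    ∃ (α β : ZMod n → Ω) (σ : Gal(Ω/ℚ)), Function.Injective α ∧ Function.Injective β ∧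
      (∀ z, aeval z f = 0 ↔ ∃ i, z = α i) ∧ (∀ z, aeval z g = 0 ↔ ∃ i, z = β i) ∧
      (∀ i, α (i + 1) = σ (α i)) ∧ (∀ i, β (i + 1) = σ (β i)) ∧
      ∀ i j, C (β j) (α i) = 0 ↔ i - j ∈ S := by
  have : IsAlgClosed Ω := IsAlgClosure.isAlgClosed ℚ
  have : CharZero Ω := algebraRat.charZero Ω
  obtain ⟨k, _, _, φ, σ, hℓ0, hσ⟩ := exists_domain_reduction_frobenius (Ω := Ω) hℓ
  obtain ⟨x₀, hx₀⟩ := IsAlgClosed.exists_aeval_eq_zero Ω f fun h =>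
    NeZero.ne n (hfn.symm.trans (natDegree_eq_of_degree_eq_some h))
  let x : integralClosure ℤ Ω := ⟨x₀, f, hf, hx₀⟩
  have hx : aeval (x : Ω) f = 0 := hx₀
  obtain ⟨hper, p, hp, hper', hne⟩ := hred hℓ0 (φ x) (aeval_reduction_eq_zero φ hx)
  have hpx : φ (aeval x p) = aeval (φ x) p := (aeval_algHom_apply φ.toIntAlgHom x p).symm
  rw [← hpx] at hp hper' hne
  -- The base point of the second labelling is a root of g whose reduction is the prescribed
  -- polynomial in that of x; this ties the two cyclic labellings together.
  obtain ⟨y, hy, hyx⟩ := exists_root_of_aeval_reduction_eq_zero φ hg _ hp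
  rw [← hyx] at hper' hne
  obtain ⟨r, -, hrinj, hrall, hrσ, hrφ⟩ := exists_cyclic_labelling hσ hf hfn x hx hper
  obtain ⟨s, hs0, hsinj, hsall, hsσ, -⟩ := exists_cyclic_labelling hσ hg hgn y hy hper'
  refine ⟨fun i => r i, fun i => s i, σ, Subtype.val_injective.comp hrinj,
    Subtype.val_injective.comp hsinj, hrall, hsall, hrσ, hsσ, ?_⟩
  refine cyclic_incidence_iff (α := fun i => (r i : Ω)) (β := fun i => (s i : Ω))
    (Subtype.val_injective.comp hrinj) hrσ hsσ
    (fun τ y x => hC (τ : Ω →+* Ω) y x) hcubic hS fun i hi => ?_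
  -- The product C·D vanishes in characteristic zero; D does not, since its reduction does not, so C
  -- vanishes.
  refine (mul_eq_zero.1 (hCD _ _ ((hsall _).2 ⟨0, rfl⟩) ((hrall _).2 ⟨i, rfl⟩))).resolve_right ?_
  intro hzero
  refine hne i hi ?_
  have h1 : D (s 0) (r i) = 0 := Subtype.val_injective
    ((hD (integralClosure ℤ Ω).val.toRingHom (s 0) (r i)).trans hzero)
  have h2 := hD φ (s 0) (r i)
  rw [h1, map_zero, hs0] at h2
  rw [h2]
  congr 1
  have := hrφ i.val
  rw [ZMod.natCast_zmod_val] at this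
  exact this.symm

/-- If modulo `ℓ` the polynomial `f` has a factor whose roots have Frobenius orbits of length divisible
by `d`, then `d` divides the order of every group through which the Galois group acts faithfully on
the roots of `f`. -/
theorem dvd_card_range_of_minimalPeriod {H : Type*} [Group H] [Finite H] {ρ : Gal(Ω/ℚ) →* H}
    {f h : ℤ[X]}
    (hker : ∀ τ, ρ τ = 1 → ∀ z : Ω, aeval z f = 0 → τ z = z) (hf : f.Monic) (hh : h.Monic)
    (hdeg : 0 < h.natDegree) {ℓ d : ℕ} (hℓ : ℓ.Prime)
    (hred : ∀ {k : Type w} [CommRing k] [IsDomain k], (ℓ : k) = 0 → ∀ a : k, aeval a h = 0 →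
      aeval a f = 0 ∧ d ∣ Function.minimalPeriod (· ^ ℓ) a) : d ∣ Nat.card ρ.range := by
  have : IsAlgClosed Ω := IsAlgClosure.isAlgClosed ℚ
  have : CharZero Ω := algebraRat.charZero Ω
  obtain ⟨k, _, _, φ, σ, hℓ0, hσ⟩ := exists_domain_reduction_frobenius (Ω := Ω) hℓ
  obtain ⟨x₀, hx₀⟩ := IsAlgClosed.exists_aeval_eq_zero Ω h fun h0 =>
    hdeg.ne' (natDegree_eq_of_degree_eq_some h0)
  let x : integralClosure ℤ Ω := ⟨x₀, h, hh, hx₀⟩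
  have hx : aeval (x : Ω) h = 0 := hx₀
  obtain ⟨hfx, hd⟩ := hred hℓ0 (φ x) (aeval_reduction_eq_zero φ hx)
  -- The root x of h is only an auxiliary lift of a residual root; y is a genuine root of f with the
  -- same reduction.
  obtain ⟨y, hy, hyx⟩ := exists_root_of_aeval_reduction_eq_zero φ hf x hfx
  rw [← hyx] at hd
  have h1 : d ∣ orderOf (ρ σ) := by
    refine hd.trans (minimalPeriod_reduction_dvd hσ _ y (hker _ ?_ _ hy))
    rw [map_pow, pow_orderOf_eq_one]
  have h2 : orderOf (⟨ρ σ, σ, rfl⟩ : ρ.range) = orderOf (ρ σ) := Subgroup.orderOf_mk _ _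
  exact h1.trans (h2 ▸ orderOf_dvd_natCard _)

end CyclicConfiguration

/-! ### Explicit polynomial identities in degree seven. -/

section SepticCertificates

/-- The polynomial `p₇` with integer coefficients. -/
noncomputable def septicP : ℤ[X] := X ^ 7 - 7 * X + 3

/-- The polynomial `q₇` with integer coefficients. -/
noncomputable def septicQ : ℤ[X] := X ^ 7 + 14 * X ^ 4 - 42 * X ^ 2 - 21 * X + 9

theorem septicP_monic : septicP.Monic := by
  unfold septicP
  monicity!

theorem septicQ_monic : septicQ.Monic := by
  unfold septicQ
  monicity!

theorem natDegree_septicP : septicP.natDegree = 7 := by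
  unfold septicP
  compute_degree!

theorem natDegree_septicQ : septicQ.natDegree = 7 := by
  unfold septicQ
  compute_degree!

theorem map_septicP : septicP.map (Int.castRingHom ℚ) = polyP7 := by
  simp [septicP, polyP7]

theorem map_septicQ : septicQ.map (Int.castRingHom ℚ) = polyQ7 := by
  simp [septicQ, polyQ7]

theorem aeval_septicP {A : Type*} [CommRing A] (x : A) : aeval x septicP = x ^ 7 - 7 * x + 3 := by
  simp [septicP, map_ofNat]

theorem aeval_septicQ {A : Type*} [CommRing A] (x : A) :
    aeval x septicQ = x ^ 7 + 14 * x ^ 4 - 42 * x ^ 2 - 21 * x + 9 := by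
  simp [septicQ, map_ofNat]

/-- The relation between the roots of `q₇` and those of `p₇`. -/
def septicC {A : Type*} [CommRing A] (y x : A) : A :=
  (32 * y ^ 6 - 51 * y ^ 5 + 81 * y ^ 4 + 319 * y ^ 3 - 510 * y ^ 2 - 534 * y + 183) +
    (23 * y ^ 6 - 36 * y ^ 5 + 57 * y ^ 4 + 232 * y ^ 3 - 360 * y ^ 2 - 393 * y + 126) * x +
    (-3 * y) * x ^ 2 +
    (3) * x ^ 3

/-- The cofactor of `septicC` in `p₇`. -/
def septicD {A : Type*} [CommRing A] (y x : A) : A :=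
  (-14 * y ^ 6 + 21 * y ^ 5 - 33 * y ^ 4 - 145 * y ^ 3 + 213 * y ^ 2 + 252 * y - 72) +
    (40 * y ^ 6 - 63 * y ^ 5 + 99 * y ^ 4 + 404 * y ^ 3 - 636 * y ^ 2 - 684 * y + 231) * x +
    (-23 * y ^ 6 + 36 * y ^ 5 - 57 * y ^ 4 - 232 * y ^ 3 + 363 * y ^ 2 + 393 * y - 126) * x ^ 2 +
    (3 * y) * x ^ 3 +
    (3) * x ^ 4

theorem map_septicC {A B : Type*} [CommRing A] [CommRing B] (φ : A →+* B) (y x : A) :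
    φ (septicC y x) = septicC (φ y) (φ x) := by
  simp [septicC, map_ofNat]

theorem map_septicD {A B : Type*} [CommRing A] [CommRing B] (φ : A →+* B) (y x : A) :
    φ (septicD y x) = septicD (φ y) (φ x) := by
  simp [septicD, map_ofNat]

/-- This is the splitting of 9·p₇ into a cubic and a quartic over the field of a root of q₇, cleared
of denominators. -/
theorem septicC_mul_septicD {A : Type*} [CommRing A] (y x : A) (hy : aeval y septicQ = 0)
    (hx : aeval x septicP = 0) : septicC y x * septicD y x = 0 := by
  rw [aeval_septicQ] at hy
  rw [aeval_septicP] at hx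
  unfold septicC septicD
  linear_combination (9 : A) * hx + ((-448 * y ^ 5 + 1386 * y ^ 4 - 3261 * y ^ 3 + 550 * y ^ 2 +
    5973 * y - 1467) +
    (958 * y ^ 5 - 3069 * y ^ 4 + 7308 * y ^ 3 - 2074 * y ^ 2 - 12318 * y + 3696) * x +
    (184 * y ^ 5 - 564 * y ^ 4 + 1302 * y ^ 3 - 97 * y ^ 2 - 2604 * y + 672) * x ^ 2 +
    (-529 * y ^ 5 + 1656 * y ^ 4 - 3918 * y ^ 3 + 838 * y ^ 2 + 6900 * y - 1788) * x ^ 3 +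
    (138) * x ^ 4) * hy

theorem pow_seven_of_aeval_septicP {k : Type*} [CommRing k] (h2 : (2 : k) = 0) {a : k}
    (ha : aeval a septicP = 0) : a ^ 7 = a + 1 := by
  rw [aeval_septicP] at ha
  linear_combination ha + (3 * a - 2) * h2

theorem pow_two_pow_of_aeval_septicP {k : Type*} [CommRing k] (h2 : (2 : k) = 0) {a : k}
    (ha : aeval a septicP = 0) :
    a ^ 8 = a ^ 2 + a ∧ a ^ 32 = a ^ 4 + a ^ 2 + a ∧ a ^ 64 = a ^ 4 + a ∧ a ^ 128 = a := by
  have h7 := pow_seven_of_aeval_septicP h2 ha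
  have h8 : a ^ 8 = a ^ 2 + a := by
    linear_combination (a) * h7
  have h16 : a ^ 16 = a ^ 4 + a ^ 2 := by
    rw [show a ^ 16 = (a ^ 8) ^ 2 by ring, h8]
    linear_combination (a ^ 3) * h2
  have h32 : a ^ 32 = a ^ 4 + a ^ 2 + a := by
    rw [show a ^ 32 = (a ^ 16) ^ 2 by ring, h16]
    linear_combination (a) * h7 + (a ^ 6) * h2
  have h64 : a ^ 64 = a ^ 4 + a := by
    rw [show a ^ 64 = (a ^ 32) ^ 2 by ring, h32]
    linear_combination (a) * h7 + (a ^ 6 + a ^ 5 + a ^ 3 + a ^ 2) * h2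
  have h128 : a ^ 128 = a := by
    rw [show a ^ 128 = (a ^ 64) ^ 2 by ring, h64]
    linear_combination (a) * h7 + (a ^ 5 + a ^ 2) * h2
  exact ⟨h8, h32, h64, h128⟩

theorem minimalPeriod_of_aeval_septicP {k : Type*} [CommRing k] [IsDomain k] (h2 : (2 : k) = 0)
    {a : k} (ha : aeval a septicP = 0) : Function.minimalPeriod (· ^ 2) a = 7 := by
  obtain ⟨-, -, -, h128⟩ := pow_two_pow_of_aeval_septicP h2 ha
  have : Fact (Nat.Prime 7) := ⟨by norm_num⟩
  refine minimalPeriod_pow_eq (q := 7) (i := 0) (fun h => one_ne_zero (α := k) ?_) (by simpa using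
    h128)
    (by norm_num)
  have h7 := pow_seven_of_aeval_septicP h2 ha
  have h : a ^ 2 = a := by simpa using h
  have h' : a ^ 7 = a := by
    linear_combination (a ^ 5 + a ^ 4 + a ^ 3 + a ^ 2 + a + 1) * h
  linear_combination h' - h7

/-- The multiplier of `h` is an inverse of D modulo 2 and the relation a⁷ = a + 1. Since p₇ and q₇
agree modulo 2, the same a serves as the reduction of a root of q₇. The exponents 8, 32 and 64
belong to the labels 3, 5 and 6. -/
theorem septicD_pow_eight_ne_zero {k : Type*} [CommRing k] [IsDomain k] (h2 : (2 : k) = 0)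
    {a : k} (ha : aeval a septicP = 0) : septicD a (a ^ 8) ≠ 0 := fun h =>
  one_ne_zero (α := k) <| by
  have h7 := pow_seven_of_aeval_septicP h2 ha
  rw [(pow_two_pow_of_aeval_septicP h2 ha).1] at h
  unfold septicD at h
  linear_combination (a ^ 4 + 1) * h - (a ^ 7 + a ^ 5 + 1) * h7 -
    (-12 * a ^ 14 - 5 * a ^ 13 + 17 * a ^ 12 - 159 * a ^ 11 - 66 * a ^ 10 + 711 * a ^ 9 + 400 * a
      ^ 8 - 821 * a ^ 7 - 237 * a ^ 6 + 958 * a ^ 5 + 346 * a ^ 4 - 662 * a ^ 3 - 183 * a ^ 2 + 242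
      * a - 36) * h2

theorem septicD_pow_thirtytwo_ne_zero {k : Type*} [CommRing k] [IsDomain k] (h2 : (2 : k) = 0)
    {a : k} (ha : aeval a septicP = 0) : septicD a (a ^ 32) ≠ 0 := fun h =>
  one_ne_zero (α := k) <| by
  have h7 := pow_seven_of_aeval_septicP h2 ha
  rw [(pow_two_pow_of_aeval_septicP h2 ha).2.1] at h
  unfold septicD at h
  linear_combination (a ^ 4 + a ^ 3 + a ^ 2 + 1) * h - (a ^ 13 + a ^ 12 + a ^ 8 + a ^ 7 + a ^ 4 +
    a ^ 3 + 1) * h7 -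
    (a ^ 20 + a ^ 19 - 4 * a ^ 18 + 20 * a ^ 17 - 21 * a ^ 16 - 98 * a ^ 15 + 60 * a ^ 14 + 28 * a
      ^ 13 + 202 * a ^ 12 + 784 * a ^ 11 + 1054 * a ^ 10 + 846 * a ^ 9 + 803 * a ^ 8 + 893 * a ^ 7 -
      453 * a ^ 6 - 355 * a ^ 5 + 521 * a ^ 4 - 456 * a ^ 3 - 219 * a ^ 2 + 242 * a - 36) * h2

theorem septicD_pow_sixtyfour_ne_zero {k : Type*} [CommRing k] [IsDomain k] (h2 : (2 : k) = 0)
    {a : k} (ha : aeval a septicP = 0) : septicD a (a ^ 64) ≠ 0 := fun h =>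
  one_ne_zero (α := k) <| by
  have h7 := pow_seven_of_aeval_septicP h2 ha
  rw [(pow_two_pow_of_aeval_septicP h2 ha).2.2.1] at h
  unfold septicD at h
  linear_combination (a ^ 5 + a ^ 4 + a ^ 3 + a ^ 2 + 1) * h - (a ^ 14 + a ^ 13 + a ^ 11 + a ^ 10
    + a ^ 8 + a ^ 5 + a ^ 4 + a ^ 2 + 1) * h7 -
    (a ^ 21 + a ^ 20 - 10 * a ^ 19 + 15 * a ^ 18 - 15 * a ^ 17 - 152 * a ^ 16 + 109 * a ^ 15 + 181
      * a ^ 14 - 11 * a ^ 13 + 687 * a ^ 12 + 334 * a ^ 11 + 92 * a ^ 10 + 691 * a ^ 9 - 481 * a ^ 8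
      + 82 * a ^ 7 + 243 * a ^ 6 - 810 * a ^ 5 + 393 * a ^ 4 + 12 * a ^ 3 - 334 * a ^ 2 + 242 * a -
      36) * h2

/-- A cubic factor of `p₇` modulo `17`. -/
noncomputable def septicCubic : ℤ[X] := X ^ 3 + 3 * X ^ 2 + 8 * X + 1

/-- A quartic factor of `p₇` modulo `13`. -/
noncomputable def septicQuartic : ℤ[X] := X ^ 4 + X ^ 3 + X ^ 2 + 5 * X - 4

theorem aeval_septicCubic {A : Type*} [CommRing A] (x : A) :
    aeval x septicCubic = x ^ 3 + 3 * x ^ 2 + 8 * x + 1 := by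
  simp [septicCubic, map_ofNat]

theorem aeval_septicQuartic {A : Type*} [CommRing A] (x : A) :
    aeval x septicQuartic = x ^ 4 + x ^ 3 + x ^ 2 + 5 * x - 4 := by
  simp [septicQuartic, map_ofNat]

theorem pow_of_aeval_septicCubic {k : Type*} [CommRing k] (hp : (17 : k) = 0) {a : k}
    (ha : aeval a septicCubic = 0) : a ^ 17 = -7 * a ^ 2 - 8 * a + 3 := by
  rw [aeval_septicCubic] at ha
  linear_combination (a ^ 14 - 3 * a ^ 13 + a ^ 12 + 3 * a ^ 11 + 3 * a ^ 10 + 7 * a ^ 8 - 7 * a ^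
    7 - a ^ 6 + a ^ 5 - 5 * a ^ 4 + 8 * a ^ 3 - 2 * a ^ 2 - 2 * a - 3) * ha + (a ^ 14 - a ^ 13 - 2
    * a ^ 12 - 2 * a ^ 11 - a ^ 10 - 2 * a ^ 9 + 3 * a ^ 8 + a ^ 7 + a ^ 5 - 3 * a ^ 4 + a ^ 3 + 2
    * a ^ 2 + 2 * a) * hp

/-- The Frobenius iterates of a are computed as quadratics in a; the third returns to a, and a
Bézout identity excludes that the first does. -/
theorem dvd_minimalPeriod_of_aeval_septicCubic {k : Type*} [CommRing k] [IsDomain k]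
    (hp : ((17 : ℕ) : k) = 0) {a : k} (ha : aeval a septicCubic = 0) :
    aeval a septicP = 0 ∧ 3 ∣ Function.minimalPeriod (· ^ 17) a := by
  rw [Nat.cast_ofNat] at hp
  have hr := pow_of_aeval_septicCubic hp ha
  have ha' := ha
  rw [aeval_septicCubic] at ha
  have h1 : aeval (-7 * a ^ 2 - 8 * a + 3) septicCubic = 0 := by
    rw [aeval_septicCubic]
    linear_combination (-3 * a ^ 3 + 6 * a ^ 2 - 2 * a - 6) * ha + (-20 * a ^ 6 - 69 * a ^ 5 - 44
      * a ^ 4 + 47 * a ^ 3 + 25 * a ^ 2 - 22 * a + 5) * hp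
  have h2 : (-7 * a ^ 2 - 8 * a + 3) ^ 17 = 7 * a ^ 2 + 7 * a - 6 := by
    rw [pow_of_aeval_septicCubic hp h1]
    linear_combination (-3 * a + 7) * ha + (-20 * a ^ 4 - 46 * a ^ 3 - 6 * a ^ 2 + 20 * a - 5) *
      hp
  have h3 : aeval (7 * a ^ 2 + 7 * a - 6) septicCubic = 0 := by
    rw [aeval_septicCubic]
    linear_combination (3 * a ^ 3 - 2 * a - 2) * ha + (20 * a ^ 6 + 60 * a ^ 5 + 16 * a ^ 4 - 66 *
      a ^ 3 - 9 * a ^ 2 + 34 * a - 9) * hp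
  have h4 : (7 * a ^ 2 + 7 * a - 6) ^ 17 = a := by
    rw [pow_of_aeval_septicCubic hp h3]
    linear_combination (-3 * a + 3) * ha + (-20 * a ^ 4 - 40 * a ^ 3 + 12 * a ^ 2 + 30 * a - 12) *
      hp
  refine ⟨?_, dvd_of_eq (minimalPeriod_pow_eq (q := 3) (i := 0) (fun h => ?_) ?_ rfl).symm⟩
  · rw [aeval_septicP]
    linear_combination (a ^ 4 - 3 * a ^ 3 + a ^ 2 + 3 * a + 3) * ha + (a ^ 4 - a ^ 3 - 2 * a ^ 2 -
      2 * a) * hp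
  · have h : a ^ 17 = a := by simpa using h
    rw [hr] at h
    refine one_ne_zero (α := k) ?_
    linear_combination (-5 * a ^ 2 + 2 * a + 4) * h - (a - 6) * ha - (2 * a ^ 4 + 2 * a ^ 3 - 3 *
      a ^ 2 + a + 1) * hp
  · rw [show 17 ^ 3 ^ (0 + 1) = 17 * 17 * 17 by norm_num, pow_mul, pow_mul, hr, h2, h4]

theorem pow_of_aeval_septicQuartic {k : Type*} [CommRing k] (hp : (13 : k) = 0) {a : k}
    (ha : aeval a septicQuartic = 0) :
    a ^ 13 ^ 2 = a ^ 3 - 6 * a ^ 2 + 4 * a - 4 := by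
  have hr {b : k} (hb : aeval b septicQuartic = 0) : b ^ 13 = -b ^ 3 - b ^ 2 - 4 * b + 5 := by
    rw [aeval_septicQuartic] at hb
    linear_combination (b ^ 9 - b ^ 8 - 4 * b ^ 6 - 6 * b ^ 3 + 3 * b ^ 2 + 3 * b - 2) * hb + (b ^
      9 + 2 * b ^ 7 - b ^ 6 + 2 * b ^ 4 - 3 * b ^ 3 + 2 * b - 1) * hp
  have h1 : aeval (-a ^ 3 - a ^ 2 - 4 * a + 5) septicQuartic = 0 := by
    rw [aeval_septicQuartic] at ha ⊢
    linear_combination (a ^ 8 + 3 * a ^ 7 + 5 * a ^ 6 + 5 * a ^ 5 - 4 * a ^ 4 - 4 * a ^ 3 - 4 * a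
      ^ 2 - 4) * ha + (a ^ 10 + a ^ 9 + 5 * a ^ 8 - 9 * a ^ 7 - 48 * a ^ 5 + 58 * a ^ 4 - 46 * a ^ 3
      + 158 * a ^ 2 - 180 * a + 60) * hp
  rw [sq, pow_mul, hr ha, hr h1]
  rw [aeval_septicQuartic] at ha
  linear_combination (a ^ 5 + 2 * a ^ 4 - a ^ 3 + 3 * a ^ 2 - 6 * a - 2) * ha + (a ^ 7 + 2 * a ^ 5
    - 6 * a ^ 4 + a ^ 3 - 9 * a ^ 2 + 26 * a - 13) * hp

/-- The square of Frobenius is given by a cubic in a; applied twice it returns a, and a Bézout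
identity shows that applied once it does not. -/
theorem dvd_minimalPeriod_of_aeval_septicQuartic {k : Type*} [CommRing k] [IsDomain k]
    (hp : ((13 : ℕ) : k) = 0) {a : k} (ha : aeval a septicQuartic = 0) :
    aeval a septicP = 0 ∧ 4 ∣ Function.minimalPeriod (· ^ 13) a := by
  rw [Nat.cast_ofNat] at hp
  have hr := pow_of_aeval_septicQuartic hp ha
  rw [aeval_septicQuartic] at ha
  have h3 : aeval (a ^ 3 - 6 * a ^ 2 + 4 * a - 4) septicQuartic = 0 := by
    rw [aeval_septicQuartic]
    linear_combination (a ^ 8 + a ^ 7 - 4 * a ^ 6 + a ^ 5 - a ^ 4 - a ^ 3 + 4 * a + 6) * ha + (-2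
      * a ^ 11 + 18 * a ^ 10 - 90 * a ^ 9 + 261 * a ^ 8 - 491 * a ^ 7 + 706 * a ^ 6 - 750 * a ^ 5 +
      639 * a ^ 4 - 405 * a ^ 3 + 200 * a ^ 2 - 66 * a + 16) * hp
  have h4 : (a ^ 3 - 6 * a ^ 2 + 4 * a - 4) ^ 13 ^ 2 = a := by
    rw [pow_of_aeval_septicQuartic hp h3]
    linear_combination (a ^ 5 - 6 * a ^ 4 - 5 * a ^ 3 + 5 * a ^ 2 + 2 * a + 6) * ha + (-a ^ 8 + 10
      * a ^ 7 - 29 * a ^ 6 + 56 * a ^ 5 - 84 * a ^ 4 + 75 * a ^ 3 - 68 * a ^ 2 + 29 * a - 12) * hp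
  refine ⟨?_, dvd_of_eq (minimalPeriod_pow_eq (q := 2) (i := 1) (fun h => ?_) ?_ rfl).symm⟩
  · rw [aeval_septicP]
    linear_combination (a ^ 3 - a ^ 2 - 4) * ha + (a ^ 3 + a - 1) * hp
  · rw [show 13 ^ 2 ^ 1 = 13 ^ 2 by norm_num, hr] at h
    refine one_ne_zero (α := k) ?_
    linear_combination (-5 * a ^ 3 - 6 * a ^ 2 - 2 * a - 2) * h - (-5 * a ^ 2 + 3 * a - 5) * ha -
      (2 * a ^ 5 + 2 * a ^ 4 + 3 * a ^ 3 + 3 * a - 1) * hp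
  · rw [show 13 ^ 2 ^ (1 + 1) = 13 ^ 2 * 13 ^ 2 by norm_num, pow_mul, hr, h4]

end SepticCertificates

/-! ### Explicit polynomial identities in degree eight. -/

section OcticCertificates

/-- The polynomial `p₈` with integer coefficients. -/
noncomputable def octicP : ℤ[X] :=
  X ^ 8 - 4 * X ^ 7 - 4 * X ^ 6 + 26 * X ^ 5 + 2 * X ^ 4 - 52 * X ^ 3 + 31 * X + 1

/-- The polynomial `q₈` with integer coefficients. -/
noncomputable def octicQ : ℤ[X] :=
  X ^ 8 + 12 * X ^ 7 + 30 * X ^ 6 - 108 * X ^ 5 - 402 * X ^ 4 + 342 * X ^ 3 + 1256 * X ^ 2 - 687 *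
    X - 337

theorem octicP_monic : octicP.Monic := by
  unfold octicP
  monicity!

theorem octicQ_monic : octicQ.Monic := by
  unfold octicQ
  monicity!

theorem natDegree_octicP : octicP.natDegree = 8 := by
  unfold octicP
  compute_degree!

theorem natDegree_octicQ : octicQ.natDegree = 8 := by
  unfold octicQ
  compute_degree!

theorem map_octicP : octicP.map (Int.castRingHom ℚ) = polyP8 := by
  simp [octicP, polyP8]

theorem map_octicQ : octicQ.map (Int.castRingHom ℚ) = polyQ8 := by
  simp [octicQ, polyQ8]

theorem aeval_octicP {A : Type*} [CommRing A] (x : A) : aeval x octicP =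
    x ^ 8 - 4 * x ^ 7 - 4 * x ^ 6 + 26 * x ^ 5 + 2 * x ^ 4 - 52 * x ^ 3 + 31 * x + 1 := by
  simp [octicP, map_ofNat]

theorem aeval_octicQ {A : Type*} [CommRing A] (x : A) : aeval x octicQ =
    x ^ 8 + 12 * x ^ 7 + 30 * x ^ 6 - 108 * x ^ 5 - 402 * x ^ 4 + 342 * x ^ 3 + 1256 * x ^ 2 - 687
      * x - 337 := by
  simp [octicQ, map_ofNat]

/-- The relation between the roots of `q₈` and those of `p₈`. -/
def octicC {A : Type*} [CommRing A] (y x : A) : A :=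
  (-79 * y ^ 7 - 813 * y ^ 6 - 1156 * y ^ 5 + 8704 * y ^ 4 + 20033 * y ^ 3 - 14855 * y ^ 2 - 71007
    * y - 23065) +
    (-33 * y ^ 6 - 297 * y ^ 5 + 352 * y ^ 4 + 6567 * y ^ 3 + 12529 * y ^ 2 - 13805 * y - 76164) *
      x +
    (17831 * y) * x ^ 2 +
    (17831) * x ^ 3

/-- The cofactor of `octicC` in `p₈`. -/
def octicD {A : Type*} [CommRing A] (y x : A) : A :=
  (355 * y ^ 7 + 4217 * y ^ 6 + 12976 * y ^ 5 - 12924 * y ^ 4 - 90687 * y ^ 3 + 5260 * y ^ 2 +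
    162968 * y - 90555) +
    (-13 * y ^ 7 - 1099 * y ^ 6 - 9780 * y ^ 5 - 18818 * y ^ 4 + 45278 * y ^ 3 + 91284 * y ^ 2 -
      167939 * y - 57033) * x +
    (13 * y ^ 7 + 87 * y ^ 6 + 672 * y ^ 5 + 5838 * y ^ 4 + 13462 * y ^ 3 - 33963 * y ^ 2 - 65217
      * y + 182015) * x ^ 2 +
    (33 * y ^ 6 + 297 * y ^ 5 - 352 * y ^ 4 - 6567 * y ^ 3 + 5302 * y ^ 2 + 85129 * y + 4840) * x
      ^ 3 +
    (-17831 * y - 71324) * x ^ 4 +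
    (17831) * x ^ 5

theorem map_octicC {A B : Type*} [CommRing A] [CommRing B] (φ : A →+* B) (y x : A) :
    φ (octicC y x) = octicC (φ y) (φ x) := by
  simp [octicC, map_ofNat]

theorem map_octicD {A B : Type*} [CommRing A] [CommRing B] (φ : A →+* B) (y x : A) :
    φ (octicD y x) = octicD (φ y) (φ x) := by
  simp [octicD, map_ofNat]

/-- A cubic factor of p₈ over the field of a root of q₈; the constant 317944561 is 17831², from
clearing denominators in both factors. -/
theorem octicC_mul_octicD {A : Type*} [CommRing A] (y x : A) (hy : aeval y octicQ = 0)
    (hx : aeval x octicP = 0) : octicC y x * octicD y x = 0 := by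
  rw [aeval_octicQ] at hy
  rw [aeval_octicP] at hx
  unfold octicC octicD
  linear_combination (317944561 : A) * hx + ((-28045 * y ^ 6 - 285218 * y ^ 5 - 599939 * y ^ 4 +
    1413524 * y ^ 3 + 5445960 * y ^ 2 + 2784977 * y - 5254322) +
    (1027 * y ^ 6 + 73351 * y ^ 5 + 525517 * y ^ 4 + 643539 * y ^ 3 - 1563300 * y ^ 2 - 332495 * y
      + 4877698) * x +
    (-1027 * y ^ 6 - 4689 * y ^ 5 - 11641 * y ^ 4 - 180945 * y ^ 3 - 914208 * y ^ 2 - 731337 * y -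
      432301) * x ^ 2 +
    (-3036 * y ^ 5 - 20592 * y ^ 4 + 42944 * y ^ 3 + 247170 * y ^ 2 - 332948 * y - 2800611) * x ^
      3 +
    (-1089 * y ^ 4 - 6534 * y ^ 3 + 46101 * y ^ 2 + 167706 * y + 1116885) * x ^ 4) * hy

theorem pow_three_pow_of_aeval_octicP {k : Type*} [CommRing k] (h3 : (3 : k) = 0) {a : k}
    (ha : aeval a octicP = 0) :
    a ^ 27 = -a ^ 7 - a ^ 6 + a ^ 5 + a ^ 3 + a ^ 2 + a + 1 ∧ a ^ 81 = 1 - a := by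
  have hF : a ^ 8 - a ^ 7 - a ^ 6 - a ^ 5 - a ^ 4 - a ^ 3 + a + 1 = 0 := by
    rw [aeval_octicP] at ha
    linear_combination ha + (a ^ 7 + a ^ 6 - 9 * a ^ 5 - a ^ 4 + 17 * a ^ 3 - 10 * a) * h3
  have h9 : a ^ 9 = -a ^ 7 - a ^ 6 - a ^ 5 - a ^ 4 + a ^ 3 - a ^ 2 + a - 1 := by
    linear_combination (a + 1) * hF + (a ^ 7 + a ^ 6 + a ^ 5 + a ^ 4 - a) * h3
  have h27 : a ^ 27 = -a ^ 7 - a ^ 6 + a ^ 5 + a ^ 3 + a ^ 2 + a + 1 := by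
    rw [show a ^ 27 = (a ^ 9) ^ 3 by ring, h9]
    linear_combination (-a ^ 13 - a ^ 12 + a ^ 11 + a ^ 10 - a ^ 4 + a ^ 2 + a + 1) * hF + (-a ^
      20 - 3 * a ^ 19 - 4 * a ^ 18 - 3 * a ^ 17 - 3 * a ^ 16 - a ^ 15 + a ^ 14 - a ^ 13 + a ^ 12 - 5
      * a ^ 11 - a ^ 10 - a ^ 9 - 2 * a ^ 8 + 5 * a ^ 7 - 4 * a ^ 6 + 6 * a ^ 5 - 4 * a ^ 4 + 3 * a
      ^ 3 - 3 * a ^ 2 - 1) * h3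
  have h81 : a ^ 81 = 1 - a := by
    rw [show a ^ 81 = (a ^ 27) ^ 3 by ring, h27]
    linear_combination (-a ^ 13 - a ^ 12 + a ^ 11 + a ^ 10 - a ^ 7 - a ^ 6 + a ^ 5 - a ^ 4 - a ^ 3
      - a ^ 2 + a) * hF + (-a ^ 20 - a ^ 19 + a ^ 18 + a ^ 17 + 2 * a ^ 16 + 3 * a ^ 15 + a ^ 14 - a
      ^ 13 - 5 * a ^ 12 - 6 * a ^ 11 - 5 * a ^ 10 - 5 * a ^ 9 + 2 * a ^ 7 + 4 * a ^ 6 + 5 * a ^ 5 +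
      5 * a ^ 4 + 4 * a ^ 3 + 2 * a ^ 2 + a) * h3
  exact ⟨h27, h81⟩

theorem minimalPeriod_of_aeval_octicP {k : Type*} [CommRing k] [IsDomain k] (h3 : (3 : k) = 0)
    {a : k} (ha : aeval a octicP = 0) : Function.minimalPeriod (· ^ 3) a = 8 := by
  obtain ⟨-, h81⟩ := pow_three_pow_of_aeval_octicP h3 ha
  -- The polynomial p₈ is invariant under x ↦ 1 − x, and the fourth power of Frobenius acts on its
  -- roots by this involution.
  have h1 : aeval (1 - a) octicP = 0 := by
    rw [aeval_octicP] at ha ⊢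
    linear_combination ha
  obtain ⟨-, h81'⟩ := pow_three_pow_of_aeval_octicP h3 h1
  refine minimalPeriod_pow_eq (q := 2) (i := 2) (fun h => one_ne_zero (α := k) ?_) ?_ (by
    norm_num)
  · have h : a ^ 81 = a := by simpa using h
    rw [aeval_octicP] at ha
    have h' : a + 1 = 0 := by linear_combination 2 * h81 - 2 * h + (1 - a) * h3
    linear_combination (a ^ 7 + a ^ 6 + a ^ 5 + a ^ 4 + a ^ 3 + a ^ 2 - a - 1) * h' - (1) * ha -
      (2 * a ^ 7 + 2 * a ^ 6 - 8 * a ^ 5 + 18 * a ^ 3 - 11 * a - 1) * h3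
  · rw [show 3 ^ 8 = 81 * 81 by norm_num, pow_mul, h81, h81', sub_sub_cancel]

/-- Modulo 3 the polynomial q₈ becomes x⁸ − x² − 1, and the fourth power of Frobenius acts on its
roots as negation. -/
theorem minimalPeriod_of_aeval_octicQ {k : Type*} [CommRing k] [IsDomain k] (h3 : (3 : k) = 0)
    {b : k} (hb : aeval b octicQ = 0) : Function.minimalPeriod (· ^ 3) b = 8 := by
  have hG : b ^ 8 - b ^ 2 - 1 = 0 := by
    rw [aeval_octicQ] at hb
    linear_combination hb + (-4 * b ^ 7 - 10 * b ^ 6 + 36 * b ^ 5 + 134 * b ^ 4 - 114 * b ^ 3 -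
      419 * b ^ 2 + 229 * b + 112) * h3
  have h27 : b ^ 27 = -b ^ 3 + b := by
    linear_combination (b ^ 19 + b ^ 13 + b ^ 11 + b ^ 7 - b ^ 5 + b ^ 3 + b) * hG + (b ^ 13 + b ^
      3) * h3
  have h81 : b ^ 81 = -b := by
    rw [show b ^ 81 = (b ^ 27) ^ 3 by ring, h27]
    linear_combination (-b) * hG + (b ^ 7 - b ^ 5) * h3
  refine minimalPeriod_pow_eq (q := 2) (i := 2) (fun h => one_ne_zero (α := k) ?_) ?_ (by
    norm_num)
  · have h : b ^ 81 = b := by simpa using h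
    have h0 : b = 0 := by linear_combination h - h81 + b * h3
    linear_combination (b ^ 7 - b) * h0 - hG
  · rw [show 3 ^ 8 = 81 * 81 by norm_num, pow_mul, h81, Odd.neg_pow (by decide), h81, neg_neg]

/-- A polynomial that sends the roots of `p₈` modulo `3` to roots of `q₈` modulo `3`. -/
noncomputable def octicLink : ℤ[X] := X ^ 7 + X ^ 6 - X ^ 5 + X ^ 3 - X ^ 2 + X - 1

theorem aeval_octicLink {A : Type*} [CommRing A] (x : A) :
    aeval x octicLink = x ^ 7 + x ^ 6 - x ^ 5 + x ^ 3 - x ^ 2 + x - 1 := by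
  simp [octicLink]

theorem aeval_octicLink_octicQ {k : Type*} [CommRing k] (h3 : (3 : k) = 0) {a : k}
    (ha : aeval a octicP = 0) : aeval (aeval a octicLink) octicQ = 0 := by
  rw [aeval_octicP] at ha
  rw [aeval_octicLink, aeval_octicQ]
  linear_combination (a ^ 48 + a ^ 45 + a ^ 40 + a ^ 37 - a ^ 36 - a ^ 34 - a ^ 33 + a ^ 32 + a ^
    31 + a ^ 29 + a ^ 27 + a ^ 26 - a ^ 25 - a ^ 23 - a ^ 22 - a ^ 21 - a ^ 20 - a ^ 19 + a ^ 18 -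
    a ^ 17 - a ^ 15 + a ^ 13 - a ^ 9 + a ^ 8 - a ^ 5 + a ^ 3 - a ^ 2 + a - 1) * ha + (4 * a ^ 55 +
    8 * a ^ 54 - 9 * a ^ 53 - 20 * a ^ 52 + 16 * a ^ 51 + 50 * a ^ 50 - 7 * a ^ 49 - 81 * a ^ 48 +
    92 * a ^ 47 + 131 * a ^ 46 - 324 * a ^ 45 + 3 * a ^ 44 + 664 * a ^ 43 - 505 * a ^ 42 - 646 * a
    ^ 41 + 1267 * a ^ 40 - 277 * a ^ 39 - 1389 * a ^ 38 + 1847 * a ^ 37 - 239 * a ^ 36 - 2344 * a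
    ^ 35 + 2657 * a ^ 34 - 453 * a ^ 33 - 2792 * a ^ 32 + 4388 * a ^ 31 - 2008 * a ^ 30 - 3982 * a
    ^ 29 + 7048 * a ^ 28 - 3241 * a ^ 27 - 4467 * a ^ 26 + 8874 * a ^ 25 - 5488 * a ^ 24 - 3581 *
    a ^ 23 + 9878 * a ^ 22 - 7139 * a ^ 21 - 362 * a ^ 20 + 8348 * a ^ 19 - 9872 * a ^ 18 + 3046 *
    a ^ 17 + 6495 * a ^ 16 - 9251 * a ^ 15 + 5069 * a ^ 14 + 2206 * a ^ 13 - 6820 * a ^ 12 + 5651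
    * a ^ 11 - 720 * a ^ 10 - 3093 * a ^ 9 + 3745 * a ^ 8 - 2605 * a ^ 7 - 634 * a ^ 6 + 1898 * a
    ^ 5 - 1423 * a ^ 4 + 385 * a ^ 3 + 101 * a ^ 2 - 393 * a + 330) * h3

theorem octicD_eq_of_char_three {k : Type*} [CommRing k] (h3 : (3 : k) = 0) (y x : k) :
    octicD y x = (y ^ 7 - y ^ 6 + y ^ 5 + y ^ 2 - y) +
    (-y ^ 7 - y ^ 6 + y ^ 4 - y ^ 3 + y) * x +
    (y ^ 7 + y ^ 3 - 1) * x ^ 2 +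
    (-y ^ 4 + y ^ 2 + y + 1) * x ^ 3 +
    (y + 1) * x ^ 4 +
    (-1) * x ^ 5 := by
  unfold octicD
  linear_combination -((-118 * y ^ 7 - 1406 * y ^ 6 - 4325 * y ^ 5 + 4308 * y ^ 4 + 30229 * y ^ 3
    - 1753 * y ^ 2 - 54323 * y + 30185) +
    (4 * y ^ 7 + 366 * y ^ 6 + 3260 * y ^ 5 + 6273 * y ^ 4 - 15093 * y ^ 3 - 30428 * y ^ 2 + 55980
      * y + 19011) * x +
    (-4 * y ^ 7 - 29 * y ^ 6 - 224 * y ^ 5 - 1946 * y ^ 4 - 4487 * y ^ 3 + 11321 * y ^ 2 + 21739 *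
      y - 60672) * x ^ 2 +
    (-11 * y ^ 6 - 99 * y ^ 5 + 117 * y ^ 4 + 2189 * y ^ 3 - 1767 * y ^ 2 - 28376 * y - 1613) * x
      ^ 3 +
    (5944 * y + 23775) * x ^ 4 +
    (-5944) * x ^ 5) * h3

/-- As in degree seven, the multiplier of `h` inverts D modulo 3 and p₈. This is label 0; labels 1
and 3 give the powers a³ and a²⁷. -/
theorem octicD_self_ne_zero {k : Type*} [CommRing k] [IsDomain k] (h3 : (3 : k) = 0)
    {a : k} (ha : aeval a octicP = 0) : octicD (aeval a octicLink) a ≠ 0 := fun h =>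
  one_ne_zero (α := k) <| by
  rw [octicD_eq_of_char_three h3, aeval_octicLink] at h
  rw [aeval_octicP] at ha
  linear_combination (a ^ 7 + a ^ 6 - a ^ 5 - a ^ 2 + a + 1) * h - (a ^ 50 - a ^ 49 + a ^ 48 + a ^
    47 + a ^ 46 - a ^ 44 + a ^ 43 + a ^ 42 + a ^ 39 - a ^ 38 - a ^ 37 - a ^ 36 - a ^ 35 - a ^ 34 -
    a ^ 33 + a ^ 32 + a ^ 31 - a ^ 28 - a ^ 26 + a ^ 25 - a ^ 24 - a ^ 23 + a ^ 21 + a ^ 20 - a ^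
    16 + a ^ 15 - a ^ 13 + a ^ 12 - a ^ 9 - a ^ 8 + a ^ 7 + a ^ 6 - a ^ 5 - a ^ 4 + a ^ 3 - a ^ 2
    - a + 1) * ha -
    (4 * a ^ 57 + 4 * a ^ 56 - 13 * a ^ 55 - 4 * a ^ 54 + 28 * a ^ 53 + 13 * a ^ 52 - 60 * a ^ 51
      - 30 * a ^ 50 + 163 * a ^ 49 - 40 * a ^ 48 - 283 * a ^ 47 + 305 * a ^ 46 + 136 * a ^ 45 - 621
      * a ^ 44 + 507 * a ^ 43 + 354 * a ^ 42 - 1158 * a ^ 41 + 937 * a ^ 40 + 433 * a ^ 39 - 1916 *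
      a ^ 38 + 1862 * a ^ 37 + 131 * a ^ 36 - 2577 * a ^ 35 + 3254 * a ^ 34 - 1079 * a ^ 33 - 2477 *
      a ^ 32 + 4542 * a ^ 31 - 3211 * a ^ 30 - 754 * a ^ 29 + 4459 * a ^ 28 - 5181 * a ^ 27 + 2361 *
      a ^ 26 + 1987 * a ^ 25 - 4934 * a ^ 24 + 4753 * a ^ 23 - 1851 * a ^ 22 - 1742 * a ^ 21 + 3933
      * a ^ 20 - 3800 * a ^ 19 + 1860 * a ^ 18 + 508 * a ^ 17 - 2081 * a ^ 16 + 2382 * a ^ 15 - 1656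
      * a ^ 14 + 598 * a ^ 13 + 266 * a ^ 12 - 772 * a ^ 11 + 818 * a ^ 10 - 526 * a ^ 9 + 243 * a ^
      8 - 86 * a ^ 7 - 13 * a ^ 6 + 69 * a ^ 5 - 95 * a ^ 4 + 66 * a ^ 3 - 7 * a ^ 2 - 5 * a - 1) *
      h3

theorem octicD_pow_three_ne_zero {k : Type*} [CommRing k] [IsDomain k] (h3 : (3 : k) = 0)
    {a : k} (ha : aeval a octicP = 0) : octicD (aeval a octicLink) (a ^ 3) ≠ 0 := fun h =>
  one_ne_zero (α := k) <| by
  rw [octicD_eq_of_char_three h3, aeval_octicLink] at h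
  rw [aeval_octicP] at ha
  linear_combination (a + 1) * h - (a ^ 48 + a ^ 46 - a ^ 45 + a ^ 44 - a ^ 43 - a ^ 41 - a ^ 40 -
    a ^ 38 + a ^ 37 + a ^ 36 + a ^ 35 - a ^ 34 - a ^ 32 - a ^ 31 - a ^ 29 + a ^ 28 + a ^ 27 + a ^
    26 - a ^ 25 - a ^ 24 - a ^ 23 + a ^ 21 + a ^ 20 - a ^ 19 - a ^ 16 + a ^ 14 - a ^ 13 + a ^ 12 -
    a ^ 11 - a ^ 10 - a ^ 7 + a ^ 6 + a ^ 5 + a ^ 4 - a ^ 3 - a ^ 2 + a + 1) * ha -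
    (4 * a ^ 55 + 8 * a ^ 54 - 5 * a ^ 53 - 20 * a ^ 52 - 5 * a ^ 51 + 48 * a ^ 50 + 29 * a ^ 49 -
      78 * a ^ 48 - 37 * a ^ 47 + 65 * a ^ 46 + 16 * a ^ 45 - 5 * a ^ 44 - 8 * a ^ 43 - 135 * a ^ 42
      + 49 * a ^ 41 + 213 * a ^ 40 - 153 * a ^ 39 - 30 * a ^ 38 + 100 * a ^ 37 - 221 * a ^ 36 + 261
      * a ^ 35 + 102 * a ^ 34 - 489 * a ^ 33 + 339 * a ^ 32 + 64 * a ^ 31 - 305 * a ^ 30 + 523 * a ^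
      29 - 376 * a ^ 28 - 234 * a ^ 27 + 598 * a ^ 26 - 485 * a ^ 25 + 101 * a ^ 24 + 327 * a ^ 23 -
      539 * a ^ 22 + 350 * a ^ 21 + 88 * a ^ 20 - 398 * a ^ 19 + 356 * a ^ 18 - 91 * a ^ 17 - 164 *
      a ^ 16 + 316 * a ^ 15 - 229 * a ^ 14 - 34 * a ^ 13 + 231 * a ^ 12 - 281 * a ^ 11 + 208 * a ^
      10 - 95 * a ^ 9 - 5 * a ^ 8 + 140 * a ^ 7 - 174 * a ^ 6 + 77 * a ^ 5 - 47 * a ^ 4 + 65 * a ^ 3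
      - 25 * a ^ 2 - 6 * a - 1) * h3

theorem octicD_pow_twentyseven_ne_zero {k : Type*} [CommRing k] [IsDomain k] (h3 : (3 : k) = 0)
    {a : k} (ha : aeval a octicP = 0) : octicD (aeval a octicLink) (a ^ 27) ≠ 0 := fun h =>
  one_ne_zero (α := k) <| by
  rw [(pow_three_pow_of_aeval_octicP h3 ha).1, octicD_eq_of_char_three h3, aeval_octicLink] at h
  rw [aeval_octicP] at ha
  linear_combination (a ^ 7 + a ^ 6 + a ^ 5 + a ^ 4 - a ^ 3 + a ^ 2 + 1) * h - (a ^ 62 - a ^ 61 +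
    a ^ 60 - a ^ 59 + a ^ 58 - a ^ 57 - a ^ 56 + a ^ 55 - a ^ 50 + a ^ 49 + a ^ 48 - a ^ 47 + a ^
    44 - a ^ 43 + a ^ 40 + a ^ 38 + a ^ 37 + a ^ 34 - a ^ 32 + a ^ 31 + a ^ 28 - a ^ 27 - a ^ 26 +
    a ^ 25 - a ^ 24 - a ^ 21 - a ^ 20 - a ^ 18 - a ^ 17 + a ^ 16 + a ^ 15 + a ^ 14 + a ^ 12 - a ^
    10 - a ^ 8 - a ^ 7 + a ^ 6 - a ^ 5 - a ^ 4 - a ^ 3 - a + 1) * ha -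
    (5 * a ^ 69 + 12 * a ^ 68 + 8 * a ^ 67 - 5 * a ^ 66 - 40 * a ^ 65 - 18 * a ^ 64 + 41 * a ^ 63
      - 37 * a ^ 62 - 64 * a ^ 61 - 5 * a ^ 60 - 61 * a ^ 59 + 96 * a ^ 58 + 261 * a ^ 57 - 241 * a
      ^ 56 - 77 * a ^ 55 + 679 * a ^ 54 - 335 * a ^ 53 - 293 * a ^ 52 + 855 * a ^ 51 - 955 * a ^ 50
      - 78 * a ^ 49 + 1301 * a ^ 48 - 2102 * a ^ 47 + 614 * a ^ 46 + 1524 * a ^ 45 - 2861 * a ^ 44 +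
      2448 * a ^ 43 - 5 * a ^ 42 - 2937 * a ^ 41 + 4821 * a ^ 40 - 3035 * a ^ 39 - 867 * a ^ 38 +
      4474 * a ^ 37 - 6137 * a ^ 36 + 4211 * a ^ 35 + 233 * a ^ 34 - 5365 * a ^ 33 + 7650 * a ^ 32 -
      5971 * a ^ 31 + 1631 * a ^ 30 + 4157 * a ^ 29 - 8046 * a ^ 28 + 7997 * a ^ 27 - 4587 * a ^ 26
      - 1199 * a ^ 25 + 5664 * a ^ 24 - 7997 * a ^ 23 + 6663 * a ^ 22 - 2631 * a ^ 21 - 1330 * a ^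
      20 + 4770 * a ^ 19 - 5187 * a ^ 18 + 4418 * a ^ 17 - 1965 * a ^ 16 + 27 * a ^ 15 + 1323 * a ^
      14 - 1589 * a ^ 13 + 949 * a ^ 12 - 259 * a ^ 11 - 660 * a ^ 10 + 876 * a ^ 9 - 1070 * a ^ 8 +
      712 * a ^ 7 - 602 * a ^ 6 + 295 * a ^ 5 - 187 * a ^ 4 + 75 * a ^ 3 - 17 * a ^ 2 - 6 * a - 2) *
      h3

/-- A sextic factor of `p₈` modulo `2`. -/
noncomputable def octicSextic : ℤ[X] := X ^ 6 + X ^ 5 + X ^ 3 + X ^ 2 + 1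

theorem aeval_octicSextic {A : Type*} [CommRing A] (x : A) :
    aeval x octicSextic = x ^ 6 + x ^ 5 + x ^ 3 + x ^ 2 + 1 := by
  simp [octicSextic]

/-- From a⁸ = a + 1 the orbit length divides 6. If 3 did not divide it, it would divide 2, and a⁴ =
a contradicts the sextic. -/
theorem dvd_minimalPeriod_of_aeval_octicSextic {k : Type*} [CommRing k] [IsDomain k]
    (hp : ((2 : ℕ) : k) = 0) {a : k} (ha : aeval a octicSextic = 0) :
    aeval a octicP = 0 ∧ 3 ∣ Function.minimalPeriod (· ^ 2) a := by
  have h2 : (2 : k) = 0 := by rwa [Nat.cast_ofNat] at hp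
  rw [aeval_octicSextic] at ha
  have h8 : a ^ 8 = a + 1 := by
    linear_combination (a ^ 2 + a + 1) * ha + (-a ^ 7 - a ^ 6 - a ^ 5 - a ^ 4 - a ^ 3 - a ^ 2 - a
      - 1) * h2
  have h16 : a ^ 16 = a ^ 2 + 1 := by
    rw [show a ^ 16 = (a ^ 8) ^ 2 by ring, h8]
    linear_combination (a) * h2
  have h32 : a ^ 32 = a ^ 4 + 1 := by
    rw [show a ^ 32 = (a ^ 16) ^ 2 by ring, h16]
    linear_combination (a ^ 2) * h2
  have h64 : a ^ 64 = a := by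
    rw [show a ^ 64 = (a ^ 32) ^ 2 by ring, h32]
    linear_combination (a ^ 2 + a + 1) * ha + (-a ^ 7 - a ^ 6 - a ^ 5 - a ^ 3 - a ^ 2 - a) * h2
  refine ⟨?_, by_contra fun h => one_ne_zero (α := k) ?_⟩
  · rw [aeval_octicP]
    linear_combination (a ^ 2 + a + 1) * ha + (-3 * a ^ 7 - 3 * a ^ 6 + 12 * a ^ 5 - 27 * a ^ 3 -
      a ^ 2 + 15 * a) * h2
  · have h6 : Function.minimalPeriod (· ^ 2) a ∣ 2 * 3 := by
      refine Function.IsPeriodicPt.minimalPeriod_dvd ?_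
      rw [Function.IsPeriodicPt, Function.IsFixedPt, pow_iterate]
      exact h64
    have h4 : a ^ 2 ^ 2 = a := by
      have := Function.isPeriodicPt_iff_minimalPeriod_dvd.2
        (((Nat.Prime.coprime_iff_not_dvd Nat.prime_three).2 h).symm.dvd_of_dvd_mul_right h6)
      rwa [Function.IsPeriodicPt, Function.IsFixedPt, pow_iterate] at this
    have h4 : a ^ 4 = a := h4
    linear_combination (a ^ 2 + a) * h4 - (1) * ha - (-a ^ 3 - a ^ 2 - 1) * h2

end OcticCertificates

/-! ### The linear representation attached to a cyclic configuration. -/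

section CyclicRepresentation

open Matrix

theorem exists_smul_root_eq {Ω ι : Type*} [Field Ω] [Algebra ℚ Ω] {f : ℤ[X]}
    {r : ι → Ω} (hr : ∀ z, aeval z f = 0 ↔ ∃ i, z = r i) (τ : Gal(Ω/ℚ)) (i : ι) :
    ∃ i', τ • r i = r i' :=
  (hr _).1 (aeval_galois_apply_eq_zero τ ((hr _).2 ⟨i, rfl⟩))

theorem exists_smul_eq_of_cyclic {k Ω : Type*} [Field k] [Field Ω] [Algebra k Ω] {n : ℕ} [NeZero n]
    {r : ZMod n → Ω} {σ : Gal(Ω/k)} (hr : ∀ i, r (i + 1) = σ (r i)) (i j : ZMod n) :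
    ∃ τ : Gal(Ω/k), τ • r i = r j := by
  have h : ∀ m : ℕ, σ ^ m • r i = r (i + m) := fun m => by
    induction m with
    | zero => simp
    | succ m ih => rw [pow_succ', mul_smul, ih, Nat.cast_succ, ← add_assoc, hr]; rfl
  exact ⟨σ ^ (j - i).val, by rw [h, ZMod.natCast_zmod_val, add_sub_cancel]⟩

theorem eq_of_mulVec_eq_of_single {ι m F : Type*} [Fintype m] [DecidableEq m] [CommRing F]
    {v : ι → m → F} (hv : ∀ c, ∃ i, v i = Pi.single c 1) (A B : Matrix m m F)
    (h : ∀ i, A *ᵥ v i = B *ᵥ v i) : A = B := by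
  ext r c
  obtain ⟨i, hi⟩ := hv c
  simpa [hi] using congrFun (h i) r

theorem eq_of_vecMul_eq_of_single {ι m F : Type*} [Fintype m] [DecidableEq m] [CommRing F]
    {u : ι → m → F} (hu : ∀ c, ∃ i, u i = Pi.single c 1) (A B : Matrix m m F)
    (h : ∀ i, u i ᵥ* A = u i ᵥ* B) : A = B := by
  ext r c
  obtain ⟨i, hi⟩ := hu r
  simpa [hi] using congrFun (h i) c

theorem aeval_map_intCastRingHom {Ω : Type*} [Field Ω] [Algebra ℚ Ω] (f : ℤ[X]) (z : Ω) :
    aeval z (f.map (Int.castRingHom ℚ)) = aeval z f := by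
  rw [← algebraMap_int_eq, aeval_map_algebraMap]

/-- A cyclic configuration of the roots of `f` and `g` whose automorphisms are linear, and whose
Galois group is the full linear group. -/
theorem conclusions_of_cyclic_configuration {Ω m F : Type*} [Field Ω] [Algebra ℚ Ω] [IsGalois ℚ Ω]
    [Fintype m] [DecidableEq m] [Field F] {n : ℕ} [NeZero n] {f g : ℤ[X]} (hf : f.Monic)
    (hfn : f.natDegree = n) (hg : g.Monic) (hgn : g.natDegree = n) {α β : ZMod n → Ω}
    {σ : Gal(Ω/ℚ)} (hα : Function.Injective α) (hβ : Function.Injective β)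
    (hαf : ∀ z, aeval z f = 0 ↔ ∃ i, z = α i) (hβg : ∀ z, aeval z g = 0 ↔ ∃ i, z = β i)
    (hασ : ∀ i, α (i + 1) = σ (α i)) (hβσ : ∀ i, β (i + 1) = σ (β i))
    {I : Ω → Ω → Prop} (hI : ∀ (τ : Gal(Ω/ℚ)) y x, I (τ • y) (τ • x) ↔ I y x)
    {S : Finset (ZMod n)} (hS : ∀ i j, I (β j) (α i) ↔ i - j ∈ S)
    {v u : ZMod n → m → F} {c : F} (hv : Function.Injective v) (hu : Function.Injective u)
    (hvsingle : ∀ c, ∃ i, v i = Pi.single c 1) (husingle : ∀ c, ∃ i, u i = Pi.single c 1)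
    (hinc : ∀ i j, i - j ∈ S ↔ u j ⬝ᵥ v i = c)
    (hdual : ∀ j w, (∀ i, w ⬝ᵥ v i = c ↔ u j ⬝ᵥ v i = c) → w = u j)
    (hlin : ∀ π π' : ZMod n → ZMod n, Function.Injective π → Function.Surjective π' →
      (∀ i j, π i - π' j ∈ S ↔ i - j ∈ S) → ∃ A : Matrix m m F, ∀ i, A *ᵥ v i = v (π i))
    (hsurj : ∀ ρ : Gal(Ω/ℚ) →* GL m F, (∀ τ, ρ τ = 1 → ∀ z : Ω, aeval z f = 0 → τ z = z) →
      (∀ i, (ρ σ : Matrix m m F) *ᵥ v i = v (i + 1)) → ρ.range = ⊤)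
    (hmove : ∀ (g : GL m F) i j, ∃ x, x ∈ vecStabilizer ((g : Matrix m m F) *ᵥ v i) ∧
      x ∉ covecStabilizer (u j))
    (hsylow : ∀ i j, (vecStabilizer (v i)).index = n →
      (covecStabilizer (u j)).index = n → ∀ p : ℕ, p.Prime →
      ∃ (C : Subgroup (GL m F)) (x : GL m F), C ≤ vecStabilizer (v i) ∧
      C.map (MulAut.conj x).toMonoidHom ≤ covecStabilizer (u j) ∧
      ¬ p ∣ C.relIndex (vecStabilizer (v i)) ∧
      ¬ p ∣ (C.map (MulAut.conj x).toMonoidHom).relIndex (covecStabilizer (u j))) :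
    Irreducible (f.map (Int.castRingHom ℚ)) ∧ Irreducible (g.map (Int.castRingHom ℚ)) ∧
      ∀ x y : Ω, aeval x (f.map (Int.castRingHom ℚ)) = 0 → aeval y (g.map (Int.castRingHom ℚ)) = 0 →
        SylowConjugateFields ℚ⟮x⟯ ℚ⟮y⟯ ∧ IsEmpty (ℚ⟮x⟯ ≃+* ℚ⟮y⟯) ∧
        galoisClosure ℚ⟮x⟯ = galoisClosure ℚ⟮y⟯ ∧
        Nonempty (galoisGroup (galoisClosure ℚ⟮x⟯) ≃* GL m F) := by
  have hpermα := exists_smul_root_eq hαf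
  have hpermβ := exists_smul_root_eq hβg
  have htransα := exists_smul_eq_of_cyclic hασ
  have htransβ := exists_smul_eq_of_cyclic hβσ
  have hirr {h : ℤ[X]} {r : ZMod n → Ω} (hh : h.Monic) (hn : h.natDegree = n)
      (hr : Function.Injective r) (hroot : aeval (r 0) h = 0)
      (htrans : ∀ i j, ∃ τ : Gal(Ω/ℚ), τ • r i = r j) :
      Irreducible (h.map (Int.castRingHom ℚ)) := by
    refine irreducible_of_injective_galois_orbit (hh.map _) ?_
      ((aeval_map_intCastRingHom h _).trans hroot) hr (htrans 0)
    rw [hh.natDegree_map, hn, ZMod.card]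
  have hfirr := hirr hf hfn hα ((hαf _).2 ⟨0, rfl⟩) htransα
  have hgirr := hirr hg hgn hβ ((hβg _).2 ⟨0, rfl⟩) htransβ
  refine ⟨hfirr, hgirr, fun x y hx hy => ?_⟩
  rw [aeval_map_intCastRingHom] at hx hy
  obtain ⟨i, rfl⟩ := (hαf x).1 hx
  obtain ⟨j, rfl⟩ := (hβg y).1 hy
  -- An automorphism permutes both families of labels and preserves incidence; `hlin` turns this
  -- pair of permutations into a matrix.
  obtain ⟨ρ, hρ⟩ := exists_linear_representation hpermα (eq_of_mulVec_eq_of_single hvsingle)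
    fun τ => by
      choose π hπ using hpermα τ
      choose π' hπ' using hpermβ τ
      have hinj : Function.Injective π' := fun a b hab =>
        hβ (smul_left_cancel τ (by rw [hπ', hπ', hab]))
      obtain ⟨A, hA⟩ := hlin π π' (fun a b hab => hα (smul_left_cancel τ (by rw [hπ, hπ, hab])))
        (Finite.surjective_of_injective hinj) fun a b => by rw [← hS, ← hS, ← hπ, ← hπ', hI]
      refine ⟨A, fun a b hab => ?_⟩
      rw [hA, hα ((hπ a).symm.trans hab)]
  have hρu : ∀ τ j j', τ • β j = β j' → u j' ᵥ* (ρ τ : Matrix m m F) = u j := fun τ j j' hj =>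
    vecMul_eq_of_smul_eq hpermα hI (fun i j => (hS i j).trans (hinc i j)) hdual hρ hj
  -- Distinct roots have distinct vectors, so the kernel of ρ fixes every root of f, as `hsurj`
  -- requires.
  have hrange : ρ.range = ⊤ := by
    refine hsurj ρ (fun τ hτ z hz => ?_) fun i => hρ _ _ _ (hασ i).symm
    obtain ⟨a, rfl⟩ := (hαf z).1 hz
    obtain ⟨b, hb⟩ := hpermα τ a
    have h1 := hρ τ a b hb
    rw [hτ, Units.val_one, one_mulVec] at h1
    rw [hv h1]
    exact hv h1 ▸ hb
  refine conclusions_of_linear_representation hpermα hpermβ htransα htransβ hv hu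
    (eq_of_mulVec_eq_of_single hvsingle) (eq_of_vecMul_eq_of_single husingle)
    (MonoidHom.range_eq_top.1 hrange) hρ hρu hmove hfirr hgirr ?_ ?_ ?_ i j
  · exact fun i => (aeval_map_intCastRingHom f _).trans ((hαf _).2 ⟨i, rfl⟩)
  · exact fun j => (aeval_map_intCastRingHom g _).trans ((hβg _).2 ⟨j, rfl⟩)
  · rw [hf.natDegree_map, hg.natDegree_map, hfn, hgn]
    exact hsylow

end CyclicRepresentation

/-! ### Linearity of collineations of the Fano plane. -/

section SepticLinear

open Matrix

/-- The points of the Fano plane in cyclic order. -/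
def septicVec : ZMod 7 → Fin 3 → ZMod 2 :=
  ![![1, 0, 0], ![0, 1, 0], ![0, 0, 1], ![1, 0, 1], ![1, 1, 1], ![1, 1, 0], ![0, 1, 1]]

/-- The lines of the Fano plane in cyclic order. -/
def septicCovec : ZMod 7 → Fin 3 → ZMod 2 :=
  ![![1, 1, 1], ![0, 1, 1], ![0, 0, 1], ![1, 0, 0], ![0, 1, 0], ![1, 0, 1], ![1, 1, 0]]

/-- The indices of the points on the line of index zero of the Fano plane. -/
def septicLine : Finset (ZMod 7) := {3, 5, 6}

theorem septicVec_add_eq_zero : ∀ j a b c : ZMod 7, a ≠ b → a ≠ c → b ≠ c → a - j ∈ septicLine →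
    b - j ∈ septicLine → c - j ∈ septicLine → septicVec a + septicVec b + septicVec c = 0 := by
  decide +kernel

theorem sub_mem_septicLine_iff : ∀ i j, i - j ∈ septicLine ↔ septicCovec j ⬝ᵥ septicVec i = 0 := by
  decide +kernel

set_option synthInstance.maxSize 2000 in
set_option synthInstance.maxHeartbeats 200000 in
-- A line determines its covector; this makes the action on lines contragredient to that on points.
theorem eq_septicCovec_of_forall_iff : ∀ j w, (∀ i, w ⬝ᵥ septicVec i = 0 ↔
    septicCovec j ⬝ᵥ septicVec i = 0) → w = septicCovec j := by
  decide +kernel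

theorem septicVec_injective : Function.Injective septicVec := by
  unfold Function.Injective
  decide +kernel

theorem septicCovec_injective : Function.Injective septicCovec := by
  unfold Function.Injective
  decide +kernel

theorem exists_septicVec_eq_single : ∀ c, ∃ i, septicVec i = Pi.single c 1 := by
  decide +kernel

theorem exists_septicCovec_eq_single : ∀ c, ∃ i, septicCovec i = Pi.single c 1 := by
  decide +kernel

/-- The matrix is prescribed on the basis vectors. Since three points of a line sum to zero,
agreement with π at two points of a line propagates to the third, and lines successively reach all
seven points. -/
theorem exists_matrix_of_septicLine_iff {π π' : ZMod 7 → ZMod 7} (hπ : Function.Injective π)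
    (h : ∀ i j, π i - π' j ∈ septicLine ↔ i - j ∈ septicLine) :
    ∃ A : Matrix (Fin 3) (Fin 3) (ZMod 2), ∀ i, A *ᵥ septicVec i = septicVec (π i) := by
  let A : Matrix (Fin 3) (Fin 3) (ZMod 2) := of fun r c => septicVec (π (![0, 1, 2] c)) r
  have hline (j a b c : ZMod 7) (ha : a - j ∈ septicLine) (hb : b - j ∈ septicLine)
      (hc : c - j ∈ septicLine) (hab : a ≠ b) (hac : a ≠ c) (hbc : b ≠ c)
      (h1 : A *ᵥ septicVec a = septicVec (π a)) (h2 : A *ᵥ septicVec b = septicVec (π b)) :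
      A *ᵥ septicVec c = septicVec (π c) :=
    mulVec_eq_of_relation (septicVec_add_eq_zero j a b c hab hac hbc ha hb hc)
      (septicVec_add_eq_zero (π' j) (π a) (π b) (π c) (hπ.ne hab) (hπ.ne hac) (hπ.ne hbc)
        ((h a j).2 ha) ((h b j).2 hb) ((h c j).2 hc)) h1 h2
  have h0 : A *ᵥ septicVec 0 = septicVec (π 0) := by
    rw [show septicVec 0 = Pi.single 0 1 by decide, mulVec_single_one]
    rfl
  have h1 : A *ᵥ septicVec 1 = septicVec (π 1) := by
    rw [show septicVec 1 = Pi.single 1 1 by decide, mulVec_single_one]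
    rfl
  have h2 : A *ᵥ septicVec 2 = septicVec (π 2) := by
    rw [show septicVec 2 = Pi.single 2 1 by decide, mulVec_single_one]
    rfl
  have h3 := hline 4 0 2 3 (by decide) (by decide) (by decide) (by decide) (by decide) (by decide)
    h0 h2
  have h4 := hline 5 1 3 4 (by decide) (by decide) (by decide) (by decide) (by decide) (by decide)
    h1 h3
  have h5 := hline 6 2 4 5 (by decide) (by decide) (by decide) (by decide) (by decide) (by decide)
    h2 h4
  have h6 := hline 0 3 5 6 (by decide) (by decide) (by decide) (by decide) (by decide) (by decide)
    h3 h5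
  have key : ∀ i : ZMod 7, i = 0 ∨ i = 1 ∨ i = 2 ∨ i = 3 ∨ i = 4 ∨ i = 5 ∨ i = 6 := by decide
  refine ⟨A, fun i => ?_⟩
  rcases key i with rfl | rfl | rfl | rfl | rfl | rfl | rfl <;> assumption

end SepticLinear

/-! ### The septic pair. -/

section SepticConclusion

open Matrix

universe w

variable {Ω : Type w} [Field Ω] [Algebra ℚ Ω] [IsAlgClosure ℚ Ω]

theorem exists_septic_configuration : ∃ (α β : ZMod 7 → Ω) (σ : Gal(Ω/ℚ)),
    Function.Injective α ∧ Function.Injective β ∧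
    (∀ z, aeval z septicP = 0 ↔ ∃ i, z = α i) ∧ (∀ z, aeval z septicQ = 0 ↔ ∃ i, z = β i) ∧
    (∀ i, α (i + 1) = σ (α i)) ∧ (∀ i, β (i + 1) = σ (β i)) ∧
    ∀ i j, septicC (β j) (α i) = 0 ↔ i - j ∈ septicLine := by
  have : CharZero Ω := algebraRat.charZero Ω
  refine exists_cyclic_configuration (C := septicC) (D := septicD) septicP_monic natDegree_septicP
    septicQ_monic natDegree_septicQ Nat.prime_two (by decide) map_septicC map_septicD
    septicC_mul_septicD (fun y => ⟨3, -3 * y, 23 * y ^ 6 - 36 * y ^ 5 + 57 * y ^ 4 + 232 * y ^ 3 -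
      360 * y ^ 2 - 393 * y + 126, 32 * y ^ 6 - 51 * y ^ 5 + 81 * y ^ 4 + 319 * y ^ 3 - 510 * y ^ 2
      - 534 * y + 183, by norm_num, fun x => ?_⟩)
    fun {k} _ _ h2 a ha => ?_
  · unfold septicC
    ring
  · rw [Nat.cast_ofNat] at h2
    have hper := minimalPeriod_of_aeval_septicP h2 ha
    -- The linking polynomial is X because p₇ and q₇ coincide modulo 2.
    refine ⟨hper, X, ?_⟩
    rw [aeval_X]
    refine ⟨?_, hper, fun i hi => ?_⟩
    · rw [aeval_septicP] at ha
      rw [aeval_septicQ]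
      linear_combination ha + (7 * a ^ 4 - 21 * a ^ 2 - 7 * a + 3) * h2
    · have hi' : i = 3 ∨ i = 5 ∨ i = 6 := by simpa [septicLine] using hi
      rcases hi' with rfl | rfl | rfl
      · exact septicD_pow_eight_ne_zero h2 ha
      · exact septicD_pow_thirtytwo_ne_zero h2 ha
      · exact septicD_pow_sixtyfour_ne_zero h2 ha

theorem septicCubic_monic : septicCubic.Monic := by
  unfold septicCubic
  monicity!

theorem septicQuartic_monic : septicQuartic.Monic := by
  unfold septicQuartic
  monicity!

/-- Frobenius orbits of length 7, 4 and 3 at the primes 2, 13 and 17 make the order of the image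
divisible by 84. -/
theorem range_eq_top_of_septicP {ρ : Gal(Ω/ℚ) →* GL (Fin 3) (ZMod 2)}
    (hρ : ∀ τ, ρ τ = 1 → ∀ z : Ω, aeval z septicP = 0 → τ z = z) : ρ.range = ⊤ := by
  refine eq_top_of_dvd_card_GL_fin_three_zmod_two ?_
  have h7 : 7 ∣ Nat.card ρ.range :=
    dvd_card_range_of_minimalPeriod hρ septicP_monic septicP_monic
      (natDegree_septicP ▸ by norm_num) Nat.prime_two fun h2 a ha =>
        ⟨ha, dvd_of_eq (minimalPeriod_of_aeval_septicP (by rwa [Nat.cast_ofNat] at h2) ha).symm⟩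
  have h4 : 4 ∣ Nat.card ρ.range :=
    dvd_card_range_of_minimalPeriod hρ septicP_monic septicQuartic_monic
      (by rw [show septicQuartic.natDegree = 4 by unfold septicQuartic; compute_degree!]; norm_num)
      (by norm_num) fun h a ha => dvd_minimalPeriod_of_aeval_septicQuartic h ha
  have h3 : 3 ∣ Nat.card ρ.range :=
    dvd_card_range_of_minimalPeriod hρ septicP_monic septicCubic_monic
      (by rw [show septicCubic.natDegree = 3 by unfold septicCubic; compute_degree!]; norm_num)
      (by norm_num) fun h a ha => dvd_minimalPeriod_of_aeval_septicCubic h ha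
  omega

theorem septic_conclusions : Irreducible polyP7 ∧ Irreducible polyQ7 ∧
    ∀ α β : Ω, aeval α polyP7 = 0 → aeval β polyQ7 = 0 →
      SylowConjugateFields ℚ⟮α⟯ ℚ⟮β⟯ ∧ IsEmpty (ℚ⟮α⟯ ≃+* ℚ⟮β⟯) ∧
      galoisClosure ℚ⟮α⟯ = galoisClosure ℚ⟮β⟯ ∧
      Nonempty (galoisGroup (galoisClosure ℚ⟮α⟯) ≃* GL (Fin 3) (ZMod 2)) := by
  obtain ⟨α, β, σ, hα, hβ, hαf, hβg, hασ, hβσ, hS⟩ := exists_septic_configuration (Ω := Ω)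
  rw [← map_septicP, ← map_septicQ]
  refine conclusions_of_cyclic_configuration (I := fun y x => septicC y x = 0) septicP_monic
    natDegree_septicP septicQ_monic natDegree_septicQ hα hβ hαf hβg hασ hβσ (fun τ y x => ?_) hS
    septicVec_injective septicCovec_injective exists_septicVec_eq_single
    exists_septicCovec_eq_single sub_mem_septicLine_iff eq_septicCovec_of_forall_iff
    (fun π π' hπ _ h => exists_matrix_of_septicLine_iff hπ h)
    (fun ρ hρ _ => range_eq_top_of_septicP hρ)
    (fun g i j => exists_notMem_covecStabilizer_of_fin_three ?_)
    fun i j hi hj p hp => exists_conj_subgroups_of_fin_three_zmod_two hi hj hp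
  · rw [show septicC (τ • y) (τ • x) = τ (septicC y x) from
      (map_septicC (τ : Ω →+* Ω) y x).symm, map_eq_zero]
  · revert j
    decide +kernel

end SepticConclusion

/-! ### Linearity of incidence-preserving permutations of the nonzero plane vectors over the field
with three elements. -/

section OcticLinear

open Matrix

/-- The nonzero vectors of the plane over the field with three elements, in the cyclic order given
by an element of order eight. -/
def octicVec : ZMod 8 → Fin 2 → ZMod 3 :=
  ![![1, 0], ![0, 1], ![1, 2], ![2, 2], ![2, 0], ![0, 2], ![2, 1], ![1, 1]]

/-- The nonzero covectors of the plane over the field with three elements, in cyclic order. -/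
def octicCovec : ZMod 8 → Fin 2 → ZMod 3 :=
  ![![1, 1], ![2, 1], ![0, 2], ![2, 0], ![2, 2], ![1, 2], ![0, 1], ![1, 0]]

/-- The indices of the points on the line of index zero. -/
def octicLine : Finset (ZMod 8) := {0, 1, 3}

theorem octicVec_add_eq_zero : ∀ j a b c : ZMod 8, a ≠ b → a ≠ c → b ≠ c → a - j ∈ octicLine →
    b - j ∈ octicLine → c - j ∈ octicLine → octicVec a + octicVec b + octicVec c = 0 := by
  decide +kernel

/-- The lines here are the affine lines u·v = 1 missing the origin. Two independent vectors lie on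
one of them, so distinct vectors on no common line are opposite. -/
theorem octicVec_eq_neg : ∀ a b : ZMod 8, a ≠ b →
    (∀ j, a - j ∈ octicLine → b - j ∉ octicLine) → octicVec b = -octicVec a := by
  decide +kernel

theorem sub_mem_octicLine_iff : ∀ i j, i - j ∈ octicLine ↔ octicCovec j ⬝ᵥ octicVec i = 1 := by
  decide +kernel

set_option synthInstance.maxSize 2000 in
set_option synthInstance.maxHeartbeats 200000 in
theorem eq_octicCovec_of_forall_iff : ∀ j w, (∀ i, w ⬝ᵥ octicVec i = 1 ↔
    octicCovec j ⬝ᵥ octicVec i = 1) → w = octicCovec j := by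
  decide +kernel

theorem octicVec_injective : Function.Injective octicVec := by
  unfold Function.Injective
  decide +kernel

theorem octicCovec_injective : Function.Injective octicCovec := by
  unfold Function.Injective
  decide +kernel

theorem octicVec_ne_zero : ∀ i, octicVec i ≠ 0 := by
  decide +kernel

theorem octicCovec_ne_zero : ∀ i, octicCovec i ≠ 0 := by
  decide +kernel

theorem exists_octicVec_eq_single : ∀ c, ∃ i, octicVec i = Pi.single c 1 := by
  decide +kernel

theorem exists_octicCovec_eq_single : ∀ c, ∃ i, octicCovec i = Pi.single c 1 := by
  decide +kernel

/-- Agreement with π propagates from the two basis vectors through lines, whose points sum to zero,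
and through opposite pairs, recognised as pairs on no common line. Surjectivity of `π'` is needed to
exclude every line in the second case. -/
theorem exists_matrix_of_octicLine_iff {π π' : ZMod 8 → ZMod 8} (hπ : Function.Injective π)
    (hπ' : Function.Surjective π') (h : ∀ i j, π i - π' j ∈ octicLine ↔ i - j ∈ octicLine) :
    ∃ A : Matrix (Fin 2) (Fin 2) (ZMod 3), ∀ i, A *ᵥ octicVec i = octicVec (π i) := by
  let A : Matrix (Fin 2) (Fin 2) (ZMod 3) := of fun r c => octicVec (π (![0, 1] c)) r
  have hline (j a b c : ZMod 8) (ha : a - j ∈ octicLine) (hb : b - j ∈ octicLine)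
      (hc : c - j ∈ octicLine) (hab : a ≠ b) (hac : a ≠ c) (hbc : b ≠ c)
      (h1 : A *ᵥ octicVec a = octicVec (π a)) (h2 : A *ᵥ octicVec b = octicVec (π b)) :
      A *ᵥ octicVec c = octicVec (π c) :=
    mulVec_eq_of_relation (octicVec_add_eq_zero j a b c hab hac hbc ha hb hc)
      (octicVec_add_eq_zero (π' j) (π a) (π b) (π c) (hπ.ne hab) (hπ.ne hac) (hπ.ne hbc)
        ((h a j).2 ha) ((h b j).2 hb) ((h c j).2 hc)) h1 h2
  have hneg (a b : ZMod 8) (hab : a ≠ b) (hj : ∀ j, a - j ∈ octicLine → b - j ∉ octicLine)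
      (h1 : A *ᵥ octicVec a = octicVec (π a)) : A *ᵥ octicVec b = octicVec (π b) := by
    rw [octicVec_eq_neg a b hab hj, mulVec_neg, h1,
      octicVec_eq_neg (π a) (π b) (hπ.ne hab) fun j' ha hb => ?_]
    obtain ⟨j, rfl⟩ := hπ' j'
    exact hj j ((h a j).1 ha) ((h b j).1 hb)
  have h0 : A *ᵥ octicVec 0 = octicVec (π 0) := by
    rw [show octicVec 0 = Pi.single 0 1 by decide, mulVec_single_one]
    rfl
  have h1 : A *ᵥ octicVec 1 = octicVec (π 1) := by
    rw [show octicVec 1 = Pi.single 1 1 by decide, mulVec_single_one]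
    rfl
  have h3 := hline 0 0 1 3 (by decide) (by decide) (by decide) (by decide) (by decide) (by decide)
    h0 h1
  have h7 := hneg 3 7 (by decide) (by decide) h3
  have h2 := hline 7 7 0 2 (by decide) (by decide) (by decide) (by decide) (by decide) (by decide)
    h7 h0
  have h4 := hneg 0 4 (by decide) (by decide) h0
  have h5 := hneg 1 5 (by decide) (by decide) h1
  have h6 := hneg 2 6 (by decide) (by decide) h2
  have key : ∀ i : ZMod 8, i = 0 ∨ i = 1 ∨ i = 2 ∨ i = 3 ∨ i = 4 ∨ i = 5 ∨ i = 6 ∨ i = 7 := by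
    decide
  refine ⟨A, fun i => ?_⟩
  rcases key i with rfl | rfl | rfl | rfl | rfl | rfl | rfl | rfl <;> assumption

/-- The cyclic shift has determinant −1; this excludes `SL₂(3)` as the Galois image. -/
theorem det_ne_one_of_mulVec_octicVec {A : Matrix (Fin 2) (Fin 2) (ZMod 3)}
    (hA : ∀ i, A *ᵥ octicVec i = octicVec (i + 1)) : A.det ≠ 1 := by
  have h0 := hA 0
  have h1 := hA 1
  rw [show octicVec 0 = Pi.single 0 1 by decide, mulVec_single_one] at h0
  rw [show octicVec 1 = Pi.single 1 1 by decide, mulVec_single_one] at h1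
  have h00 : A 0 0 = 0 := congrFun h0 0
  have h10 : A 1 0 = 1 := congrFun h0 1
  have h01 : A 0 1 = 1 := congrFun h1 0
  rw [det_fin_two, h00, h10, h01]
  simp only [zero_mul, mul_one]
  decide

end OcticLinear

/-! ### The octic pair. -/

section OcticConclusion

open Matrix

universe w

variable {Ω : Type w} [Field Ω] [Algebra ℚ Ω] [IsAlgClosure ℚ Ω]

theorem exists_octic_configuration : ∃ (α β : ZMod 8 → Ω) (σ : Gal(Ω/ℚ)),
    Function.Injective α ∧ Function.Injective β ∧
    (∀ z, aeval z octicP = 0 ↔ ∃ i, z = α i) ∧ (∀ z, aeval z octicQ = 0 ↔ ∃ i, z = β i) ∧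
    (∀ i, α (i + 1) = σ (α i)) ∧ (∀ i, β (i + 1) = σ (β i)) ∧
    ∀ i j, octicC (β j) (α i) = 0 ↔ i - j ∈ octicLine := by
  have : CharZero Ω := algebraRat.charZero Ω
  refine exists_cyclic_configuration (C := octicC) (D := octicD) octicP_monic natDegree_octicP
    octicQ_monic natDegree_octicQ Nat.prime_three (by decide) map_octicC map_octicD
    octicC_mul_octicD (fun y => ⟨17831, 17831 * y, -33 * y ^ 6 - 297 * y ^ 5 + 352 * y ^ 4 + 6567
      * y ^ 3 + 12529 * y ^ 2 - 13805 * y - 76164, -79 * y ^ 7 - 813 * y ^ 6 - 1156 * y ^ 5 + 8704 *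
      y ^ 4 + 20033 * y ^ 3 - 14855 * y ^ 2 - 71007 * y - 23065, by norm_num, fun x => ?_⟩)
    fun {k} _ _ h3 a ha => ?_
  · unfold octicC
    ring
  · rw [Nat.cast_ofNat] at h3
    have hg := aeval_octicLink_octicQ h3 ha
    refine ⟨minimalPeriod_of_aeval_octicP h3 ha, octicLink, hg,
      minimalPeriod_of_aeval_octicQ h3 hg, fun i hi => ?_⟩
    have hi' : i = 0 ∨ i = 1 ∨ i = 3 := by simpa [octicLine] using hi
    rcases hi' with rfl | rfl | rfl
    · rw [show a ^ 3 ^ (0 : ZMod 8).val = a from pow_one a]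
      exact octicD_self_ne_zero h3 ha
    · exact octicD_pow_three_ne_zero h3 ha
    · exact octicD_pow_twentyseven_ne_zero h3 ha

theorem octicSextic_monic : octicSextic.Monic := by
  unfold octicSextic
  monicity!

/-- Frobenius at 3 contributes the factor 8 and Frobenius at 2 the factor 3, so 24 divides the
order; the determinant of the image of σ excludes index two. -/
theorem range_eq_top_of_octicP {ρ : Gal(Ω/ℚ) →* GL (Fin 2) (ZMod 3)} {σ : Gal(Ω/ℚ)}
    (hρ : ∀ τ, ρ τ = 1 → ∀ z : Ω, aeval z octicP = 0 → τ z = z)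
    (hσ : ∀ i, (ρ σ : Matrix (Fin 2) (Fin 2) (ZMod 3)) *ᵥ octicVec i = octicVec (i + 1)) :
    ρ.range = ⊤ := by
  refine eq_top_of_dvd_card_GL_fin_two_zmod_three ?_ ⟨σ, rfl⟩ (det_ne_one_of_mulVec_octicVec hσ)
  have h8 : 8 ∣ Nat.card ρ.range :=
    dvd_card_range_of_minimalPeriod hρ octicP_monic octicP_monic
      (natDegree_octicP ▸ by norm_num) Nat.prime_three fun h3 a ha =>
        ⟨ha, dvd_of_eq (minimalPeriod_of_aeval_octicP (by rwa [Nat.cast_ofNat] at h3) ha).symm⟩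
  have h3 : 3 ∣ Nat.card ρ.range :=
    dvd_card_range_of_minimalPeriod hρ octicP_monic octicSextic_monic
      (by rw [show octicSextic.natDegree = 6 by unfold octicSextic; compute_degree!]; norm_num)
      Nat.prime_two fun h a ha => dvd_minimalPeriod_of_aeval_octicSextic h ha
  omega

theorem octic_conclusions : Irreducible polyP8 ∧ Irreducible polyQ8 ∧
    ∀ α β : Ω, aeval α polyP8 = 0 → aeval β polyQ8 = 0 →
      SylowConjugateFields ℚ⟮α⟯ ℚ⟮β⟯ ∧ IsEmpty (ℚ⟮α⟯ ≃+* ℚ⟮β⟯) ∧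
      galoisClosure ℚ⟮α⟯ = galoisClosure ℚ⟮β⟯ ∧
      Nonempty (galoisGroup (galoisClosure ℚ⟮α⟯) ≃* GL (Fin 2) (ZMod 3)) := by
  obtain ⟨α, β, σ, hα, hβ, hαf, hβg, hασ, hβσ, hS⟩ := exists_octic_configuration (Ω := Ω)
  rw [← map_octicP, ← map_octicQ]
  refine conclusions_of_cyclic_configuration (I := fun y x => octicC y x = 0) octicP_monic
    natDegree_octicP octicQ_monic natDegree_octicQ hα hβ hαf hβg hασ hβσ (fun τ y x => ?_) hS
    octicVec_injective octicCovec_injective exists_octicVec_eq_single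
    exists_octicCovec_eq_single sub_mem_octicLine_iff eq_octicCovec_of_forall_iff
    (fun π π' hπ hπ' h => exists_matrix_of_octicLine_iff hπ hπ' h)
    (fun ρ hρ hσ => range_eq_top_of_octicP hρ hσ)
    (fun g i j => exists_notMem_covecStabilizer_of_fin_two (fun h0 => octicVec_ne_zero i ?_)
      (octicCovec_ne_zero j))
    fun i j hi hj p hp => exists_conj_subgroups_of_fin_two_zmod_three (octicVec_ne_zero i)
      (octicCovec_ne_zero j) hi hj hp
  · rw [show octicC (τ • y) (τ • x) = τ (octicC y x) from
      (map_octicC (τ : Ω →+* Ω) y x).symm, map_eq_zero]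
  · rw [← one_mulVec (octicVec i), ← Units.val_one, ← inv_mul_cancel g, Units.val_mul,
      ← mulVec_mulVec, h0, mulVec_zero]

end OcticConclusion

theorem claim1p2 {Ω : Type*} [Field Ω] [Algebra ℚ Ω] [IsAlgClosure ℚ Ω] :
    -- (a) the pair `p₇`, `q₇`
    (Irreducible polyP7 ∧ Irreducible polyQ7 ∧
      ∀ α β : Ω, aeval α polyP7 = 0 → aeval β polyQ7 = 0 →
        SylowConjugateFields ℚ⟮α⟯ ℚ⟮β⟯ ∧
        IsEmpty (ℚ⟮α⟯ ≃+* ℚ⟮β⟯) ∧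
        galoisClosure ℚ⟮α⟯ = galoisClosure ℚ⟮β⟯ ∧
        Nonempty (galoisGroup (galoisClosure ℚ⟮α⟯) ≃*
          Matrix.ProjectiveSpecialLinearGroup (Fin 3) (ZMod 2))) ∧
    -- (b) the pair `p₈`, `q₈`
    (Irreducible polyP8 ∧ Irreducible polyQ8 ∧
      ∀ α β : Ω, aeval α polyP8 = 0 → aeval β polyQ8 = 0 →
        SylowConjugateFields ℚ⟮α⟯ ℚ⟮β⟯ ∧
        IsEmpty (ℚ⟮α⟯ ≃+* ℚ⟮β⟯) ∧
        galoisClosure ℚ⟮α⟯ = galoisClosure ℚ⟮β⟯ ∧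
        Nonempty (galoisGroup (galoisClosure ℚ⟮α⟯) ≃*
          Matrix.GeneralLinearGroup (Fin 2) (ZMod 3))) ∧
    -- a number field is not determined by the Sylow subgroups of its absolute Galois group
    (∃ K L : IntermediateField ℚ Ω, NumberField K ∧ NumberField L ∧
      IsEmpty (K ≃+* L) ∧ HaveIsomorphicSylows K.fixingSubgroup L.fixingSubgroup) := by
  have : IsAlgClosed Ω := IsAlgClosure.isAlgClosed ℚ
  obtain ⟨hP, hQ, h7⟩ := septic_conclusions (Ω := Ω)
  refine ⟨⟨hP, hQ, fun α β hα hβ => ?_⟩, octic_conclusions, ?_⟩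
  · obtain ⟨h1, h2, h3, ⟨e⟩⟩ := h7 α β hα hβ
    exact ⟨h1, h2, h3, nonempty_GL_mulEquiv_PSL_fin_three_zmod_two.map e.trans⟩
  · obtain ⟨α, hα⟩ := IsAlgClosed.exists_aeval_eq_zero Ω polyP7 hP.degree_pos.ne'
    obtain ⟨β, hβ⟩ := IsAlgClosed.exists_aeval_eq_zero Ω polyQ7 hQ.degree_pos.ne'
    obtain ⟨h1, h2, -, -⟩ := h7 α β hα hβ
    have hnf (x : Ω) : NumberField ℚ⟮x⟯ :=
      { to_charZero := algebraRat.charZero _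
        to_finiteDimensional := by
          -- The two `ℚ`-algebra structures on the field agree because such a structure is unique.
          convert finiteDimensional_adjoin_simple (k := ℚ) x
          · rfl
          · exact Subsingleton.elim _ _ }
    exact ⟨_, _, hnf α, hnf β, h2, SylowConjugateSubgroups.haveIsomorphicSylows h1⟩
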